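/- **Setting.** Let $\Omega\subset\mathbb R^2$ be a bounded connected open set with Lipschitz boundary, $\partial_D\Omega\subset\partial\Omega$ closed with $\mathcal H^1(\partial_D\Omega)>0$, and $\partial_N\Omega=\partial\Omega\setminus\partial_D\Omega$. Let $0<\sigma_0<\sigma_1<\overline\sigma<\sigma_{max}$ and let $\gamma:[0,\sigma_{max}]\to\overline\Omega$ be the arc-length parametrization of a simple $C^3$ arc $\Gamma$ with $\gamma(0),\gamma(\sigma_{max})\in\partial_N\Omega$ and $\gamma(s)\in\Omega$ for $0<s<\sigma_{max}$. Assume that $\Omega\setminus\Gamma$ is the disjoint union of two connected open sets $\Omega^+,\Omega^-$ with Lipschitz boundary, lying on the positive and the negative side of $\Gamma$ with respect to a unit normal field, and that $\mathcal H^1(\partial_D\Omega\cap\partial\Omega^\pm)>0$. Put $\Gamma(\sigma)=\gamma([0,\sigma])$. For $\sigma\in[\sigma_0,\overline\sigma]$ let $\Phi_\sigma:\Omega\to\Omega$ be a diffeomorphism which is the identity near $\partial\Omega$, leaves $\Omega^+$ and $\Omega^-$ invariant and maps $\Gamma(\sigma)$ onto $\Gamma(\sigma_0)$, with $0<c\le\det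 D\Phi_\sigma\le C$ uniformly in $\sigma$. Let $\Psi_\sigma=\Phi_\sigma^{-1}$ and $A(\sigma)=\det D\Psi_\sigma\,(D\Psi_\sigma)^{-1}(D\Psi_\sigma)^{-T}$, and assume that $\sigma\mapsto A(\sigma)$ is of class $C^2$ on $[\sigma_0,\overline\sigma]$, uniformly in $\Omega$. Let $T>0$, let $\psi\in W^{1,\infty}(0,T;H^1(\Omega))$ be bounded in $L^\infty(\Omega)$ uniformly in $t\in[0,T]$, with $\psi(t)$ supported in the set where all $\Phi_\sigma$ are the identity, and let $g\in W^{1,\infty}(0,T;L^2(\partial_N\Omega,\mathcal H^1))$ be such that the support of $g(t)$ does not meet $\Gamma$ for any $t\in[0,T]$. Let $V$ be the space of $v\in H^1(\Omega\setminus\Gamma(\sigma_0))$ with zero trace on $\partial_D\Omega$, with scalar product $(v,w)_V=\int Dv\cdot Dw\,dx$, and for $t\in[0,T]$, $v\in V$, $\sigma\in[\sigma_0,\overline\sigma]$ put $$\mathcal F(t,v,\sigma)=\int_{\Omega\setminus\Gamma(\sigma_0)}\big(A(\sigma)(Dv+D\psi(t))\,\big|\,Dv+D\psi(t)\big)\,dx+\sigma-\int_{\partial_N\Omega}g(t)\,(v+\psi(t))\,d\mathcal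 H^1 .$$ Denote by $\mathrm{grad}_v\mathcal F$ its gradient in $V$ with respect to $v$, and by $\partial_\sigma\mathcal F$ (one-sided at $\sigma_0$, $\overline\sigma$) and $\partial_t\mathcal F$ (which exists for a.e. $t$) its partial derivatives. Let $\lambda$ be a Lipschitz function on $[\sigma_0,\overline\sigma]$ with $\lambda=1$ on $[\sigma_0,\sigma_1]$, $\lambda>0$ on $(\sigma_1,\overline\sigma)$ and $\lambda(\overline\sigma)=0$. For $u_0\in V$ and $\varepsilon>0$, a solution of the modified $\varepsilon$-gradient flow with initial data $(u_0,\sigma_0)$ is a pair $v_\varepsilon\in C^1([0,T];V)$, $\sigma_\varepsilon\in C^1([0,T];[\sigma_0,\overline\sigma])$ with $\sigma_\varepsilon$ increasing (non-strictly), $v_\varepsilon(0)=u_0$, $\sigma_\varepsilon(0)=\sigma_0$ and, for every $t\in[0,T]$, $$\varepsilon\dot v_\varepsilon=-\mathrm{grad}_v\mathcal F(t,v_\varepsilon,\sigma_\varepsilon),\qquad \varepsilon\dot\sigma_\varepsilon=(-\partial_\sigma\mathcal F(t,v_\varepsilon,\sigma_\varepsilon))^+\lambda(\sigma_\varepsilon).$$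 **Theorem.** Let $u_0\in V$ be such that the initial configuration $(u_0,\sigma_0)$ is in equilibrium, $\mathrm{grad}_v\mathcal F(0,u_0,\sigma_0)=0$. Then the approximable irreversible quasistatic evolution problem on $[0,T]$ with initial data $(u_0,\sigma_0)$ has a solution: there is a left-continuous map $t\mapsto(v(t),\sigma(t))$ from $[0,T]$ into $V\times[\sigma_0,\overline\sigma]$ such that * for every $t\in[0,T]$: $\mathrm{grad}_v\mathcal F(t,v(t),\sigma(t))=0$ and $\partial_\sigma\mathcal F(t,v(t),\sigma(t))\,\lambda(\sigma(t))\ge0$; * $t\mapsto\sigma(t)$ is increasing (non-strictly); * $\tau\mapsto\partial_t\mathcal F(\tau,v(\tau),\sigma(\tau))$ is integrable on $(0,T)$ and, for all $0\le s<t\le T$, $\ \mathcal F(t,v(t),\sigma(t))\le\mathcal F(s,v(s),\sigma(s))+\int_s^t\partial_t\mathcal F(\tau,v(\tau),\sigma(\tau))\,d\tau$; * there are $\varepsilon_n>0$ with $\varepsilon_n\to0$, and solutions $(v_{\varepsilon_n},\sigma_{\varepsilon_n})$ of the modified $\varepsilon_n$-gradient flow with initial data $(u_0,\sigma_0)$,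 such that for a.e. $t\in[0,T]$: $\sigma_{\varepsilon_n}(t)\to\sigma(t)$ and $v_{\varepsilon_n}(t)\to v(t)$ strongly in $V$. -/

import Mathlib

open MeasureTheory Set Filter Topology

noncomputable section

/-- The Euclidean plane. -/
abbrev E2 : Type := EuclideanSpace ℝ (Fin 2)

/-! ### Lipschitz domains -/

/-- `U` has Lipschitz boundary: near each boundary point, in suitable Cartesian coordinates,
`U` is the region strictly above the graph of a Lipschitz function. -/
def HasLipschitzBoundary (U : Set E2) : Prop :=
  ∀ p ∈ frontier U, ∃ e : E2 ≃ᵃⁱ[ℝ] E2, ∃ f : ℝ → ℝ, ∃ K : NNReal, LipschitzWith K f ∧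
    ∃ W ∈ 𝓝 p, ∀ x ∈ W, (x ∈ U ↔ f (e x 0) < e x 1)

/-! ### The Sobolev space `H¹(U)` -/

/-- Square-integrable functions on `U`. -/
abbrev L2 (U : Set E2) : Type := Lp ℝ 2 (volume.restrict U)

/-- Square-integrable vector fields on `U`. -/
abbrev L2Vec (U : Set E2) : Type := Lp E2 2 (volume.restrict U)

/-- `G` is the distributional gradient of `u` on `U`. -/
def IsWeakGradient (U : Set E2) (u : E2 → ℝ) (G : E2 → E2) : Prop :=
  ∀ φ : E2 → ℝ, ContDiff ℝ (⊤ : ℕ∞) φ → HasCompactSupport φ → tsupport φ ⊆ U → ∀ e : E2,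
    ∫ x in U, u x * fderiv ℝ φ x e = - ∫ x in U, inner ℝ (G x) e * φ x

lemma memLp_test_deriv {U : Set E2} {φ : E2 → ℝ} (h : ContDiff ℝ (⊤ : ℕ∞) φ)
    (hc : HasCompactSupport φ) (e : E2) :
    MemLp (fun x => fderiv ℝ φ x e) 2 (volume.restrict U) := by
  have h1 : Continuous (fun x => fderiv ℝ φ x e) :=
    (h.continuous_fderiv (by simp)).clm_apply continuous_const
  have h2 : HasCompactSupport (fun x => fderiv ℝ φ x e) :=
    (hc.fderiv (𝕜 := ℝ)).comp_left (g := fun L : E2 →L[ℝ] ℝ => L e) (by simp)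
  exact (h1.memLp_of_hasCompactSupport h2).restrict U

lemma memLp_test_smul {U : Set E2} {φ : E2 → ℝ} (h : ContDiff ℝ (⊤ : ℕ∞) φ)
    (hc : HasCompactSupport φ) (e : E2) :
    MemLp (fun x => φ x • e) 2 (volume.restrict U) := by
  have h1 : Continuous (fun x => φ x • e) := h.continuous.smul continuous_const
  have h2 : HasCompactSupport (fun x => φ x • e) :=
    hc.comp_left (g := fun c : ℝ => c • e) (by simp)
  exact (h1.memLp_of_hasCompactSupport h2).restrict U

/-- The defining identity of the weak gradient, as an identity between `L²` scalar products. -/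
lemma isWeakGradient_iff {U : Set E2} (u : L2 U) (G : L2Vec U) :
    IsWeakGradient U u G ↔
      ∀ φ : E2 → ℝ, ∀ (h : ContDiff ℝ (⊤ : ℕ∞) φ) (hc : HasCompactSupport φ), tsupport φ ⊆ U →
        ∀ e : E2, inner ℝ ((memLp_test_deriv (U := U) h hc e).toLp) u
          + inner ℝ ((memLp_test_smul (U := U) h hc e).toLp) G = 0 := by
  have key : ∀ φ : E2 → ℝ, ∀ (h : ContDiff ℝ (⊤ : ℕ∞) φ) (hc : HasCompactSupport φ), ∀ e : E2,
      inner ℝ ((memLp_test_deriv (U := U) h hc e).toLp) u = ∫ x in U, u x * fderiv ℝ φ x e ∧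
      inner ℝ ((memLp_test_smul (U := U) h hc e).toLp) G =
        ∫ x in U, inner ℝ (G x) e * φ x := by
    intro φ h hc e
    constructor
    · rw [L2.inner_def]
      refine integral_congr_ae ?_
      filter_upwards [(memLp_test_deriv (U := U) h hc e).coeFn_toLp] with x hx
      rw [hx]; simp
    · rw [L2.inner_def]
      refine integral_congr_ae ?_
      filter_upwards [(memLp_test_smul (U := U) h hc e).coeFn_toLp] with x hx
      rw [hx, real_inner_smul_left, real_inner_comm]; ring
  constructor
  · intro H φ h hc hs e
    rw [(key φ h hc e).1, (key φ h hc e).2, H φ h hc hs e]; ring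
  · intro H φ h hc hs e
    have := H φ h hc hs e
    rw [(key φ h hc e).1, (key φ h hc e).2] at this
    linarith

/-- `H¹(U)`: pairs `(u, Du)` in `L²(U) × L²(U; ℝ²)` with `Du` the distributional gradient of `u`,
with the Hilbert norm `(‖u‖₂² + ‖Du‖₂²)^(1/2)`. -/
def H1 (U : Set E2) : Submodule ℝ (WithLp 2 (L2 U × L2Vec U)) where
  carrier := {p | IsWeakGradient U p.fst p.snd}
  zero_mem' := by
    rw [mem_ofPred_eq, isWeakGradient_iff]
    intro φ h hc hs e; simp
  add_mem' := by
    intro a b ha hb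
    rw [mem_ofPred_eq, isWeakGradient_iff] at ha hb ⊢
    intro φ h hc hs e
    have h1 := ha φ h hc hs e
    have h2 := hb φ h hc hs e
    rw [WithLp.add_fst, WithLp.add_snd, inner_add_right, inner_add_right]; linarith
  smul_mem' := by
    intro c a ha
    rw [mem_ofPred_eq, isWeakGradient_iff] at ha ⊢
    intro φ h hc hs e
    have h1 := ha φ h hc hs e
    rw [WithLp.smul_fst, WithLp.smul_snd, inner_smul_right, inner_smul_right, ← mul_add, h1,
      mul_zero]

lemma isClosed_H1 (U : Set E2) : IsClosed (H1 U : Set (WithLp 2 (L2 U × L2Vec U))) := by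
  have : (H1 U : Set (WithLp 2 (L2 U × L2Vec U))) =
      ⋂ (φ : E2 → ℝ) (h : ContDiff ℝ (⊤ : ℕ∞) φ) (hc : HasCompactSupport φ)
        (_ : tsupport φ ⊆ U) (e : E2),
        {p | inner ℝ ((memLp_test_deriv (U := U) h hc e).toLp) p.fst
          + inner ℝ ((memLp_test_smul (U := U) h hc e).toLp) p.snd = 0} := by
    ext p
    simp only [mem_iInter, mem_ofPred_eq]
    exact isWeakGradient_iff p.fst p.snd
  rw [this]
  refine isClosed_iInter fun φ => isClosed_iInter fun h => isClosed_iInter fun hc =>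
    isClosed_iInter fun _ => isClosed_iInter fun e => isClosed_eq ?_ continuous_const
  have c1 : Continuous fun p : WithLp 2 (L2 U × L2Vec U) => p.fst :=
    (WithLp.fstL 2 ℝ (L2 U) (L2Vec U)).continuous
  have c2 : Continuous fun p : WithLp 2 (L2 U × L2Vec U) => p.snd :=
    (WithLp.sndL 2 ℝ (L2 U) (L2Vec U)).continuous
  exact (continuous_const.inner c1).add (continuous_const.inner c2)

instance (U : Set E2) : CompleteSpace (H1 U) := (isClosed_H1 U).completeSpace_coe

/-- The function underlying an element of `H¹(U)`. -/
def h1Fn {U : Set E2} (u : H1 U) : L2 U := u.1.fst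

/-- The gradient of an element of `H¹(U)`. -/
def h1Grad {U : Set E2} (u : H1 U) : L2Vec U := u.1.snd

/-! ### Boundary traces -/

/-- `c` is the value at the boundary point `x` of the trace of `f : U → ℝ`, i.e. the limit of the
averages of `f` over `B(x, r) ∩ U` as `r → 0+`. For a Sobolev function on a domain with Lipschitz
boundary this limit exists at almost every boundary point, and is the usual trace. -/
def HasTraceAt (U : Set E2) (f : E2 → ℝ) (x : E2) (c : ℝ) : Prop :=
  Tendsto (fun r : ℝ => ⨍ y in Metric.ball x r ∩ U, f y) (𝓝[>] 0) (𝓝 c)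

/-- The trace of `f : U → ℝ`, as a function on the boundary. -/
def traceFn (U : Set E2) (f : E2 → ℝ) (x : E2) : ℝ :=
  limUnder (𝓝[>] (0 : ℝ)) fun r : ℝ => ⨍ y in Metric.ball x r ∩ U, f y

lemma integrable_ball_inter {U : Set E2} (u : L2 U) (x : E2) (r : ℝ) :
    IntegrableOn u (Metric.ball x r ∩ U) := by
  have h : MemLp u 2 (volume.restrict (Metric.ball x r ∩ U)) :=
    (Lp.memLp u).mono_measure (Measure.restrict_mono_set _ inter_subset_right)
  have : IsFiniteMeasure (volume.restrict (Metric.ball x r ∩ U)) :=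
    ⟨by
      rw [Measure.restrict_apply_univ]
      exact (measure_mono inter_subset_left).trans_lt measure_ball_lt_top⟩
  exact h.integrable (by norm_num)

lemma HasTraceAt.congr {U : Set E2} {f g : E2 → ℝ} {x : E2} {c : ℝ} (h : HasTraceAt U f x c)
    (hfg : f =ᵐ[volume.restrict U] g) : HasTraceAt U g x c := by
  refine Tendsto.congr (fun r => ?_) h
  refine average_congr ?_
  exact ae_mono (Measure.restrict_mono_set _ inter_subset_right) hfg

/-- The elements of `H¹(U)` whose trace vanishes `ℋ¹`-almost everywhere on `D`. -/
def H1Zero (U D : Set E2) : Submodule ℝ (H1 U) where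
  carrier := {u | ∀ᵐ x ∂(μH[1] : Measure E2).restrict D, HasTraceAt U (h1Fn u) x 0}
  zero_mem' := by
    rw [mem_ofPred_eq]
    refine Eventually.of_forall fun x => ?_
    have h0 : HasTraceAt U (fun _ => 0) x 0 := by simp [HasTraceAt]
    exact h0.congr (Lp.coeFn_zero ℝ 2 (volume.restrict U)).symm
  add_mem' := by
    intro a b ha hb
    rw [mem_ofPred_eq] at ha hb ⊢
    filter_upwards [ha, hb] with x hax hbx
    have h0 : HasTraceAt U (fun y => h1Fn a y + h1Fn b y) x 0 := by
      have := Tendsto.add hax hbx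
      rw [add_zero] at this
      refine this.congr fun r => ?_
      rw [setAverage_eq, setAverage_eq, setAverage_eq, integral_add, smul_add]
      · exact integrable_ball_inter (h1Fn a) x r
      · exact integrable_ball_inter (h1Fn b) x r
    exact h0.congr (Lp.coeFn_add (h1Fn a) (h1Fn b)).symm
  smul_mem' := by
    intro c a ha
    rw [mem_ofPred_eq] at ha ⊢
    filter_upwards [ha] with x hax
    have h0 : HasTraceAt U (fun y => c * h1Fn a y) x 0 := by
      have := Tendsto.const_mul c hax
      rw [mul_zero] at this
      refine this.congr fun r => ?_
      rw [setAverage_eq, setAverage_eq, integral_const_mul, smul_eq_mul, smul_eq_mul]; ring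
    refine h0.congr ?_
    filter_upwards [Lp.coeFn_smul c (h1Fn a)] with y hy
    exact hy.symm

/-! ### The space `V` with the norm `‖Dv‖₂` -/

/-- The space of `u ∈ H¹(U)` with zero trace on `D`, to be equipped with the scalar product
`(Du, Dw)` of `L²(U; ℝ²)`. -/
def DirichletSpace (U D : Set E2) : Type := H1Zero U D

namespace DirichletSpace

variable {U D : Set E2}

instance : AddCommGroup (DirichletSpace U D) := inferInstanceAs (AddCommGroup (H1Zero U D))

instance : Module ℝ (DirichletSpace U D) := inferInstanceAs (Module ℝ (H1Zero U D))

/-- The element of `H¹(U)` underlying an element of `V`. -/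
def toH1 (v : DirichletSpace U D) : H1 U := Subtype.val (p := fun u => u ∈ H1Zero U D) v

/-- The function underlying an element of `V`. -/
def fn (v : DirichletSpace U D) : L2 U := h1Fn v.toH1

/-- The gradient, as a linear map from `V` to `L²(U; ℝ²)`. -/
def grad : DirichletSpace U D →ₗ[ℝ] L2Vec U where
  toFun v := h1Grad v.toH1
  map_add' _ _ := rfl
  map_smul' _ _ := rfl

/-- The norm `‖v‖_V = ‖Dv‖₂`. -/
instance : SeminormedAddCommGroup (DirichletSpace U D) :=
  SeminormedAddCommGroup.induced (DirichletSpace U D) (L2Vec U)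
    (grad : DirichletSpace U D →ₗ[ℝ] L2Vec U)

/-- The scalar product `(v, w)_V = (Dv, Dw)`. -/
instance : InnerProductSpace ℝ (DirichletSpace U D) where
  norm_smul_le c v := by
    change ‖grad (c • v)‖ ≤ ‖c‖ * ‖grad v‖
    rw [map_smul, norm_smul]
  inner v w := inner ℝ (grad v) (grad w)
  norm_sq_eq_re_inner v := norm_sq_eq_re_inner (𝕜 := ℝ) (grad v)
  conj_inner_symm v w := inner_conj_symm (𝕜 := ℝ) (grad v) (grad w)
  add_left u v w := by
    change inner ℝ (grad (u + v)) (grad w) = _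
    rw [map_add, inner_add_left]
  smul_left v w c := by
    change inner ℝ (grad (c • v)) (grad w) = _
    rw [map_smul, inner_smul_left]

end DirichletSpace

/-! ### Vector-valued `W^{1,∞}(0,T)` -/

/-- `f` is (the continuous representative of) an element of `W^{1,∞}(0,T;X)`: it is the primitive
of an essentially bounded function `f'`, its weak derivative. -/
def MemW1Infty {X : Type*} [NormedAddCommGroup X] [NormedSpace ℝ X] [CompleteSpace X]
    (T : ℝ) (f : ℝ → X) : Prop :=
  ∃ f' : ℝ → X, MemLp f' ⊤ (volume.restrict (Ioc 0 T)) ∧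
    ∀ t ∈ Icc 0 T, f t = f 0 + ∫ s in (0 : ℝ)..t, f' s

/-! ### The model -/

/-- Rotation of the plane by a right angle. -/
def rot (x : E2) : E2 := !₂[-x 1, x 0]

/-- The coefficients produced in the Dirichlet integral by a change of variables `x = P y`:
`det DP(y) (DP(y))⁻¹ ((DP(y))⁻¹)ᵀ`. -/
def pullbackCoeff (P : E2 → E2) (y : E2) : E2 →L[ℝ] E2 :=
  (fderiv ℝ P y).det •
    ((fderiv ℝ P y).inverse ∘L ContinuousLinearMap.adjoint (fderiv ℝ P y).inverse)

/-- Reference configuration, crack path, changes of variables and loads. -/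
structure CrackModel where
  /-- The reference configuration. -/
  Ω : Set E2
  isOpen_Ω : IsOpen Ω
  isConnected_Ω : IsConnected Ω
  isBounded_Ω : Bornology.IsBounded Ω
  lipschitz_Ω : HasLipschitzBoundary Ω
  /-- The Dirichlet part of the boundary. -/
  dirichlet : Set E2
  dirichlet_subset : dirichlet ⊆ frontier Ω
  isClosed_dirichlet : IsClosed dirichlet
  dirichlet_pos : 0 < (μH[1] : Measure E2) dirichlet
  /-- Initial crack length. -/
  σ₀ : ℝ
  /-- Maximal admissible crack length. -/
  σbar : ℝ
  /-- Length of the extended arc, which cuts the body into two pieces. -/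
  σmax : ℝ
  σ₀_pos : 0 < σ₀
  σ₀_lt_σbar : σ₀ < σbar
  σbar_lt_σmax : σbar < σmax
  /-- Arc-length parametrization of the (extended) crack path. -/
  γ : ℝ → E2
  γ_contDiff : ContDiffOn ℝ 3 γ (Icc 0 σmax)
  γ_injOn : InjOn γ (Icc 0 σmax)
  γ_arcLength : ∀ s ∈ Icc 0 σmax, ‖derivWithin γ (Icc 0 σmax) s‖ = 1
  γ_left : γ 0 ∈ frontier Ω \ dirichlet
  γ_right : γ σmax ∈ frontier Ω \ dirichlet
  γ_mem : ∀ s ∈ Ioo 0 σmax, γ s ∈ Ω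
  /-- The part of the cut body on the positive side of the path. -/
  Ωpos : Set E2
  /-- The part of the cut body on the negative side of the path. -/
  Ωneg : Set E2
  cut : Ω \ γ '' Icc 0 σmax = Ωpos ∪ Ωneg
  disjoint_parts : Disjoint Ωpos Ωneg
  isOpen_pos : IsOpen Ωpos
  isOpen_neg : IsOpen Ωneg
  isConnected_pos : IsConnected Ωpos
  isConnected_neg : IsConnected Ωneg
  lipschitz_pos : HasLipschitzBoundary Ωpos
  lipschitz_neg : HasLipschitzBoundary Ωneg
  /-- `Ωpos` lies on the side of the unit normal `rot γ'`, and `Ωneg` on the other one. -/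
  oriented : ∀ s ∈ Ioo 0 σmax, ∀ᶠ δ in 𝓝[>] (0 : ℝ),
    γ s + δ • rot (deriv γ s) ∈ Ωpos ∧ γ s - δ • rot (deriv γ s) ∈ Ωneg
  dirichlet_pos_pos : 0 < (μH[1] : Measure E2) (dirichlet ∩ frontier Ωpos)
  dirichlet_neg_pos : 0 < (μH[1] : Measure E2) (dirichlet ∩ frontier Ωneg)
  /-- The diffeomorphisms `Φ_σ` of `Ω` taking the crack of length `σ` to that of length `σ₀`. -/
  Φ : ℝ → E2 → E2
  /-- The inverse diffeomorphisms. -/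
  Ψ : ℝ → E2 → E2
  Φ_contDiff : ∀ σ ∈ Icc σ₀ σbar, ContDiffOn ℝ 1 (Φ σ) Ω
  Ψ_contDiff : ∀ σ ∈ Icc σ₀ σbar, ContDiffOn ℝ 1 (Ψ σ) Ω
  Φ_mapsTo : ∀ σ ∈ Icc σ₀ σbar, MapsTo (Φ σ) Ω Ω
  Ψ_mapsTo : ∀ σ ∈ Icc σ₀ σbar, MapsTo (Ψ σ) Ω Ω
  inverse : ∀ σ ∈ Icc σ₀ σbar, InvOn (Ψ σ) (Φ σ) Ω Ω
  /-- `Φ_σ` is the identity near the boundary. -/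
  Φ_eq_id : ∀ σ ∈ Icc σ₀ σbar, ∃ K ⊆ Ω, IsCompact K ∧ ∀ x ∈ Ω \ K, Φ σ x = x
  Φ_pos : ∀ σ ∈ Icc σ₀ σbar, Φ σ '' Ωpos = Ωpos
  Φ_neg : ∀ σ ∈ Icc σ₀ σbar, Φ σ '' Ωneg = Ωneg
  Φ_crack : ∀ σ ∈ Icc σ₀ σbar, Φ σ '' (γ '' Icc 0 σ ∩ Ω) = γ '' Icc 0 σ₀ ∩ Ω
  Φ_det : ∃ c C : ℝ, 0 < c ∧ ∀ σ ∈ Icc σ₀ σbar, ∀ x ∈ Ω,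
    c ≤ (fderiv ℝ (Φ σ) x).det ∧ (fderiv ℝ (Φ σ) x).det ≤ C
  /-- The transformed coefficients are of class `C²` in `σ`, uniformly in the space variable. -/
  coeff_contDiff : ∃ a : ℝ → BoundedContinuousFunction Ω (E2 →L[ℝ] E2),
    ContDiffOn ℝ 2 a (Icc σ₀ σbar) ∧
      ∀ σ ∈ Icc σ₀ σbar, ∀ y : Ω, a σ y = pullbackCoeff (Ψ σ) y
  /-- The time horizon. -/
  T : ℝ
  T_pos : 0 < T
  /-- The imposed boundary displacement, extended to the body. -/
  ψ : ℝ → H1 Ω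
  ψ_mem : MemW1Infty T ψ
  ψ_bounded : ∃ M : ℝ, ∀ t ∈ Icc 0 T, ∀ᵐ x ∂volume.restrict Ω, |h1Fn (ψ t) x| ≤ M
  /-- `ψ(t)` is supported where all the changes of variables are the identity. -/
  ψ_support : ∀ t ∈ Icc 0 T, ∀ᵐ x ∂volume.restrict Ω,
    (∃ σ ∈ Icc σ₀ σbar, Φ σ x ≠ x) → h1Fn (ψ t) x = 0
  /-- The density of the applied boundary forces. -/
  g : ℝ → Lp ℝ 2 ((μH[1] : Measure E2).restrict (frontier Ω \ dirichlet))
  g_mem : MemW1Infty T g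
  /-- The support of `g(t)` does not meet the crack path. -/
  g_support : ∀ t ∈ Icc 0 T, ∀ x ∈ γ '' Icc 0 σmax, ∃ r > 0,
    ∀ᵐ y ∂(μH[1] : Measure E2).restrict (frontier Ω \ dirichlet),
      y ∈ Metric.ball x r → g t y = 0

namespace CrackModel

variable (M : CrackModel)

/-- The Neumann part of the boundary. -/
def neumann : Set E2 := frontier M.Ω \ M.dirichlet

/-- The body with the initial crack removed. -/
def body : Set E2 := M.Ω \ M.γ '' Icc 0 M.σ₀

/-- The space `V` of `H¹` functions on the initially cracked body with zero trace on the Dirichlet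
part of the boundary, with `‖v‖_V = ‖Dv‖₂`. -/
abbrev V : Type := DirichletSpace M.body M.dirichlet

/-- The coefficient matrix `A(σ)` at the point `y`. -/
def A (σ : ℝ) (y : E2) : E2 →L[ℝ] E2 := pullbackCoeff (M.Ψ σ) y

/-- The total energy `ℱ(t, v, σ)` on the fixed domain. -/
def F (t : ℝ) (v : M.V) (σ : ℝ) : ℝ :=
  (∫ y in M.body, inner ℝ (M.A σ y (DirichletSpace.grad v y + h1Grad (M.ψ t) y))
      (DirichletSpace.grad v y + h1Grad (M.ψ t) y))
    + σ
    - ∫ x in M.neumann, M.g t x * (traceFn M.body v.fn x + traceFn M.Ω (h1Fn (M.ψ t)) x) ∂μH[1]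

/-- `G = grad_v ℱ(t, v, σ)`: the element `G` of `V` represents, through the scalar product of `V`,
the Fréchet differential of `ℱ(t, ·, σ)` at `v`. -/
def IsGradV (t : ℝ) (v : M.V) (σ : ℝ) (G : M.V) : Prop :=
  HasFDerivAt (fun w : M.V => M.F t w σ) (innerSL ℝ G) v

/-- `∂_σ ℱ(t, v, σ)`, one-sided at the endpoints of `[σ₀, σbar]`. -/
def dσF (t : ℝ) (v : M.V) (σ : ℝ) : ℝ :=
  derivWithin (fun s => M.F t v s) (Icc M.σ₀ M.σbar) σ

/-- `∂_t ℱ(t, v, σ)` (defined for almost every `t`). -/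
def dtF (t : ℝ) (v : M.V) (σ : ℝ) : ℝ :=
  derivWithin (fun s => M.F s v σ) (Icc 0 M.T) t

/-- The penalization factors: Lipschitz functions on `[σ₀, σbar]`, equal to `1` up to `σ₁`, positive
between `σ₁` and `σbar`, and zero at `σbar`. -/
structure IsCutoff (σ₁ : ℝ) (lam : ℝ → ℝ) : Prop where
  lipschitz : ∃ K : NNReal, LipschitzOnWith K lam (Icc M.σ₀ M.σbar)
  eq_one : ∀ σ ∈ Icc M.σ₀ σ₁, lam σ = 1
  pos : ∀ σ ∈ Ioo σ₁ M.σbar, 0 < lam σ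
  eq_zero : lam M.σbar = 0

/-- `(v, σ)` is a (`C¹`) solution on `[0,T]` to the modified `ε`-gradient flow
`ε v' = - grad_v ℱ(t, v, σ)`, `ε σ' = (-∂_σ ℱ(t, v, σ))⁺ λ(σ)` with initial data `(u₀, σ₀)`. -/
structure IsGradientFlow (lam : ℝ → ℝ) (u₀ : M.V) (ε : ℝ) (v : ℝ → M.V) (σ : ℝ → ℝ) : Prop where
  mem : ∀ t ∈ Icc 0 M.T, σ t ∈ Icc M.σ₀ M.σbar
  monotone : MonotoneOn σ (Icc 0 M.T)
  eq_v : ∃ v' : ℝ → M.V, ContinuousOn v' (Icc 0 M.T) ∧ ∀ t ∈ Icc 0 M.T,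
    HasDerivWithinAt v (v' t) (Icc 0 M.T) t ∧ M.IsGradV t (v t) (σ t) (-(ε • v' t))
  eq_σ : ∃ σ' : ℝ → ℝ, ContinuousOn σ' (Icc 0 M.T) ∧ ∀ t ∈ Icc 0 M.T,
    HasDerivWithinAt σ (σ' t) (Icc 0 M.T) t ∧
      ε * σ' t = max (-M.dσF t (v t) (σ t)) 0 * lam (σ t)
  init_v : v 0 = u₀
  init_σ : σ 0 = M.σ₀

/-- `t ↦ (v(t), σ(t))` is an approximable irreversible quasistatic evolution on `[0,T]` with initial
data `(u₀, σ₀)`. -/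
structure IsApproximableEvolution (lam : ℝ → ℝ) (u₀ : M.V) (v : ℝ → M.V) (σ : ℝ → ℝ) :
    Prop where
  mem : ∀ t ∈ Icc 0 M.T, σ t ∈ Icc M.σ₀ M.σbar
  left_continuous : ∀ t ∈ Icc 0 M.T,
    ContinuousWithinAt v (Icc 0 t) t ∧ ContinuousWithinAt σ (Icc 0 t) t
  equilibrium : ∀ t ∈ Icc 0 M.T, M.IsGradV t (v t) (σ t) 0
  stability : ∀ t ∈ Icc 0 M.T, 0 ≤ M.dσF t (v t) (σ t) * lam (σ t)
  irreversibility : MonotoneOn σ (Icc 0 M.T)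
  energy_integrable :
    IntervalIntegrable (fun τ => M.dtF τ (v τ) (σ τ)) volume 0 M.T
  energy_inequality : ∀ s t, 0 ≤ s → s < t → t ≤ M.T →
    M.F t (v t) (σ t) ≤ M.F s (v s) (σ s) + ∫ τ in s..t, M.dtF τ (v τ) (σ τ)
  approximable : ∃ (ε : ℕ → ℝ) (vε : ℕ → ℝ → M.V) (σε : ℕ → ℝ → ℝ),
    (∀ n, 0 < ε n) ∧ Tendsto ε atTop (𝓝 0) ∧
    (∀ n, M.IsGradientFlow lam u₀ (ε n) (vε n) (σε n)) ∧
    ∀ᵐ t ∂volume.restrict (Icc 0 M.T),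
      Tendsto (fun n => σε n t) atTop (𝓝 (σ t)) ∧ Tendsto (fun n => vε n t) atTop (𝓝 (v t))

end CrackModel

end

/-! ### Increments of Sobolev functions along segments. -/

noncomputable section

/-! The evolution is a vanishing-viscosity limit of the gradient flows. For fixed `σ` the energy is
a quadratic, uniformly convex function of `v`, so the state in equilibrium with `(t, σ)` is unique
and is a Lipschitz function `w t σ` (`EnergySystem.exists_critical`). Hence only the scalar `σ`
needs a compactness argument, and since it is monotone in time Helly's theorem supplies it.

The flows exist on all of `[0, T]`, with a bound on `v` independent of `ε`, by Picard–Lindelöf for a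
truncated field and coercivity (`EnergySystem.exists_flow`). The energy balance, together with the
bounded total growth of `σ`, shows that the integral over `[0, T]` of `‖grad_v E‖² + (-∂_σ E)⁺ λ` is
at most `C ε` (`EnergySystem.exists_dissipation_bound`). With `ε_n = 2^{-n}` this integrand tends to
zero at almost every time. Convexity turns `grad_v E → 0` into `v_n - w(t, σ_n) → 0`, which gives
strong convergence, and the other term gives the stability condition in the limit
(`EnergySystem.exists_limit_of_flows`). The limit length is then made left-continuous and `v(t)` is
defined as `w(t, σ(t))`. Each time is a limit of times at which the flows converge, so every
condition extends to all times by continuity. The energy inequality survives because the dissipated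
energy has a sign (`EnergySystem.exists_evolution`).

This scheme requires `V` to be a Hilbert space for the norm `‖Dv‖₂`, with a bounded trace operator.
The cracked body is not assumed to be Lipschitz, but the extended arc is a null set which cuts it
into two connected Lipschitz domains, each touching the Dirichlet part in positive length. On such a
domain both the Poincaré–Wirtinger inequality (`isPoincareSet_self`) and the trace theorem
(`hasTraceBound_frontier`) come from one fact: increments of a Sobolev function are integrals of its
weak gradient along segments (`IsWeakGradient.increment`). Traces are limits of averages over small
balls, hence local, so that near an outer boundary point off the arc they may be computed on
whichever piece coincides there with the body.

Finally, in the plane a matrix `d Q Qᵀ` with `d det Q = 1` is elliptic as soon as it is bounded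
(`ellipticity_of_norm_le`). The transformed energy is therefore a uniformly coercive quadratic
energy with Lipschitz loads (`CrackModel.exists_quadraticData`), to which the abstract result
applies. -/

lemma measurePreserving_shear (h : E2) (τ : Measure ℝ) [SFinite τ] :
    MeasurePreserving (fun p : ℝ × E2 => (p.1, p.2 + p.1 • h)) (τ.prod volume) (τ.prod volume) := by
  refine MeasurePreserving.skew_product (g := fun t z => z + t • h) (MeasurePreserving.id τ) ?_ ?_
  · fun_prop
  · exact Eventually.of_forall fun t => (measurePreserving_add_right volume (t • h)).map_eq

lemma integrable_shear {F : Type*} [NormedAddCommGroup F] {G : E2 → F} (hG : Integrable G) (h : E2)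
    (τ : Measure ℝ) [IsFiniteMeasure τ] :
    Integrable (fun p : ℝ × E2 => G (p.2 + p.1 • h)) (τ.prod volume) :=
  (measurePreserving_shear h τ).integrable_comp_of_integrable (hG.comp_snd τ)

/-- A function with a weak gradient is, in almost every point, the integral of that gradient along
segments of a given direction. -/
lemma IsWeakGradient.increment {U O : Set E2} {u : E2 → ℝ} {G : E2 → E2}
    (hw : IsWeakGradient U u G) (hU : IsOpen U) (hO : IsOpen O)
    (hu : IntegrableOn u U) (hG : IntegrableOn G U) (h : E2)
    (hseg : ∀ z ∈ O, ∀ t ∈ Icc (0 : ℝ) 1, z + t • h ∈ U) :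
    ∀ᵐ z, z ∈ O → u (z + h) - u z = ∫ t in (0 : ℝ)..1, inner ℝ (G (z + t • h)) h := by
  set τ : Measure ℝ := volume.restrict (Ioc (0 : ℝ) 1) with hτ
  set u' : E2 → ℝ := U.indicator u with hu'
  set G' : E2 → E2 := U.indicator G with hG'
  have iu : Integrable u' := (integrable_indicator_iff hU.measurableSet).2 hu
  have iG : Integrable G' := (integrable_indicator_iff hU.measurableSet).2 hG
  have iGh : Integrable fun z => inner ℝ (G' z) h := iG.inner_const h
  have iGs := integrable_shear iGh h τ
  have iK : Integrable fun z => ∫ t, inner ℝ (G' (z + t • h)) h ∂τ := iGs.integral_prod_right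
  have ius : Integrable fun z => u' (z + h) := iu.comp_add_right h
  -- Test against `φ` supported in `O`. The translation moves onto `φ`, whose increment `φ(z - h) -
  -- φ(z)` is the integral over `t` of `-∂_h φ(z - th)`. By `hseg` each translate `φ(· - th)` is
  -- still supported in `U`, hence admissible in the weak formulation, and Fubini concludes.
  have main : ∀ᵐ z, z ∈ O → u' (z + h) - u' z - ∫ t, inner ℝ (G' (z + t • h)) h ∂τ = 0 := by
    refine hO.ae_eq_zero_of_integral_contDiff_smul_eq_zero
      (((ius.sub iu).sub iK).locallyIntegrable.locallyIntegrableOn O) ?_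
    intro φ hφ hφc hφO
    have cφ : Continuous φ := hφ.continuous
    have cdφ : Continuous (fderiv ℝ φ) := hφ.continuous_fderiv (by simp)
    obtain ⟨B, hB⟩ := hφc.exists_bound_of_continuous cφ
    obtain ⟨B', hB'⟩ := (hφc.fderiv (𝕜 := ℝ)).exists_bound_of_continuous cdφ
    have iφu : Integrable fun z => φ z * u' z :=
      iu.bdd_mul cφ.aestronglyMeasurable (Eventually.of_forall hB)
    have iφus : Integrable fun z => φ z * u' (z + h) :=
      ius.bdd_mul cφ.aestronglyMeasurable (Eventually.of_forall hB)
    have iφK : Integrable fun z => φ z * ∫ t, inner ℝ (G' (z + t • h)) h ∂τ :=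
      iK.bdd_mul cφ.aestronglyMeasurable (Eventually.of_forall hB)
    have e1 : ∫ z, φ z * u' (z + h) = ∫ z, φ (z - h) * u' z := by
      rw [← integral_add_right_eq_self (fun z => φ (z - h) * u' z) h]
      simp
    have e2 : ∀ z, φ (z - h) - φ z = ∫ t, - (fderiv ℝ φ (z - t • h) h) ∂τ := by
      intro z
      have hd : ∀ t ∈ uIcc (0 : ℝ) 1,
          HasDerivAt (fun t : ℝ => φ (z - t • h)) (- (fderiv ℝ φ (z - t • h) h)) t := by
        intro t _
        have h1 : HasDerivAt (fun t : ℝ => z - t • h) (-h) t := by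
          simpa using ((hasDerivAt_id t).smul_const h).const_sub z
        have h2 := (hφ.differentiable (by simp) (z - t • h)).hasFDerivAt.comp_hasDerivAt t h1
        exact h2.congr_deriv (by simp)
      have hc : Continuous fun t : ℝ => - (fderiv ℝ φ (z - t • h) h) := by fun_prop
      have := intervalIntegral.integral_eq_sub_of_hasDerivAt hd (hc.intervalIntegrable _ _)
      rw [intervalIntegral.integral_of_le zero_le_one] at this
      rw [hτ, this]; simp
    have e3 : ∀ t ∈ Ioc (0 : ℝ) 1, ∫ z, - (fderiv ℝ φ (z - t • h) h) * u' z
        = ∫ z, inner ℝ (G' (z + t • h)) h * φ z := by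
      intro t ht
      have hφt : ContDiff ℝ (⊤ : ℕ∞) fun z => φ (z - t • h) :=
        hφ.comp (contDiff_id.sub contDiff_const)
      have hct : HasCompactSupport fun z => φ (z - t • h) :=
        hφc.comp_homeomorph (Homeomorph.subRight (t • h))
      have hst : tsupport (fun z => φ (z - t • h)) ⊆ U := by
        have : tsupport (fun z => φ (z - t • h)) = (Homeomorph.subRight (t • h)) ⁻¹' tsupport φ :=
          tsupport_comp_eq_preimage φ (Homeomorph.subRight (t • h))
        rw [this]
        intro z hz
        have := hseg _ (hφO hz) t ⟨ht.1.le, ht.2⟩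
        simpa using this
      have hwt := hw _ hφt hct hst h
      have hfd : ∀ z, fderiv ℝ (fun z => φ (z - t • h)) z h = fderiv ℝ φ (z - t • h) h := by
        intro z
        rw [fderiv_comp_sub]
      have l1 : ∫ z, - (fderiv ℝ φ (z - t • h) h) * u' z
          = - ∫ z in U, u z * fderiv ℝ (fun z => φ (z - t • h)) z h := by
        rw [← integral_indicator hU.measurableSet, ← integral_neg]
        refine integral_congr_ae (Eventually.of_forall fun z => ?_)
        by_cases hz : z ∈ U
        · simp [hu', hz, hfd]; ring
        · simp [hu', hz]
      have l2 : ∫ z in U, inner ℝ (G z) h * φ (z - t • h)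
          = ∫ z, inner ℝ (G' (z + t • h)) h * φ z := by
        rw [← integral_indicator hU.measurableSet, ← integral_add_right_eq_self _ (t • h)]
        refine integral_congr_ae (Eventually.of_forall fun z => ?_)
        by_cases hz : z + t • h ∈ U
        · simp [hG', hz]
        · simp [hG', hz]
      rw [l1, hwt, neg_neg, l2]
    have iF1 : Integrable (fun p : E2 × ℝ => - (fderiv ℝ φ (p.1 - p.2 • h) h) * u' p.1)
        (volume.prod τ) := by
      refine (iu.comp_fst τ).bdd_mul (c := B' * ‖h‖) ?_ (Eventually.of_forall fun p => ?_)
      · exact Continuous.aestronglyMeasurable (by fun_prop)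
      · rw [norm_neg]
        exact (ContinuousLinearMap.le_opNorm _ _).trans (by gcongr; exact hB' _)
    have iF2 : Integrable (fun p : ℝ × E2 => inner ℝ (G' (p.2 + p.1 • h)) h * φ p.2)
        (τ.prod volume) := by
      refine iGs.mul_bdd (c := B) ?_ (Eventually.of_forall fun p => hB _)
      exact Continuous.aestronglyMeasurable (by fun_prop)
    have key : ∫ z, (φ (z - h) - φ z) * u' z
        = ∫ z, φ z * ∫ t, inner ℝ (G' (z + t • h)) h ∂τ := by
      calc ∫ z, (φ (z - h) - φ z) * u' z
          = ∫ z, ∫ t, - (fderiv ℝ φ (z - t • h) h) * u' z ∂τ := by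
            refine integral_congr_ae (Eventually.of_forall fun z => ?_)
            dsimp only
            rw [e2 z, ← integral_mul_const]
        _ = ∫ t, (∫ z, - (fderiv ℝ φ (z - t • h) h) * u' z) ∂τ := integral_integral_swap iF1
        _ = ∫ t, (∫ z, inner ℝ (G' (z + t • h)) h * φ z) ∂τ := by
            refine setIntegral_congr_fun measurableSet_Ioc fun t ht => e3 t ht
        _ = ∫ z, ∫ t, inner ℝ (G' (z + t • h)) h * φ z ∂τ := integral_integral_swap iF2
        _ = _ := by
            refine integral_congr_ae (Eventually.of_forall fun z => ?_)
            dsimp only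
            rw [integral_mul_const, mul_comm]
    have iφsu : Integrable fun z => φ (z - h) * u' z :=
      iu.bdd_mul (Continuous.aestronglyMeasurable (by fun_prop)) (Eventually.of_forall fun z => hB _)
    calc ∫ z, φ z • (u' (z + h) - u' z - ∫ t, inner ℝ (G' (z + t • h)) h ∂τ)
        = ∫ z, (φ z * u' (z + h) - φ z * u' z
            - φ z * ∫ t, inner ℝ (G' (z + t • h)) h ∂τ) := by
          refine integral_congr_ae (Eventually.of_forall fun z => ?_)
          simp only [smul_eq_mul]; ring
      _ = 0 := by
          have s1 := integral_sub (iφus.sub iφu) iφK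
          simp only [Pi.sub_apply] at s1
          rw [s1, integral_sub iφus iφu, e1, ← integral_sub iφsu iφu, ← key, sub_eq_zero]
          refine integral_congr_ae (Eventually.of_forall fun z => ?_)
          ring
  filter_upwards [main] with z hz hzO
  have := hz hzO
  have m0 : z ∈ U := by simpa using hseg z hzO 0 (by simp)
  have m1 : z + h ∈ U := by simpa using hseg z hzO 1 (by simp)
  rw [hu', indicator_of_mem m0, indicator_of_mem m1, sub_eq_zero] at this
  rw [this, intervalIntegral.integral_of_le zero_le_one]
  refine setIntegral_congr_fun measurableSet_Ioc fun t ht => ?_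
  simp only [hG', indicator_of_mem (hseg z hzO t ⟨ht.1.le, ht.2⟩)]

/-- `L²` bound for the increments of a function by the norm of its weak gradient. -/
lemma IsWeakGradient.lintegral_increment_le {U O : Set E2} {u : E2 → ℝ} {G : E2 → E2}
    (hw : IsWeakGradient U u G) (hU : IsOpen U) (hO : IsOpen O)
    (hu : IntegrableOn u U) (hG : IntegrableOn G U) (h : E2)
    (hseg : ∀ z ∈ O, ∀ t ∈ Icc (0 : ℝ) 1, z + t • h ∈ U) :
    ∫⁻ z in O, ‖u (z + h) - u z‖ₑ ^ 2 ≤ ‖h‖ₑ ^ 2 * ∫⁻ z in U, ‖G z‖ₑ ^ 2 := by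
  set τ : Measure ℝ := volume.restrict (Ioc (0 : ℝ) 1) with hτ
  have hτ1 : IsProbabilityMeasure τ := ⟨by simp [hτ]⟩
  set G' : E2 → E2 := U.indicator G with hG'
  have iG : Integrable G' := (integrable_indicator_iff hU.measurableSet).2 hG
  have iGs := integrable_shear iG h τ
  have sec : ∀ᵐ z, AEStronglyMeasurable (fun t => G' (z + t • h)) τ :=
    iGs.swap.aestronglyMeasurable.prodMk_left
  calc ∫⁻ z in O, ‖u (z + h) - u z‖ₑ ^ 2
      ≤ ∫⁻ z in O, ‖h‖ₑ ^ 2 * ∫⁻ t, ‖G' (z + t • h)‖ₑ ^ 2 ∂τ := by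
        refine lintegral_mono_ae ?_
        filter_upwards [ae_restrict_of_ae (hw.increment hU hO hu hG h hseg), ae_restrict_of_ae sec,
          ae_restrict_mem hO.measurableSet] with z hz hsec hzO
        rw [hz hzO, intervalIntegral.integral_of_le zero_le_one]
        have b1 : ‖∫ t in Ioc (0:ℝ) 1, inner ℝ (G (z + t • h)) h‖ₑ
            ≤ ‖h‖ₑ * ∫⁻ t, ‖G' (z + t • h)‖ₑ ∂τ := by
          refine (enorm_integral_le_lintegral_enorm _).trans ?_
          rw [← lintegral_const_mul'' _ hsec.enorm]
          refine setLIntegral_mono_ae' measurableSet_Ioc (Eventually.of_forall fun t ht => ?_)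
          rw [hG', indicator_of_mem (hseg z hzO t ⟨ht.1.le, ht.2⟩), mul_comm]
          simp only [← ofReal_norm, ← ENNReal.ofReal_mul (norm_nonneg _)]
          exact ENNReal.ofReal_le_ofReal (norm_inner_le_norm _ _)
        -- Cauchy–Schwarz against the constant 1 for the probability measure `τ`.
        have b2 : (∫⁻ t, ‖G' (z + t • h)‖ₑ ∂τ) ^ 2 ≤ ∫⁻ t, ‖G' (z + t • h)‖ₑ ^ 2 ∂τ := by
          have := ENNReal.lintegral_mul_le_Lp_mul_Lq τ Real.HolderConjugate.two_two
            hsec.enorm (aemeasurable_const (b := (1 : ENNReal)))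
          simp only [Pi.mul_apply, mul_one, one_pow, ENNReal.one_rpow, lintegral_const, measure_univ,
            ENNReal.rpow_ofNat] at this
          calc (∫⁻ t, ‖G' (z + t • h)‖ₑ ∂τ) ^ 2
              ≤ ((∫⁻ t, ‖G' (z + t • h)‖ₑ ^ 2 ∂τ) ^ (1 / 2 : ℝ)) ^ 2 := by gcongr
            _ = _ := by
              rw [← ENNReal.rpow_natCast, ← ENNReal.rpow_mul]; norm_num
        calc _ ≤ (‖h‖ₑ * ∫⁻ t, ‖G' (z + t • h)‖ₑ ∂τ) ^ 2 := by gcongr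
          _ = ‖h‖ₑ ^ 2 * (∫⁻ t, ‖G' (z + t • h)‖ₑ ∂τ) ^ 2 := by ring
          _ ≤ _ := by gcongr
    _ ≤ ∫⁻ z, ‖h‖ₑ ^ 2 * ∫⁻ t, ‖G' (z + t • h)‖ₑ ^ 2 ∂τ := setLIntegral_le_lintegral _ _
    _ = ‖h‖ₑ ^ 2 * ∫⁻ z, ∫⁻ t, ‖G' (z + t • h)‖ₑ ^ 2 ∂τ := by
        rw [lintegral_const_mul' _ _ (by simp)]
    _ = ‖h‖ₑ ^ 2 * ∫⁻ t, (∫⁻ z, ‖G' (z + t • h)‖ₑ ^ 2) ∂τ := by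
        congr 1
        exact lintegral_lintegral_swap (iGs.swap.aestronglyMeasurable.enorm.pow_const 2)
    _ = ‖h‖ₑ ^ 2 * ∫⁻ z in U, ‖G z‖ₑ ^ 2 := by
        congr 1
        -- `G'` is extended by zero to the whole plane, so translation invariance removes the
        -- dependence on `t`.
        have : ∀ t : ℝ, ∫⁻ z, ‖G' (z + t • h)‖ₑ ^ 2 = ∫⁻ z in U, ‖G z‖ₑ ^ 2 := by
          intro t
          rw [lintegral_add_right_eq_self (fun z => ‖G' z‖ₑ ^ 2) (t • h),
            ← lintegral_indicator hU.measurableSet]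
          refine lintegral_congr fun z => ?_
          by_cases hz : z ∈ U <;> simp [hG', hz]
        simp [this]

/-! ### Sobolev pairs and Poincaré inequalities on balls and unions. -/

/-- A square integrable function on `U` together with its square integrable weak gradient. -/
structure IsSobolevPair (U : Set E2) (u : E2 → ℝ) (G : E2 → E2) : Prop where
  weak : IsWeakGradient U u G
  memLp_fn : MemLp u 2 (volume.restrict U)
  memLp_grad : MemLp G 2 (volume.restrict U)

lemma volume_ne_top_of_isBounded {U : Set E2} (hb : Bornology.IsBounded U) : volume U ≠ ⊤ :=
  hb.measure_lt_top.ne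

lemma IsSobolevPair.mono {U U' : Set E2} {u : E2 → ℝ} {G : E2 → E2} (h : IsSobolevPair U u G)
    (hs : U' ⊆ U) (hU : MeasurableSet U) : IsSobolevPair U' u G where
  weak := by
    intro φ hφ hc ht e
    have z : ∀ x, x ∉ U' → φ x = 0 := fun x hx => image_eq_zero_of_notMem_tsupport fun h => hx (ht h)
    have z' : ∀ x, x ∉ U' → fderiv ℝ φ x = 0 := fun x hx =>
      image_eq_zero_of_notMem_tsupport fun h => hx (ht (tsupport_fderiv_subset ℝ h))
    have := h.weak φ hφ hc (ht.trans hs) e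
    rwa [setIntegral_eq_of_subset_of_forall_sdiff_eq_zero hU hs,
      setIntegral_eq_of_subset_of_forall_sdiff_eq_zero hU hs] at this
    · intro x hx; simp [z x hx.2]
    · intro x hx; simp [z' x hx.2]
  memLp_fn := h.memLp_fn.mono_measure (Measure.restrict_mono_set _ hs)
  memLp_grad := h.memLp_grad.mono_measure (Measure.restrict_mono_set _ hs)

lemma IsSobolevPair.integrableOn_fn {U : Set E2} {u : E2 → ℝ} {G : E2 → E2}
    (h : IsSobolevPair U u G) (hb : Bornology.IsBounded U) : IntegrableOn u U := by
  have : IsFiniteMeasure (volume.restrict U) := ⟨by simpa using hb.measure_lt_top⟩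
  exact h.memLp_fn.integrable (by norm_num)

lemma IsSobolevPair.integrableOn_grad {U : Set E2} {u : E2 → ℝ} {G : E2 → E2}
    (h : IsSobolevPair U u G) (hb : Bornology.IsBounded U) : IntegrableOn G U := by
  have : IsFiniteMeasure (volume.restrict U) := ⟨by simpa using hb.measure_lt_top⟩
  exact h.memLp_grad.integrable (by norm_num)

lemma enorm_add_sq_le {E : Type*} [NormedAddCommGroup E] (a b : E) :
    ‖a + b‖ₑ ^ 2 ≤ 2 * (‖a‖ₑ ^ 2 + ‖b‖ₑ ^ 2) := by
  calc ‖a + b‖ₑ ^ 2 ≤ (‖a‖ₑ + ‖b‖ₑ) ^ 2 := by gcongr; exact enorm_add_le a b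
    _ ≤ _ := by
      have h := ENNReal.rpow_add_le_mul_rpow_add_rpow ‖a‖ₑ ‖b‖ₑ (p := 2) (by norm_num)
      norm_num at h
      exact h

/-- `X` satisfies a Poincaré inequality with respect to functions in `H¹(U)`. -/
def IsPoincareSet (U X : Set E2) : Prop :=
  ∃ C : NNReal, ∀ u G, IsSobolevPair U u G →
    ∃ m : ℝ, ∫⁻ x in X, ‖u x - m‖ₑ ^ 2 ≤ C * ∫⁻ x in U, ‖G x‖ₑ ^ 2

lemma IsPoincareSet.mono {U X Y : Set E2} (h : IsPoincareSet U Y) (hXY : X ⊆ Y) :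
    IsPoincareSet U X := by
  obtain ⟨C, hC⟩ := h
  refine ⟨C, fun u G hu => ?_⟩
  obtain ⟨m, hm⟩ := hC u G hu
  exact ⟨m, (lintegral_mono_set hXY).trans hm⟩

lemma lintegral_enorm_sub_sq_le {X : Set E2} (u : E2 → ℝ) (m m' : ℝ) :
    ∫⁻ x in X, ‖u x - m‖ₑ ^ 2
      ≤ 2 * (∫⁻ x in X, ‖u x - m'‖ₑ ^ 2) + 2 * (‖m' - m‖ₑ ^ 2 * volume X) := by
  calc ∫⁻ x in X, ‖u x - m‖ₑ ^ 2
      ≤ ∫⁻ x in X, (2 * ‖u x - m'‖ₑ ^ 2 + 2 * ‖m' - m‖ₑ ^ 2) := by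
        refine lintegral_mono fun x => ?_
        have := enorm_add_sq_le (u x - m') (m' - m)
        rw [sub_add_sub_cancel, mul_add] at this
        exact this
    _ = _ := by
        rw [lintegral_add_right _ measurable_const, lintegral_const_mul' _ _ (by simp)]
        simp [mul_assoc]

/-- The constants `m` for `X` and `n` for `Y` are compared on `X ∩ Y`, where `u` is close to both in
`L²`. As the overlap has positive measure this bounds `|n - m|`, so `m` serves for `Y` as well. The
ratio `κ = |Y| / |X ∩ Y|` carries the bound from the overlap to all of `Y`. -/
lemma IsPoincareSet.union {U X Y : Set E2} (hX : IsPoincareSet U X) (hY : IsPoincareSet U Y)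
    (hXU : X ⊆ U)
    (hYfin : volume Y ≠ ⊤) (hXY : 0 < volume (X ∩ Y)) : IsPoincareSet U (X ∪ Y) := by
  obtain ⟨C, hC⟩ := hX
  obtain ⟨D, hD⟩ := hY
  have hfin : volume (X ∩ Y) ≠ ⊤ := ne_top_of_le_ne_top hYfin (measure_mono inter_subset_right)
  set κ := volume Y / volume (X ∩ Y) with hκ
  have hκt : κ ≠ ⊤ := ENNReal.div_ne_top hYfin hXY.ne'
  lift κ to NNReal using hκt with κ'
  refine ⟨C + 2 * D + 4 * κ' * (C + D), fun u G hu => ?_⟩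
  obtain ⟨m, hm⟩ := hC u G hu
  obtain ⟨n, hn⟩ := hD u G hu
  refine ⟨m, ?_⟩
  set I := ∫⁻ x in U, ‖G x‖ₑ ^ 2
  have h1 : ‖n - m‖ₑ ^ 2 * volume (X ∩ Y) ≤ 2 * ((C + D) * I) := by
    calc ‖n - m‖ₑ ^ 2 * volume (X ∩ Y) = ∫⁻ x in X ∩ Y, ‖n - m‖ₑ ^ 2 := by simp
      _ ≤ ∫⁻ x in X ∩ Y, (2 * ‖u x - m‖ₑ ^ 2 + 2 * ‖u x - n‖ₑ ^ 2) := by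
        refine lintegral_mono fun x => ?_
        have := enorm_add_sq_le (u x - m) (-(u x - n))
        rw [enorm_neg, mul_add] at this
        convert this using 3
        ring
      _ ≤ 2 * (∫⁻ x in X ∩ Y, ‖u x - m‖ₑ ^ 2) + 2 * ∫⁻ x in X ∩ Y, ‖u x - n‖ₑ ^ 2 := by
        rw [← lintegral_const_mul' _ _ (by simp), ← lintegral_const_mul' _ _ (by simp)]
        have hum : AEMeasurable u (volume.restrict U) := hu.memLp_fn.aestronglyMeasurable.aemeasurable
        have hum' : AEMeasurable u (volume.restrict (X ∩ Y)) :=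
          hum.mono_measure (Measure.restrict_mono_set _ (inter_subset_left.trans hXU))
        rw [lintegral_add_left']
        exact ((hum'.sub_const m).enorm.pow_const 2).const_mul 2
      _ ≤ 2 * (C * I) + 2 * (D * I) := by
        gcongr
        · exact (lintegral_mono_set inter_subset_left).trans hm
        · exact (lintegral_mono_set inter_subset_right).trans hn
      _ = _ := by ring
  have h2 : ‖n - m‖ₑ ^ 2 * volume Y ≤ κ' * (2 * ((C + D) * I)) := by
    have : volume Y = κ' * volume (X ∩ Y) := by
      rw [hκ, ENNReal.div_mul_cancel hXY.ne' hfin]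
    rw [this, mul_left_comm]
    gcongr
  calc ∫⁻ x in X ∪ Y, ‖u x - m‖ₑ ^ 2
      ≤ (∫⁻ x in X, ‖u x - m‖ₑ ^ 2) + ∫⁻ x in Y, ‖u x - m‖ₑ ^ 2 := lintegral_union_le _ _ _
    _ ≤ C * I + (2 * (D * I) + 2 * (κ' * (2 * ((C + D) * I)))) := by
        gcongr
        refine (lintegral_enorm_sub_sq_le u m n).trans ?_
        gcongr
    _ = _ := by push_cast; ring

/-- Integrate `|u(x) - u(y)|²` over `B × B` and put `x = y + h`. Only `|h| < 2r` contributes, and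
for each such `h` the increment estimate applies because the ball is convex. Some `y ∈ B` does no
worse than the average, and `m = u y` is the constant. -/
lemma isPoincareSet_ball {U : Set E2} (hU : IsOpen U) (hb : Bornology.IsBounded U) {x₀ : E2}
    {r : ℝ} (hr : 0 < r) (hB : Metric.ball x₀ r ⊆ U) : IsPoincareSet U (Metric.ball x₀ r) := by
  set B := Metric.ball x₀ r with hBdef
  have hBm : MeasurableSet B := Metric.isOpen_ball.measurableSet
  have hv0 : volume B ≠ 0 := (Metric.measure_ball_pos volume x₀ hr).ne'
  have hvt : volume B ≠ ⊤ := measure_ball_lt_top.ne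
  set L : ENNReal := ENNReal.ofReal (2 * r) ^ 2 * volume (Metric.ball (0 : E2) (2 * r)) with hL
  have hLt : L / volume B ≠ ⊤ := by
    refine ENNReal.div_ne_top (ENNReal.mul_ne_top (ENNReal.pow_ne_top ENNReal.ofReal_ne_top) measure_ball_lt_top.ne) hv0
  refine ⟨(L / volume B).toNNReal, fun u G hu => ?_⟩
  rw [ENNReal.coe_toNNReal hLt]
  set I := ∫⁻ x in U, ‖G x‖ₑ ^ 2
  set u' : E2 → ℝ := B.indicator u with hu'
  have mu' : AEMeasurable u' := by
    rw [hu', aemeasurable_indicator_iff hBm]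
    exact hu.memLp_fn.aestronglyMeasurable.aemeasurable.mono_measure
      (Measure.restrict_mono_set _ hB)
  set H : E2 × E2 → ENNReal := fun p => B.indicator (fun _ => (1 : ENNReal)) p.1 *
    (B.indicator (fun _ => (1 : ENNReal)) p.2 * ‖u' p.2 - u' p.1‖ₑ ^ 2) with hH
  have m1 : Measurable (B.indicator (fun _ => (1 : ENNReal))) :=
    measurable_const.indicator hBm
  have mH : AEMeasurable H (volume.prod volume) := by
    refine (m1.comp measurable_fst).aemeasurable.mul ((m1.comp measurable_snd).aemeasurable.mul ?_)
    refine AEMeasurable.pow_const (AEMeasurable.enorm (AEMeasurable.sub ?_ ?_)) 2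
    · exact mu'.comp_snd
    · exact mu'.comp_fst
  have mH' : AEMeasurable (fun p : E2 × E2 => H (p.1, p.1 + p.2)) (volume.prod volume) :=
    mH.comp_quasiMeasurePreserving (measurePreserving_prod_add volume volume).quasiMeasurePreserving
  set f : E2 → ENNReal := fun y => ∫⁻ x in B, ‖u x - u y‖ₑ ^ 2 with hf
  have hfH : ∀ y ∈ B, f y = ∫⁻ x, H (y, x) := by
    intro y hy
    rw [hf]; dsimp only
    rw [← lintegral_indicator hBm]
    refine lintegral_congr fun x => ?_
    by_cases hx : x ∈ B <;> simp [hH, hx, hy, hu']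
  have mf : AEMeasurable f (volume.restrict B) := by
    have : AEMeasurable (fun y => ∫⁻ x, H (y, x)) volume := mH.lintegral_prod_right'
    refine this.restrict.congr ?_
    filter_upwards [ae_restrict_mem hBm] with y hy
    exact (hfH y hy).symm
  have tot : ∫⁻ y in B, f y ≤ L * I := by
    calc ∫⁻ y in B, f y = ∫⁻ y in B, ∫⁻ x, H (y, x) :=
          setLIntegral_congr_fun hBm fun y hy => hfH y hy
      _ ≤ ∫⁻ y, ∫⁻ x, H (y, x) := setLIntegral_le_lintegral _ _
      _ = ∫⁻ y, ∫⁻ h, H (y, y + h) := by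
          refine lintegral_congr fun y => ?_
          rw [lintegral_add_left_eq_self (fun x => H (y, x)) y]
      _ = ∫⁻ h, ∫⁻ y, H (y, y + h) := lintegral_lintegral_swap mH'
      _ ≤ ∫⁻ h, (Metric.ball (0 : E2) (2 * r)).indicator
            (fun _ => ENNReal.ofReal (2 * r) ^ 2 * I) h := by
          refine lintegral_mono fun h => ?_
          by_cases hh : h ∈ Metric.ball (0 : E2) (2 * r)
          · rw [indicator_of_mem hh]
            set O : Set E2 := B ∩ (fun z => z + h) ⁻¹' B with hO
            have hOo : IsOpen O :=
              Metric.isOpen_ball.inter (Metric.isOpen_ball.preimage (by fun_prop))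
            have seg : ∀ z ∈ O, ∀ t ∈ Icc (0 : ℝ) 1, z + t • h ∈ U := by
              intro z hz t ht
              refine hB ((convex_ball x₀ r).add_smul_mem hz.1 ?_ ht)
              exact hz.2
            calc ∫⁻ y, H (y, y + h) = ∫⁻ y in O, ‖u (y + h) - u y‖ₑ ^ 2 := by
                  rw [← lintegral_indicator hOo.measurableSet]
                  refine lintegral_congr fun y => ?_
                  by_cases hy : y ∈ B <;> by_cases hyh : y + h ∈ B <;>
                    simp [hH, hO, hy, hyh, hu']
              _ ≤ ‖h‖ₑ ^ 2 * I := hu.weak.lintegral_increment_le hU hOo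
                  (hu.integrableOn_fn hb) (hu.integrableOn_grad hb) h seg
              _ ≤ _ := by
                  gcongr
                  rw [← ofReal_norm]
                  exact ENNReal.ofReal_le_ofReal (mem_ball_zero_iff.1 hh).le
          · rw [indicator_of_notMem hh]
            have h0 : ∀ y, H (y, y + h) = 0 := by
              intro y
              by_cases hy : y ∈ B
              · have : y + h ∉ B := by
                  intro hyh
                  apply hh
                  have e1 := Metric.mem_ball.1 hy
                  have e2 := Metric.mem_ball.1 hyh
                  rw [mem_ball_zero_iff]
                  have : ‖h‖ = dist (y + h) y := by simp [dist_eq_norm]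
                  rw [this]
                  linarith [dist_triangle_right (y + h) y x₀]
                simp [hH, this]
              · simp [hH, hy]
            simp [h0]
      _ = L * I := by
          rw [lintegral_indicator Metric.isOpen_ball.measurableSet]
          simp [hL]; ring
  obtain ⟨y, hy, hyle⟩ := exists_le_setLAverage hv0 hvt mf
  refine ⟨u y, hyle.trans ?_⟩
  rw [setLAverage_eq]
  calc _ ≤ L * I / volume B := by gcongr
    _ = _ := by rw [ENNReal.div_eq_inv_mul, ENNReal.div_eq_inv_mul]; ring

/-! ### Boundary charts -/

/-- The upward vertical direction of the Cartesian coordinates `e`. -/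
def chartUp (e : E2 ≃ᵃⁱ[ℝ] E2) : E2 := e.linearIsometryEquiv.symm (EuclideanSpace.single 1 1)

lemma norm_chartUp (e : E2 ≃ᵃⁱ[ℝ] E2) : ‖chartUp e‖ = 1 := by simp [chartUp]

lemma chart_add_smul_chartUp (e : E2 ≃ᵃⁱ[ℝ] E2) (z : E2) (t : ℝ) :
    e (z + t • chartUp e) = e z + t • EuclideanSpace.single 1 1 := by
  have := e.map_vadd z (t • chartUp e)
  rw [vadd_eq_add, vadd_eq_add, add_comm] at this
  rw [this, map_smul, chartUp, LinearIsometryEquiv.apply_symm_apply, add_comm]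

@[simp] lemma chart_add_zero (e : E2 ≃ᵃⁱ[ℝ] E2) (z : E2) (t : ℝ) :
    e (z + t • chartUp e) 0 = e z 0 := by
  rw [chart_add_smul_chartUp]; simp

@[simp] lemma chart_add_one (e : E2 ≃ᵃⁱ[ℝ] E2) (z : E2) (t : ℝ) :
    e (z + t • chartUp e) 1 = e z 1 + t := by
  rw [chart_add_smul_chartUp]; simp

lemma abs_chart_sub_le (e : E2 ≃ᵃⁱ[ℝ] E2) (x y : E2) (i : Fin 2) :
    |e x i - e y i| ≤ dist x y := by
  rw [← e.dist_map x y, dist_eq_norm]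
  exact PiLp.norm_apply_le (e x - e y) i

lemma continuous_chart (e : E2 ≃ᵃⁱ[ℝ] E2) (i : Fin 2) : Continuous fun x => e x i := by
  have := e.continuous
  fun_prop

/-- Near the boundary point `p`, `U` is the strict epigraph of the `K`-Lipschitz function `f`. -/
structure IsChart (U : Set E2) (p : E2) (e : E2 ≃ᵃⁱ[ℝ] E2) (f : ℝ → ℝ) (K : NNReal) (ρ : ℝ) :
    Prop where
  lipschitz : LipschitzWith K f
  pos : 0 < ρ
  mem_iff : ∀ x ∈ Metric.ball p ρ, (x ∈ U ↔ f (e x 0) < e x 1)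
  eq_of_frontier : ∀ x ∈ Metric.ball p ρ, x ∈ frontier U → f (e x 0) = e x 1

/-- For the graph equation on the frontier, `f ≤` passes from `U` to its closure, while a strict
inequality would put a frontier point inside the open set `U`. -/
lemma HasLipschitzBoundary.exists_isChart {U : Set E2} (h : HasLipschitzBoundary U)
    (hU : IsOpen U) {p : E2} (hp : p ∈ frontier U) : ∃ e f K ρ, IsChart U p e f K ρ := by
  obtain ⟨e, f, K, hf, W, hW, hWU⟩ := h p hp
  obtain ⟨ρ, hρ, hρW⟩ := Metric.mem_nhds_iff.1 hW
  refine ⟨e, f, K, ρ, hf, hρ, fun x hx => hWU x (hρW hx), fun x hx hxf => ?_⟩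
  refine le_antisymm ?_ ?_
  · have hcl : x ∈ closure (Metric.ball p ρ ∩ U) := by
      have := Metric.isOpen_ball.inter_closure (s := Metric.ball p ρ) (t := U)
        ⟨hx, frontier_subset_closure hxf⟩
      exact this
    have hsub : closure (Metric.ball p ρ ∩ U) ⊆ {x | f (e x 0) ≤ e x 1} := by
      refine closure_minimal (fun y hy => ((hWU y (hρW hy.1)).1 hy.2).le) ?_
      exact isClosed_le (hf.continuous.comp (continuous_chart e 0)) (continuous_chart e 1)
    exact hsub hcl
  · by_contra hlt
    push Not at hlt
    have hxU := (hWU x (hρW hx)).2 hlt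
    rw [hU.frontier_eq] at hxf
    exact hxf.2 hxU

/-- Lifting `ball p r ∩ U` vertically by `τ` never leaves `U` and ends in a ball contained in `U`.
There the inequality is known, and the increment estimate pays for the translation. -/
lemma IsChart.exists_isPoincareSet {U : Set E2} {p : E2} {e : E2 ≃ᵃⁱ[ℝ] E2} {f : ℝ → ℝ}
    {K : NNReal} {ρ : ℝ} (hc : IsChart U p e f K ρ) (hU : IsOpen U) (hb : Bornology.IsBounded U)
    (hp : p ∈ frontier U) : ∃ r > 0, IsPoincareSet U (Metric.ball p r ∩ U) := by
  have hρ := hc.pos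
  have hK : (0 : ℝ) ≤ K := K.2
  set τ := ρ / 2 with hτ
  -- Within distance `r` of `q = p + τ • chartUp e` the graph rises by at most `K r` and the height
  -- drops by at most `r`, in all less than `τ`; hence `ball q r ⊆ U`.
  set r := τ / (K + 2) with hr
  have hr0 : 0 < r := by positivity
  have hrτ : (K + 2) * r = τ := by rw [hr]; field_simp
  have hrle : r ≤ τ / 2 := by
    rw [hr]; gcongr; linarith
  have hp0 : f (e p 0) = e p 1 := hc.eq_of_frontier p (Metric.mem_ball_self hρ) hp
  have key : ∀ z ∈ Metric.ball p ρ, e z 1 - f (e z 0) > 0 → z ∈ U := fun z hz h =>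
    (hc.mem_iff z hz).2 (by linarith)
  have dist_up : ∀ (z : E2) (t : ℝ), 0 ≤ t → dist (z + t • chartUp e) p ≤ dist z p + t := by
    intro z t ht
    calc dist (z + t • chartUp e) p ≤ dist (z + t • chartUp e) z + dist z p := dist_triangle _ _ _
      _ = _ := by simp [dist_eq_norm, norm_smul, norm_chartUp, abs_of_nonneg ht, add_comm]
  set q := p + τ • chartUp e with hq
  have hBU : Metric.ball q r ⊆ U := by
    intro y hy
    have hy := Metric.mem_ball.1 hy
    have d1 : dist y p < ρ := by
      have := dist_up p τ (by positivity)
      rw [dist_self] at this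
      linarith [dist_triangle y q p]
    refine key y d1 ?_
    have a0 := abs_le.1 ((abs_chart_sub_le e y q 0).trans hy.le)
    have a1 := abs_le.1 ((abs_chart_sub_le e y q 1).trans hy.le)
    rw [hq, chart_add_zero] at a0
    rw [hq, chart_add_one] at a1
    have a2 : |f (e y 0) - f (e p 0)| ≤ K * r := by
      refine (hc.lipschitz.dist_le_mul _ _).trans ?_
      gcongr
      rw [Real.dist_eq, abs_le]; exact a0
    have := (abs_le.1 a2).2
    nlinarith
  obtain ⟨C, hC⟩ := isPoincareSet_ball hU hb hr0 hBU
  refine ⟨r, hr0, 2 * ‖τ‖₊ ^ 2 + 2 * C, fun u G hu => ?_⟩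
  obtain ⟨m, hm⟩ := hC u G hu
  refine ⟨m, ?_⟩
  set I := ∫⁻ x in U, ‖G x‖ₑ ^ 2
  set O := Metric.ball p r ∩ U with hO
  have hOo : IsOpen O := Metric.isOpen_ball.inter hU
  have seg : ∀ z ∈ O, ∀ t ∈ Icc (0 : ℝ) 1, z + t • (τ • chartUp e) ∈ U := by
    intro z hz t ht
    have hzp := Metric.mem_ball.1 hz.1
    rw [smul_smul]
    have htτ : t * τ ≤ τ := mul_le_of_le_one_left (by positivity) ht.2
    have ht0 : 0 ≤ t * τ := mul_nonneg ht.1 (by positivity)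
    have h1 : dist (z + (t * τ) • chartUp e) p < ρ := by
      linarith [dist_up z (t * τ) ht0]
    refine key _ h1 ?_
    rw [chart_add_zero, chart_add_one]
    have := (hc.mem_iff z (Metric.mem_ball.2 (by linarith))).1 hz.2
    linarith
  have b1 := hu.weak.lintegral_increment_le hU hOo (hu.integrableOn_fn hb)
    (hu.integrableOn_grad hb) (τ • chartUp e) seg
  have hnorm : ‖τ • chartUp e‖ₑ = ‖τ‖ₑ := by
    rw [← ofReal_norm, norm_smul, norm_chartUp, mul_one, ofReal_norm]
  rw [hnorm] at b1
  have b2 : ∫⁻ z in O, ‖u (z + τ • chartUp e) - m‖ₑ ^ 2 ≤ C * I := by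
    refine le_trans ?_ hm
    rw [← lintegral_indicator hOo.measurableSet,
      ← lintegral_indicator Metric.isOpen_ball.measurableSet,
      ← lintegral_add_right_eq_self ((Metric.ball q r).indicator fun x => ‖u x - m‖ₑ ^ 2)
        (τ • chartUp e)]
    refine lintegral_mono fun z => ?_
    by_cases hz : z ∈ O
    · have : z + τ • chartUp e ∈ Metric.ball q r := by
        rw [hq, Metric.mem_ball, dist_add_right]
        exact hz.1
      simp [hz, this]
    · simp [hz]
  have mO : AEMeasurable u (volume.restrict O) :=
    hu.memLp_fn.aestronglyMeasurable.aemeasurable.mono_measure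
      (Measure.restrict_mono_set _ inter_subset_right)
  have mOs : AEMeasurable (fun z => u (z + τ • chartUp e)) (volume.restrict O) := by
    have m1 : AEMeasurable (U.indicator u) :=
      (aemeasurable_indicator_iff hU.measurableSet).2 hu.memLp_fn.aestronglyMeasurable.aemeasurable
    have m2 := m1.comp_quasiMeasurePreserving
      (measurePreserving_add_right volume (τ • chartUp e)).quasiMeasurePreserving
    refine m2.restrict.congr ?_
    filter_upwards [ae_restrict_mem hOo.measurableSet] with z hz
    have := seg z hz 1 (by simp)
    rw [one_smul] at this
    simp [this]
  calc ∫⁻ z in O, ‖u z - m‖ₑ ^ 2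
      ≤ ∫⁻ z in O, (2 * ‖u (z + τ • chartUp e) - u z‖ₑ ^ 2
          + 2 * ‖u (z + τ • chartUp e) - m‖ₑ ^ 2) := by
        refine lintegral_mono fun z => ?_
        have := enorm_add_sq_le (-(u (z + τ • chartUp e) - u z)) (u (z + τ • chartUp e) - m)
        rw [enorm_neg, mul_add] at this
        convert this using 3
        ring
    _ = 2 * (∫⁻ z in O, ‖u (z + τ • chartUp e) - u z‖ₑ ^ 2)
          + 2 * ∫⁻ z in O, ‖u (z + τ • chartUp e) - m‖ₑ ^ 2 := by
        rw [lintegral_add_left', lintegral_const_mul' _ _ (by simp),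
          lintegral_const_mul' _ _ (by simp)]
        exact ((mOs.sub mO).enorm.pow_const 2).const_mul 2
    _ ≤ 2 * (‖τ‖ₑ ^ 2 * I) + 2 * (C * I) := by gcongr
    _ = _ := by push_cast; rw [← enorm_eq_nnnorm]; ring

/-- **Poincaré–Wirtinger inequality** on bounded connected Lipschitz domains. -/
theorem isPoincareSet_self {U : Set E2} (hU : IsOpen U) (hcon : IsConnected U)
    (hb : Bornology.IsBounded U) (hlip : HasLipschitzBoundary U) : IsPoincareSet U U := by
  have hUfin : volume U ≠ ⊤ := volume_ne_top_of_isBounded hb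
  have ball_in : ∀ x ∈ U, ∃ r > 0, Metric.ball x r ⊆ U := fun x hx =>
    Metric.isOpen_iff.1 hU x hx
  obtain ⟨x₀, hx₀⟩ := hcon.nonempty
  obtain ⟨r₀, hr₀, hB₀⟩ := ball_in x₀ hx₀
  set B₀ := Metric.ball x₀ r₀ with hB₀def
  have hB₀pos : ∀ X, B₀ ⊆ X → 0 < volume X := fun X hX =>
    (Metric.measure_ball_pos volume x₀ hr₀).trans_le (measure_mono hX)
  -- Keeping the fixed ball `B₀` inside every `X` guarantees that any two of these sets overlap in
  -- positive measure, as `IsPoincareSet.union` requires.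
  let Q : Set E2 → Prop := fun s => ∃ X, IsPoincareSet U X ∧ B₀ ⊆ X ∧ X ⊆ U ∧ s ⊆ X
  have interior_pts : ∀ x ∈ U, ∃ s ∈ 𝓝 x, Q s := by
    set Z : Set E2 := {x | ∃ s ∈ 𝓝 x, Q s} with hZ
    have hZo : IsOpen Z := by
      rw [isOpen_iff_mem_nhds]
      rintro x ⟨s, hs, hQ⟩
      filter_upwards [eventually_mem_nhds_iff.2 hs] with y hy using ⟨s, hy, hQ⟩
    have hx₀Z : x₀ ∈ Z := ⟨B₀, Metric.ball_mem_nhds x₀ hr₀, B₀,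
      isPoincareSet_ball hU hb hr₀ hB₀, subset_rfl, hB₀, subset_rfl⟩
    -- Connectedness: `Z` is open and contains `x₀`. It is closed relative to `U`, because a ball
    -- around a limit point meets the interior of a good set and can be joined to it.
    refine hcon.isPreconnected.subset_of_closure_inter_subset hZo ⟨x₀, hx₀, hx₀Z⟩ ?_
    rintro x ⟨hxc, hxU⟩
    obtain ⟨r, hr, hB⟩ := ball_in x hxU
    obtain ⟨z, hzB, s, hs, X, hX, hBX, hXU, hsX⟩ :=
      mem_closure_iff.1 hxc _ Metric.isOpen_ball (Metric.mem_ball_self hr)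
    refine ⟨Metric.ball x r, Metric.ball_mem_nhds x hr, X ∪ Metric.ball x r,
      hX.union (isPoincareSet_ball hU hb hr hB) hXU measure_ball_lt_top.ne ?_,
      hBX.trans subset_union_left, union_subset hXU hB, subset_union_right⟩
    refine Measure.measure_pos_of_mem_nhds volume (x := z) ?_
    exact inter_mem (mem_of_superset hs hsX) (Metric.isOpen_ball.mem_nhds hzB)
  have local_pts : ∀ p ∈ closure U, ∃ s ∈ 𝓝[closure U] p, Q (s ∩ U) := by
    intro p hp
    by_cases hpU : p ∈ U
    · obtain ⟨s, hs, X, hX, hBX, hXU, hsX⟩ := interior_pts p hpU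
      exact ⟨s, mem_nhdsWithin_of_mem_nhds hs, X, hX, hBX, hXU, inter_subset_left.trans hsX⟩
    · have hpf : p ∈ frontier U := by rw [hU.frontier_eq]; exact ⟨hp, hpU⟩
      obtain ⟨e, f, K, ρ, hc⟩ := hlip.exists_isChart hU hpf
      obtain ⟨r, hr, hP⟩ := hc.exists_isPoincareSet hU hb hpf
      obtain ⟨z, hzB, hzU⟩ := mem_closure_iff.1 hp _ Metric.isOpen_ball (Metric.mem_ball_self hr)
      obtain ⟨s, hs, X, hX, hBX, hXU, hsX⟩ := interior_pts z hzU
      refine ⟨Metric.ball p r, mem_nhdsWithin_of_mem_nhds (Metric.ball_mem_nhds p hr),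
        X ∪ (Metric.ball p r ∩ U), hX.union hP hXU
          (ne_top_of_le_ne_top hUfin (measure_mono inter_subset_right)) ?_,
        hBX.trans subset_union_left, union_subset hXU inter_subset_right, subset_union_right⟩
      refine Measure.measure_pos_of_mem_nhds volume (x := z) ?_
      exact inter_mem (mem_of_superset hs hsX)
        ((Metric.isOpen_ball.inter hU).mem_nhds ⟨hzB, hzU⟩)
  have hQ : Q (closure U ∩ U) := by
    -- Compactness of the closure reduces the claim to a finite union of interior and boundary
    -- pieces.
    refine (Metric.isCompact_of_isClosed_isBounded isClosed_closure hb.closure).induction_on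
      (p := fun s => Q (s ∩ U)) ?_ ?_ ?_ local_pts
    · exact ⟨B₀, isPoincareSet_ball hU hb hr₀ hB₀, subset_rfl, hB₀, by simp⟩
    · rintro s t hst ⟨X, hX, hBX, hXU, htX⟩
      exact ⟨X, hX, hBX, hXU, (inter_subset_inter_left _ hst).trans htX⟩
    · rintro s t ⟨X, hX, hBX, hXU, hsX⟩ ⟨Y, hY, hBY, hYU, htY⟩
      refine ⟨X ∪ Y, hX.union hY hXU (ne_top_of_le_ne_top hUfin (measure_mono hYU))
        (hB₀pos _ (subset_inter hBX hBY)), hBX.trans subset_union_left, union_subset hXU hYU, ?_⟩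
      rw [union_inter_distrib_right]
      exact union_subset_union hsX htY
  obtain ⟨X, hX, -, -, hUX⟩ := hQ
  exact hX.mono fun x hx => hUX ⟨subset_closure hx, hx⟩

/-! ### Chart coordinates and limits along vertical lines. -/

/-- The parametrization `(a, s) ↦ (a, f(a) + s)` in the Cartesian coordinates `e`. -/
def chartMap (e : E2 ≃ᵃⁱ[ℝ] E2) (f : ℝ → ℝ) (q : ℝ × ℝ) : E2 := e.symm !₂[q.1, f q.1 + q.2]

@[simp] lemma chart_chartMap_zero (e : E2 ≃ᵃⁱ[ℝ] E2) (f : ℝ → ℝ) (q : ℝ × ℝ) :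
    e (chartMap e f q) 0 = q.1 := by simp [chartMap]

@[simp] lemma chart_chartMap_one (e : E2 ≃ᵃⁱ[ℝ] E2) (f : ℝ → ℝ) (q : ℝ × ℝ) :
    e (chartMap e f q) 1 = f q.1 + q.2 := by simp [chartMap]

lemma chart_ext (e : E2 ≃ᵃⁱ[ℝ] E2) {x y : E2} (h0 : e x 0 = e y 0) (h1 : e x 1 = e y 1) :
    x = y := by
  apply e.injective
  ext i
  fin_cases i
  · exact h0
  · exact h1

lemma chartMap_add (e : E2 ≃ᵃⁱ[ℝ] E2) (f : ℝ → ℝ) (q : ℝ × ℝ) (t : ℝ) :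
    chartMap e f q + t • chartUp e = chartMap e f (q.1, q.2 + t) := by
  apply chart_ext e
  · simp
  · simp; ring

lemma dist_le_abs_chart (e : E2 ≃ᵃⁱ[ℝ] E2) (x y : E2) :
    dist x y ≤ |e x 0 - e y 0| + |e x 1 - e y 1| := by
  rw [← e.dist_map x y, EuclideanSpace.dist_eq, Fin.sum_univ_two, Real.dist_eq, Real.dist_eq]
  refine Real.sqrt_le_iff.2 ⟨by positivity, ?_⟩
  nlinarith [abs_nonneg (e x 0 - e y 0), abs_nonneg (e x 1 - e y 1)]

lemma dist_chartMap_le (e : E2 ≃ᵃⁱ[ℝ] E2) {f : ℝ → ℝ} {K : NNReal} (hf : LipschitzWith K f)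
    (q q' : ℝ × ℝ) :
    dist (chartMap e f q) (chartMap e f q') ≤ (1 + K) * |q.1 - q'.1| + |q.2 - q'.2| := by
  refine (dist_le_abs_chart e _ _).trans ?_
  have h := hf.dist_le_mul q.1 q'.1
  rw [Real.dist_eq, Real.dist_eq] at h
  simp only [chart_chartMap_zero, chart_chartMap_one]
  have : |f q.1 + q.2 - (f q'.1 + q'.2)| ≤ |f q.1 - f q'.1| + |q.2 - q'.2| := by
    rw [add_sub_add_comm]; exact abs_add_le _ _
  linarith

/-- A vertical shear by `f` has unit Jacobian, with no regularity of `f` beyond measurability; the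
rest are isometries. -/
lemma measurePreserving_chartMap (e : E2 ≃ᵃⁱ[ℝ] E2) {f : ℝ → ℝ} (hf : Measurable f) :
    MeasurePreserving (chartMap e f) (volume.prod volume) volume := by
  have h1 : MeasurePreserving (fun q : ℝ × ℝ => (q.1, f q.1 + q.2)) (volume.prod volume)
      (volume.prod volume) := by
    refine MeasurePreserving.skew_product (g := fun a s => f a + s) (MeasurePreserving.id _) ?_ ?_
    · exact (hf.comp measurable_fst).add measurable_snd
    · exact Eventually.of_forall fun a => (measurePreserving_add_left volume (f a)).map_eq
  have h2 : MeasurePreserving (fun q : ℝ × ℝ => (!₂[q.1, q.2] : E2)) (volume.prod volume) volume := by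
    have a1 := (volume_preserving_finTwoArrow ℝ).symm
    have a2 := (EuclideanSpace.volume_preserving_symm_measurableEquiv_toLp (Fin 2)).symm
    have := a2.comp a1
    exact this
  have h3 : MeasurePreserving (fun y : E2 => e.symm y) volume volume := by
    have : (fun y : E2 => e.symm y) = fun y => e.symm.linearIsometryEquiv y + e.symm 0 := by
      funext y
      have := e.symm.map_vadd 0 y
      simpa using this
    rw [this]
    exact (measurePreserving_add_right volume (e.symm 0)).comp
      e.symm.linearIsometryEquiv.measurePreserving
  exact h3.comp (h2.comp h1)

lemma continuous_chartMap (e : E2 ≃ᵃⁱ[ℝ] E2) {f : ℝ → ℝ} (hf : Continuous f) :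
    Continuous (chartMap e f) := by
  unfold chartMap
  have := e.symm.continuous
  fun_prop

/-- On almost every vertical line in a chart, a Sobolev function is the primitive of the vertical
component of its gradient. -/
lemma IsSobolevPair.ae_vertical {U : Set E2} (hU : IsOpen U) (hb : Bornology.IsBounded U)
    {u : E2 → ℝ} {G : E2 → E2} (hu : IsSobolevPair U u G) (hum : Measurable u) (hGm : Measurable G)
    (e : E2 ≃ᵃⁱ[ℝ] E2) {f : ℝ → ℝ} (hf : Continuous f) {I : Set ℝ} (hI : IsOpen I) {h : ℝ}
    (hR : ∀ a ∈ I, ∀ s ∈ Ioo 0 h, chartMap e f (a, s) ∈ U) :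
    ∀ᵐ a, a ∈ I → ∀ᵐ s, ∀ᵐ s', s ∈ Ioo 0 h → s' ∈ Ioo 0 h →
      u (chartMap e f (a, s')) - u (chartMap e f (a, s))
        = ∫ τ in s..s', inner ℝ (G (chartMap e f (a, τ))) (chartUp e) := by
  have hP := measurePreserving_chartMap e hf.measurable
  have hPc := continuous_chartMap e hf
  have hPm : Measurable (chartMap e f) := hPc.measurable
  -- For each fixed shift `t` the increment formula holds for almost every `q`, with a null set
  -- depending on `t`. Joint measurability of `A` allows the quantifiers to be exchanged by Fubini,
  -- so that on almost every line it holds for almost all pairs of heights.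
  set A : ℝ → ℝ × ℝ → Prop := fun t q => q.1 ∈ I → q.2 ∈ Ioo 0 h → q.2 + t ∈ Ioo 0 h →
    u (chartMap e f (q.1, q.2 + t)) - u (chartMap e f q)
      = ∫ θ in Ioc (0 : ℝ) 1, inner ℝ (G (chartMap e f (q.1, q.2 + t * θ))) (t • chartUp e)
    with hA
  have hAmeas : MeasurableSet {x : ℝ × ℝ × ℝ | A x.1 x.2} := by
    have m1 : MeasurableSet {x : ℝ × ℝ × ℝ |
        u (chartMap e f (x.2.1, x.2.2 + x.1)) - u (chartMap e f x.2)
      = ∫ θ in Ioc (0 : ℝ) 1,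
          inner ℝ (G (chartMap e f (x.2.1, x.2.2 + x.1 * θ))) (x.1 • chartUp e)} := by
      refine measurableSet_eq_fun ?_ ?_
      · exact (hum.comp (hPm.comp (by fun_prop))).sub (hum.comp (hPm.comp (by fun_prop)))
      · refine StronglyMeasurable.measurable ?_
        refine StronglyMeasurable.integral_prod_right' (ν := volume.restrict (Ioc (0 : ℝ) 1))
          (f := fun y : (ℝ × ℝ × ℝ) × ℝ => inner ℝ
            (G (chartMap e f (y.1.2.1, y.1.2.2 + y.1.1 * y.2))) (y.1.1 • chartUp e)) ?_
        refine Measurable.stronglyMeasurable ?_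
        exact (hGm.comp (hPm.comp (by fun_prop))).inner (by fun_prop)
    have mI : MeasurableSet {x : ℝ × ℝ × ℝ | x.2.1 ∈ I} :=
      hI.measurableSet.preimage (by fun_prop)
    have m2 : MeasurableSet {x : ℝ × ℝ × ℝ | x.2.2 ∈ Ioo 0 h} :=
      measurableSet_Ioo.preimage (by fun_prop)
    have m3 : MeasurableSet {x : ℝ × ℝ × ℝ | x.2.2 + x.1 ∈ Ioo 0 h} :=
      measurableSet_Ioo.preimage (by fun_prop)
    have : {x : ℝ × ℝ × ℝ | A x.1 x.2} = {x : ℝ × ℝ × ℝ | x.2.1 ∈ I}ᶜ ∪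
      ({x : ℝ × ℝ × ℝ | x.2.2 ∈ Ioo 0 h}ᶜ ∪ ({x : ℝ × ℝ × ℝ | x.2.2 + x.1 ∈ Ioo 0 h}ᶜ ∪ 
        {x : ℝ × ℝ × ℝ |
        u (chartMap e f (x.2.1, x.2.2 + x.1)) - u (chartMap e f x.2)
      = ∫ θ in Ioc (0 : ℝ) 1,
          inner ℝ (G (chartMap e f (x.2.1, x.2.2 + x.1 * θ))) (x.1 • chartUp e)})) := by
      ext x
      simp only [hA, mem_ofPred_eq, mem_union, mem_compl_iff]
      tauto
    rw [this]
    exact mI.compl.union (m2.compl.union (m3.compl.union m1))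
  have h1 : ∀ t, ∀ᵐ q ∂(volume.prod volume : Measure (ℝ × ℝ)), A t q := by
    intro t
    set R : Set E2 := {z | e z 0 ∈ I ∧ e z 1 - f (e z 0) ∈ Ioo 0 h} with hRdef
    have hRo : IsOpen R := by
      refine (hI.preimage (continuous_chart e 0)).inter (isOpen_Ioo.preimage ?_)
      exact (continuous_chart e 1).sub (hf.comp (continuous_chart e 0))
    have hRU : R ⊆ U := by
      intro z hz
      have := hR _ hz.1 _ hz.2
      convert this
      apply chart_ext e <;> simp
    set O : Set E2 := R ∩ (fun z => z + t • chartUp e) ⁻¹' R with hO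
    have hOo : IsOpen O := hRo.inter (hRo.preimage (by fun_prop))
    have seg : ∀ z ∈ O, ∀ θ ∈ Icc (0 : ℝ) 1, z + θ • (t • chartUp e) ∈ U := by
      intro z hz θ hθ
      apply hRU
      have z1 := hz.1
      have z2 : z + t • chartUp e ∈ R := hz.2
      rw [hRdef, mem_ofPred_eq] at z1 z2 ⊢
      rw [smul_smul, chart_add_zero, chart_add_one]
      rw [chart_add_zero, chart_add_one] at z2
      refine ⟨z1.1, ?_⟩
      have := (convex_Ioo (0:ℝ) h).add_smul_mem (x := e z 1 - f (e z 0)) (y := t) z1.2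
        (by convert z2.2 using 1; ring) hθ
      rw [smul_eq_mul] at this
      convert this using 1; ring
    have := hu.weak.increment hU hOo (hu.integrableOn_fn hb) (hu.integrableOn_grad hb)
      (t • chartUp e) seg
    have := hP.quasiMeasurePreserving.ae this
    filter_upwards [this] with q hq h1 h2 h3
    have hqO : chartMap e f q ∈ O := by
      refine ⟨⟨by simpa using h1, by simpa using h2⟩, ?_⟩
      rw [mem_preimage, chartMap_add]
      exact ⟨by simpa using h1, by simpa using h3⟩
    have := hq hqO
    rw [chartMap_add, intervalIntegral.integral_of_le zero_le_one] at this
    rw [this]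
    refine integral_congr_ae (Eventually.of_forall fun θ => ?_)
    simp only [smul_smul, chartMap_add]
    rw [mul_comm]
  have h2 : ∀ᵐ q ∂(volume.prod volume : Measure (ℝ × ℝ)), ∀ᵐ t, A t q :=
    (Measure.ae_ae_comm hAmeas).1 (Eventually.of_forall h1)
  filter_upwards [Measure.ae_ae_of_ae_prod h2] with a ha haI
  filter_upwards [ha] with s hs
  have := (measurePreserving_sub_right volume s).quasiMeasurePreserving.ae hs
  filter_upwards [this] with s' hs' hsI hsI'
  have := hs' haI hsI (by simpa using hsI')
  simp only [add_sub_cancel] at this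
  rw [this, ← intervalIntegral.integral_of_le zero_le_one]
  have e1 := intervalIntegral.smul_integral_comp_add_mul (a := 0) (b := 1)
    (fun τ => inner ℝ (G (chartMap e f (a, τ))) (chartUp e)) (s' - s) s
  simp only [mul_zero, add_zero, mul_one, add_sub_cancel] at e1
  rw [← e1, smul_eq_mul, ← intervalIntegral.integral_const_mul]
  refine intervalIntegral.integral_congr fun θ _ => ?_
  simp only [inner_smul_right]

/-- Existence of the limit value `T a` at the boundary of a Sobolev function along almost every
vertical line in a chart. -/
lemma IsSobolevPair.exists_line_trace {U : Set E2} (hU : IsOpen U) (hb : Bornology.IsBounded U)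
    {u : E2 → ℝ} {G : E2 → E2} (hu : IsSobolevPair U u G) (hum : Measurable u) (hGm : Measurable G)
    (e : E2 ≃ᵃⁱ[ℝ] E2) {f : ℝ → ℝ} (hf : Continuous f) {I : Set ℝ} (hI : IsOpen I) {h : ℝ}
    (hh : 0 < h) (hR : ∀ a ∈ I, ∀ s ∈ Ioo 0 h, chartMap e f (a, s) ∈ U) :
    ∃ T : ℝ → ℝ, Measurable T ∧ ∀ᵐ a, a ∈ I → ∀ᵐ s, s ∈ Ioo 0 h →
      ‖u (chartMap e f (a, s)) - T a‖ₑ ≤ ∫⁻ τ in Ioo 0 s, ‖G (chartMap e f (a, τ))‖ₑ := by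
  have hP := measurePreserving_chartMap e hf.measurable
  have hPm : Measurable (chartMap e f) := (continuous_chartMap e hf).measurable
  -- The primitive from `0` to `s`, written over the fixed interval `(0, h)` with an indicator so
  -- that measurability in `(a, s)` is immediate.
  set J : ℝ → ℝ → ℝ := fun a s => ∫ τ in Ioo 0 h,
    (Iio s).indicator (fun τ => inner ℝ (G (chartMap e f (a, τ))) (chartUp e)) τ with hJ
  have mJ : Measurable fun q : ℝ × ℝ => J q.1 q.2 := by
    refine StronglyMeasurable.measurable ?_
    refine StronglyMeasurable.integral_prod_right' (ν := volume.restrict (Ioo (0 : ℝ) h))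
      (f := fun y : (ℝ × ℝ) × ℝ => (Iio y.1.2).indicator
        (fun τ => inner ℝ (G (chartMap e f (y.1.1, τ))) (chartUp e)) y.2) ?_
    refine Measurable.stronglyMeasurable ?_
    have m1 : MeasurableSet {y : (ℝ × ℝ) × ℝ | y.2 < y.1.2} :=
      measurableSet_lt (by fun_prop) (by fun_prop)
    have m2 : Measurable fun y : (ℝ × ℝ) × ℝ =>
        (inner ℝ (G (chartMap e f (y.1.1, y.2))) (chartUp e) : ℝ) :=
      (hGm.comp (hPm.comp (by fun_prop))).inner measurable_const
    have := m2.indicator m1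
    convert this using 1
    funext y
    by_cases hy : y.2 < y.1.2 <;> simp [indicator, hy]
  -- On almost every line `u - J` is almost everywhere constant in `s`. Its mean over `(0, h)`
  -- selects that constant measurably in `a`.
  set T : ℝ → ℝ := fun a => h⁻¹ * ∫ s in Ioo 0 h, (u (chartMap e f (a, s)) - J a s) with hT
  have mT : Measurable T := by
    refine Measurable.const_mul (StronglyMeasurable.measurable ?_) _
    refine StronglyMeasurable.integral_prod_right' (ν := volume.restrict (Ioo (0 : ℝ) h))
      (f := fun y : ℝ × ℝ => u (chartMap e f y) - J y.1 y.2) ?_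
    exact ((hum.comp hPm).sub mJ).stronglyMeasurable
  refine ⟨T, mT, ?_⟩
  have iG : Integrable (U.indicator G) :=
    (integrable_indicator_iff hU.measurableSet).2 (hu.integrableOn_grad hb)
  have iGP := (hP.integrable_comp_of_integrable iG).prod_right_ae
  filter_upwards [hu.ae_vertical hU hb hum hGm e hf hI hR, iGP] with a ha hia haI
  have ig : IntegrableOn (fun τ => (inner ℝ (G (chartMap e f (a, τ))) (chartUp e) : ℝ))
      (Ioo 0 h) := by
    have : IntegrableOn (fun τ => G (chartMap e f (a, τ))) (Ioo 0 h) := by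
      refine hia.integrableOn.congr_fun (fun s hs => ?_) measurableSet_Ioo
      simp [hR a haI s hs]
    exact this.inner_const _
  have hJi : ∀ s ∈ Ioo 0 h, J a s
      = ∫ τ in (0 : ℝ)..s, inner ℝ (G (chartMap e f (a, τ))) (chartUp e) := by
    intro s hs
    rw [hJ]; dsimp only
    rw [setIntegral_indicator measurableSet_Iio, intervalIntegral.integral_of_le hs.1.le,
      integral_Ioc_eq_integral_Ioo]
    congr 2
    ext τ
    simp only [mem_inter_iff, mem_Ioo, mem_Iio]
    exact ⟨fun h => ⟨h.1.1, h.2⟩, fun h => ⟨⟨h.1, h.2.trans hs.2⟩, h.2⟩⟩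
  have ii : ∀ s ∈ Ioo 0 h, IntervalIntegrable
      (fun τ => (inner ℝ (G (chartMap e f (a, τ))) (chartUp e) : ℝ)) volume 0 s := by
    intro s hs
    rw [intervalIntegrable_iff_integrableOn_Ioo_of_le hs.1.le]
    exact ig.mono_set (Ioo_subset_Ioo_right hs.2.le)
  filter_upwards [ha haI] with s hs hsI
  have hTa : T a = u (chartMap e f (a, s)) - J a s := by
    have : ∫ s' in Ioo 0 h, (u (chartMap e f (a, s')) - J a s')
        = ∫ s' in Ioo 0 h, (u (chartMap e f (a, s)) - J a s) := by
      refine integral_congr_ae ?_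
      filter_upwards [ae_restrict_of_ae hs, ae_restrict_mem measurableSet_Ioo] with s' h1 h2
      have := h1 hsI h2
      rw [hJi s' h2, hJi s hsI]
      have e1 := intervalIntegral.integral_interval_sub_left (ii s' h2) (ii s hsI)
      rw [← e1] at this
      linarith
    rw [hT]; dsimp only
    rw [this]
    simp [hh.le]
    field_simp
  rw [hTa, sub_sub_cancel, hJi s hsI, intervalIntegral.integral_of_le hsI.1.le,
    integral_Ioc_eq_integral_Ioo]
  refine (enorm_integral_le_lintegral_enorm _).trans (lintegral_mono fun τ => ?_)
  simp only [← ofReal_norm]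
  refine ENNReal.ofReal_le_ofReal ((norm_inner_le_norm _ _).trans ?_)
  rw [norm_chartUp, mul_one]

/-- The `L²` norm over the base of a chart of the limit values along vertical lines. -/
lemma lintegral_line_trace_le {U : Set E2} (hU : IsOpen U)
    {u : E2 → ℝ} {G : E2 → E2} (hum : Measurable u) (hGm : Measurable G)
    (e : E2 ≃ᵃⁱ[ℝ] E2) {f : ℝ → ℝ} (hf : Continuous f) {I : Set ℝ} (hI : IsOpen I) {h : ℝ}
    (hh : 0 < h) (hR : ∀ a ∈ I, ∀ s ∈ Ioo 0 h, chartMap e f (a, s) ∈ U)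
    {T : ℝ → ℝ} (hT : ∀ᵐ a, a ∈ I → ∀ᵐ s, s ∈ Ioo 0 h →
      ‖u (chartMap e f (a, s)) - T a‖ₑ ≤ ∫⁻ τ in Ioo 0 s, ‖G (chartMap e f (a, τ))‖ₑ) (m : ℝ) :
    ∫⁻ a in I, ‖T a - m‖ₑ ^ 2 ≤ ENNReal.ofReal (2 / h) * (∫⁻ z in U, ‖u z - m‖ₑ ^ 2)
      + ENNReal.ofReal (2 * h) * ∫⁻ z in U, ‖G z‖ₑ ^ 2 := by
  have hP := measurePreserving_chartMap e hf.measurable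
  have hPm : Measurable (chartMap e f) := (continuous_chartMap e hf).measurable
  have fub : ∀ F : E2 → ENNReal, Measurable F →
      ∫⁻ a in I, ∫⁻ s in Ioo 0 h, F (chartMap e f (a, s)) ≤ ∫⁻ z in U, F z := by
    intro F hF
    have e1 : ∫⁻ a in I, ∫⁻ s in Ioo 0 h, F (chartMap e f (a, s))
        = ∫⁻ q in I ×ˢ Ioo 0 h, F (chartMap e f q) ∂(volume.prod volume) := by
      rw [← Measure.prod_restrict, lintegral_prod (fun q => F (chartMap e f q)) (hF.comp hPm).aemeasurable]
    rw [e1, ← hP.setLIntegral_comp_preimage hU.measurableSet hF]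
    exact lintegral_mono_set fun q hq => hR q.1 hq.1 q.2 hq.2
  set c := ENNReal.ofReal h with hc
  have hc0 : c ≠ 0 := by simpa [hc] using hh
  have hct : c ≠ ⊤ := by simp [hc]
  have vI : volume (Ioo 0 h) = c := by simp [hc]
  -- Compare `T a - m` with `u - m` at every height and average over `(0, h)`. The error is at most
  -- `H`, the integral of `|G|` along the line, and Cauchy–Schwarz bounds `H²`.
  have point : ∀ᵐ a, a ∈ I → c * ‖T a - m‖ₑ ^ 2 ≤
      2 * (∫⁻ s in Ioo 0 h, ‖u (chartMap e f (a, s)) - m‖ₑ ^ 2)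
      + 2 * c ^ 2 * ∫⁻ s in Ioo 0 h, ‖G (chartMap e f (a, s))‖ₑ ^ 2 := by
    filter_upwards [hT] with a ha haI
    set H := ∫⁻ τ in Ioo 0 h, ‖G (chartMap e f (a, τ))‖ₑ with hH
    have mG : Measurable fun τ => ‖G (chartMap e f (a, τ))‖ₑ :=
      (hGm.comp (hPm.comp (by fun_prop))).enorm
    have mu : Measurable fun τ => ‖u (chartMap e f (a, τ)) - m‖ₑ :=
      ((hum.comp (hPm.comp (by fun_prop))).sub_const m).enorm
    have hH2 : H ^ 2 ≤ c * ∫⁻ s in Ioo 0 h, ‖G (chartMap e f (a, s))‖ₑ ^ 2 := by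
      have := ENNReal.lintegral_mul_le_Lp_mul_Lq (volume.restrict (Ioo 0 h))
        Real.HolderConjugate.two_two mG.aemeasurable (aemeasurable_const (b := (1 : ENNReal)))
      simp only [Pi.mul_apply, mul_one, lintegral_const, one_mul,
        Measure.restrict_apply_univ, vI, ENNReal.rpow_ofNat, one_pow] at this
      calc H ^ 2 ≤ ((∫⁻ s in Ioo 0 h, ‖G (chartMap e f (a, s))‖ₑ ^ 2) ^ (1 / 2 : ℝ)
            * c ^ (1 / 2 : ℝ)) ^ 2 := by gcongr
        _ = _ := by
          rw [mul_pow, ← ENNReal.rpow_natCast, ← ENNReal.rpow_mul, ← ENNReal.rpow_natCast,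
            ← ENNReal.rpow_mul]
          norm_num [mul_comm]
    calc c * ‖T a - m‖ₑ ^ 2 = ∫⁻ s in Ioo 0 h, ‖T a - m‖ₑ ^ 2 := by simp [vI, mul_comm]
      _ ≤ ∫⁻ s in Ioo 0 h, (2 * ‖u (chartMap e f (a, s)) - m‖ₑ ^ 2 + 2 * H ^ 2) := by
        refine lintegral_mono_ae ?_
        filter_upwards [ae_restrict_of_ae (ha haI), ae_restrict_mem measurableSet_Ioo] with s h1 h2
        have b := enorm_add_sq_le (u (chartMap e f (a, s)) - m) (-(u (chartMap e f (a, s)) - T a))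
        rw [enorm_neg, mul_add] at b
        have e1 : T a - m = (u (chartMap e f (a, s)) - m) + -(u (chartMap e f (a, s)) - T a) := by
          ring
        rw [e1]
        refine b.trans ?_
        gcongr
        exact (h1 h2).trans (lintegral_mono_set (Ioo_subset_Ioo_right h2.2.le))
      _ = 2 * (∫⁻ s in Ioo 0 h, ‖u (chartMap e f (a, s)) - m‖ₑ ^ 2) + 2 * H ^ 2 * c := by
        rw [lintegral_add_right _ measurable_const, lintegral_const_mul' _ _ (by simp)]
        simp [vI]
      _ ≤ 2 * (∫⁻ s in Ioo 0 h, ‖u (chartMap e f (a, s)) - m‖ₑ ^ 2)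
          + 2 * (c * ∫⁻ s in Ioo 0 h, ‖G (chartMap e f (a, s))‖ₑ ^ 2) * c := by gcongr
      _ = _ := by ring
  have total : c * ∫⁻ a in I, ‖T a - m‖ₑ ^ 2 ≤ 2 * (∫⁻ z in U, ‖u z - m‖ₑ ^ 2)
      + 2 * c ^ 2 * ∫⁻ z in U, ‖G z‖ₑ ^ 2 := by
    rw [← lintegral_const_mul' _ _ hct]
    calc _ ≤ ∫⁻ a in I, (2 * (∫⁻ s in Ioo 0 h, ‖u (chartMap e f (a, s)) - m‖ₑ ^ 2)
      + 2 * c ^ 2 * ∫⁻ s in Ioo 0 h, ‖G (chartMap e f (a, s))‖ₑ ^ 2) := by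
          refine lintegral_mono_ae ?_
          filter_upwards [ae_restrict_of_ae point, ae_restrict_mem hI.measurableSet] with a h1 h2
          exact h1 h2
      _ = 2 * (∫⁻ a in I, ∫⁻ s in Ioo 0 h, ‖u (chartMap e f (a, s)) - m‖ₑ ^ 2)
        + 2 * c ^ 2 * ∫⁻ a in I, ∫⁻ s in Ioo 0 h, ‖G (chartMap e f (a, s))‖ₑ ^ 2 := by
          rw [lintegral_add_left, lintegral_const_mul' _ _ (by simp),
            lintegral_const_mul' _ _ (by finiteness)]
          refine Measurable.const_mul ?_ 2
          refine Measurable.lintegral_prod_right'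
            (f := fun q : ℝ × ℝ => ‖u (chartMap e f q) - m‖ₑ ^ 2) ?_
          exact (((hum.comp hPm).sub_const m).enorm.pow_const 2)
      _ ≤ _ := by
          gcongr
          · exact fub (fun z => ‖u z - m‖ₑ ^ 2) ((hum.sub_const m).enorm.pow_const 2)
          · exact fub (fun z => ‖G z‖ₑ ^ 2) (hGm.enorm.pow_const 2)
  have h2h : ENNReal.ofReal (2 / h) = 2 * c⁻¹ := by
    rw [div_eq_mul_inv, ENNReal.ofReal_mul (by norm_num), ENNReal.ofReal_inv_of_pos hh]; simp [hc]
  have h2h' : ENNReal.ofReal (2 * h) = 2 * c := by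
    rw [ENNReal.ofReal_mul (by norm_num)]; simp [hc]
  rw [h2h, h2h']
  calc ∫⁻ a in I, ‖T a - m‖ₑ ^ 2 = c⁻¹ * (c * ∫⁻ a in I, ‖T a - m‖ₑ ^ 2) := by
        rw [← mul_assoc, ENNReal.inv_mul_cancel hc0 hct, one_mul]
    _ ≤ c⁻¹ * (2 * (∫⁻ z in U, ‖u z - m‖ₑ ^ 2) + 2 * c ^ 2 * ∫⁻ z in U, ‖G z‖ₑ ^ 2) := by gcongr
    _ = 2 * c⁻¹ * (∫⁻ z in U, ‖u z - m‖ₑ ^ 2)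
        + 2 * (c⁻¹ * c) * c * ∫⁻ z in U, ‖G z‖ₑ ^ 2 := by ring
    _ = _ := by rw [ENNReal.inv_mul_cancel hc0 hct, mul_one]

/-! ### The trace theorem, with traces as limits of averages. -/

/-- Functions of `H¹(U)` have a trace `ℋ¹`-a.e. on `S`, which is square integrable, with estimates
depending only on `U` and `S`. -/
def HasTraceBound (U S : Set E2) : Prop :=
  ∃ C : NNReal, ∀ u G, IsSobolevPair U u G →
    (∀ᵐ x ∂(μH[1] : Measure E2).restrict S, HasTraceAt U u x (traceFn U u x)) ∧
    AEMeasurable (traceFn U u) ((μH[1] : Measure E2).restrict S) ∧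
    ∀ m : ℝ, ∫⁻ x in S, ‖traceFn U u x - m‖ₑ ^ 2 ∂μH[1]
      ≤ C * ((∫⁻ z in U, ‖u z - m‖ₑ ^ 2) + ∫⁻ z in U, ‖G z‖ₑ ^ 2)

lemma HasTraceAt.traceFn_eq {U : Set E2} {f : E2 → ℝ} {x : E2} {c : ℝ} (h : HasTraceAt U f x c) :
    traceFn U f x = c := h.limUnder_eq

lemma HasTraceBound.mono {U S S' : Set E2} (h : HasTraceBound U S') (hS : S ⊆ S') :
    HasTraceBound U S := by
  obtain ⟨C, hC⟩ := h
  refine ⟨C, fun u G hu => ?_⟩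
  obtain ⟨h1, h2, h3⟩ := hC u G hu
  exact ⟨ae_mono (Measure.restrict_mono_set _ hS) h1,
    h2.mono_measure (Measure.restrict_mono_set _ hS), fun m => (lintegral_mono_set hS).trans (h3 m)⟩

lemma HasTraceBound.union {U S S' : Set E2} (h : HasTraceBound U S) (h' : HasTraceBound U S') :
    HasTraceBound U (S ∪ S') := by
  obtain ⟨C, hC⟩ := h
  obtain ⟨D, hD⟩ := h'
  refine ⟨C + D, fun u G hu => ?_⟩
  obtain ⟨h1, h2, h3⟩ := hC u G hu
  obtain ⟨k1, k2, k3⟩ := hD u G hu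
  refine ⟨(ae_restrict_union_iff _ _ _).2 ⟨h1, k1⟩, aemeasurable_union_iff.2 ⟨h2, k2⟩, fun m => ?_⟩
  refine (lintegral_union_le _ _ _).trans ((add_le_add (h3 m) (k3 m)).trans ?_)
  rw [ENNReal.coe_add, add_mul]

lemma HasTraceBound.empty (U : Set E2) : HasTraceBound U ∅ := ⟨0, fun u G _ => by simp⟩

/-- The pieces of `U` around a boundary point of a chart are comparable to discs. -/
lemma IsChart.volume_ball_inter_ge {U : Set E2} {p : E2} {e : E2 ≃ᵃⁱ[ℝ] E2} {f : ℝ → ℝ}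
    {K : NNReal} {ρ : ℝ} (hc : IsChart U p e f K ρ) {a r : ℝ} (hr : 0 < r)
    (hball : Metric.ball (chartMap e f (a, 0)) r ⊆ Metric.ball p ρ) :
    ENNReal.ofReal (2 * (r / (2 + K)) ^ 2) ≤ volume (Metric.ball (chartMap e f (a, 0)) r ∩ U) := by
  have hK : (0 : ℝ) ≤ K := K.2
  have hP := measurePreserving_chartMap e hc.lipschitz.continuous.measurable
  have hPc := continuous_chartMap e hc.lipschitz.continuous
  -- The box of half-width and height `η` over `a` is mapped into the ball, since `(1 + K) η + η =
  -- r`; its area is `2 η²`.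
  set η := r / (2 + K) with hη
  have hη0 : 0 < η := by positivity
  have hηr : (2 + K) * η = r := by rw [hη]; field_simp
  have mU : MeasurableSet (Metric.ball (chartMap e f (a, 0)) r ∩ U) := by
    have : Metric.ball (chartMap e f (a, 0)) r ∩ U
        = Metric.ball (chartMap e f (a, 0)) r ∩ {x | f (e x 0) < e x 1} := by
      ext x
      exact and_congr_right fun hx => hc.mem_iff x (hball hx)
    rw [this]
    exact (Metric.isOpen_ball.inter (isOpen_lt (hc.lipschitz.continuous.comp (continuous_chart e 0))
      (continuous_chart e 1))).measurableSet
  rw [← hP.measure_preimage mU.nullMeasurableSet]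
  calc ENNReal.ofReal (2 * η ^ 2)
      = (volume.prod volume) (Metric.ball a η ×ˢ Ioo 0 η) := by
        rw [Measure.prod_prod, Real.volume_ball, Real.volume_Ioo, ← ENNReal.ofReal_mul (by positivity)]
        congr 1; ring
    _ ≤ _ := by
        refine measure_mono fun q hq => ?_
        have h1 : |q.1 - a| < η := hq.1
        have h2 : q.2 ∈ Ioo 0 η := hq.2
        have hd := dist_chartMap_le e hc.lipschitz q (a, 0)
        have hmem : chartMap e f q ∈ Metric.ball (chartMap e f (a, 0)) r := by
          rw [Metric.mem_ball]
          refine hd.trans_lt ?_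
          simp only [sub_zero, abs_of_pos h2.1]
          nlinarith [h2.2, abs_nonneg (q.1 - a)]
        refine ⟨hmem, (hc.mem_iff _ (hball hmem)).2 ?_⟩
        simp [h2.1]

lemma enorm_average_sub_le {X : Type*} [MeasurableSpace X] {μ : Measure X} {s : Set X}
    (h0 : μ s ≠ 0) (ht : μ s ≠ ⊤) {u : X → ℝ} (hu : IntegrableOn u s μ) (c : ℝ) :
    ‖(⨍ y in s, u y ∂μ) - c‖ₑ ≤ (∫⁻ y in s, ‖u y - c‖ₑ ∂μ) / μ s := by
  have : IsFiniteMeasure (μ.restrict s) := ⟨by simpa using ht.lt_top⟩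
  have hr : μ.real s ≠ 0 := (ENNReal.toReal_pos h0 ht).ne'
  have e1 : (⨍ y in s, u y ∂μ) - c = (μ.real s)⁻¹ * ∫ y in s, (u y - c) ∂μ := by
    rw [setAverage_eq, integral_sub hu (integrable_const c), smul_eq_mul, mul_sub]
    simp [hr]
  rw [e1, enorm_mul, ENNReal.div_eq_inv_mul]
  have : ‖(μ.real s)⁻¹‖ₑ = (μ s)⁻¹ := by
    rw [← ofReal_norm, norm_inv, Real.norm_of_nonneg measureReal_nonneg,
      ENNReal.ofReal_inv_of_pos (lt_of_le_of_ne measureReal_nonneg hr.symm), ofReal_measureReal ht]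
  rw [this]
  gcongr
  exact enorm_integral_le_lintegral_enorm _

/-- In chart coordinates the piece of `U` in a ball of radius `r` lies in the box `|y - a| ≤ r`, `0
< s < (1 + K) r`, and has comparable area. For each fixed `k` and small `r`, the mean of `|u - T a|`
is thus at most `κ` times the mean over `[a - r, a + r]` of `|T y - T a| + Y k y`. At a common
Lebesgue point of `T` and of all `Y k` the bound tends to `κ Y k a`, and `Y k a → 0` as `k → ∞`. -/
lemma IsChart.hasTraceAt_line_trace {U : Set E2} {p : E2} {e : E2 ≃ᵃⁱ[ℝ] E2} {f : ℝ → ℝ}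
    {K : NNReal} {ρ : ℝ} (hc : IsChart U p e f K ρ) (hU : IsOpen U) (hb : Bornology.IsBounded U)
    {u : E2 → ℝ} {G : E2 → E2} (hu : IsSobolevPair U u G) (hum : Measurable u) (hGm : Measurable G)
    {I : Set ℝ} (hI : IsOpen I) {h : ℝ} (hh : 0 < h)
    (hR : ∀ a ∈ I, ∀ s ∈ Ioo 0 h, chartMap e f (a, s) ∈ U)
    (hI0 : ∀ a ∈ I, chartMap e f (a, 0) ∈ Metric.ball p ρ)
    {T : ℝ → ℝ} (iT : IntegrableOn T I)
    (hT : ∀ᵐ a, a ∈ I → ∀ᵐ s, s ∈ Ioo 0 h →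
      ‖u (chartMap e f (a, s)) - T a‖ₑ ≤ ∫⁻ τ in Ioo 0 s, ‖G (chartMap e f (a, τ))‖ₑ) :
    ∀ᵐ a, a ∈ I → HasTraceAt U u (chartMap e f (a, 0)) (T a) := by
  have hfc := hc.lipschitz.continuous
  have hK : (0 : ℝ) ≤ K := K.2
  have hP := measurePreserving_chartMap e hfc.measurable
  have hPm : Measurable (chartMap e f) := (continuous_chartMap e hfc).measurable
  set V := IsUnifLocDoublingMeasure.vitaliFamily (volume : Measure ℝ) 1 with hV
  have balls : ∀ a : ℝ, Tendsto (fun r : ℝ => Metric.closedBall a r) (𝓝[>] 0) (V.filterAt a) := by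
    intro a
    refine IsUnifLocDoublingMeasure.tendsto_closedBall_filterAt volume (fun _ => a) id tendsto_id ?_
    filter_upwards [self_mem_nhdsWithin] with r hr
    exact Metric.mem_closedBall_self (by simpa using (mem_Ioi.1 hr).le)
  have iG : IntegrableOn G U := hu.integrableOn_grad hb
  -- the mass of the gradient on short vertical segments
  set Y : ℕ → ℝ → ENNReal := fun k => I.indicator fun a =>
    ∫⁻ τ in Ioo 0 (h / (k + 1)), ‖G (chartMap e f (a, τ))‖ₑ with hY
  have mY0 : ∀ δ : ℝ, Measurable fun a => ∫⁻ τ in Ioo 0 δ, ‖G (chartMap e f (a, τ))‖ₑ := fun δ =>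
    Measurable.lintegral_prod_right' (f := fun q : ℝ × ℝ => ‖G (chartMap e f q)‖ₑ)
      (hGm.comp hPm).enorm
  have mY : ∀ k, Measurable (Y k) := fun k => (mY0 _).indicator hI.measurableSet
  have hYsub : ∀ k : ℕ, h / (k + 1) ≤ h := fun k =>
    div_le_self hh.le (by linarith [(Nat.cast_nonneg k : (0 : ℝ) ≤ k)])
  have hYfin : ∫⁻ a in I, ∫⁻ τ in Ioo 0 h, ‖G (chartMap e f (a, τ))‖ₑ ≠ ⊤ := by
    have e1 : ∫⁻ a in I, ∫⁻ s in Ioo 0 h, ‖G (chartMap e f (a, s))‖ₑ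
        = ∫⁻ q in I ×ˢ Ioo 0 h, ‖G (chartMap e f q)‖ₑ ∂(volume.prod volume) := by
      rw [← Measure.prod_restrict,
        lintegral_prod (fun q => ‖G (chartMap e f q)‖ₑ) (hGm.comp hPm).enorm.aemeasurable]
    have e2 : ∫⁻ q in I ×ˢ Ioo 0 h, ‖G (chartMap e f q)‖ₑ ∂(volume.prod volume)
        ≤ ∫⁻ z in U, ‖G z‖ₑ := by
      rw [← hP.setLIntegral_comp_preimage hU.measurableSet hGm.enorm]
      exact lintegral_mono_set fun q hq => hR q.1 hq.1 q.2 hq.2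
    rw [e1]
    exact (e2.trans_lt iG.2).ne
  have hYint : ∀ k, ∫⁻ a, Y k a ≠ ⊤ := by
    intro k
    refine ne_top_of_le_ne_top hYfin ?_
    rw [hY]; dsimp only
    rw [lintegral_indicator hI.measurableSet]
    exact lintegral_mono fun a => lintegral_mono_set (Ioo_subset_Ioo_right (hYsub k))
  have hYlim : ∀ᵐ a, a ∈ I → Tendsto (fun k => Y k a) atTop (𝓝 0) := by
    have hfin : ∀ᵐ a ∂volume.restrict I,
        ∫⁻ τ in Ioo 0 h, ‖G (chartMap e f (a, τ))‖ₑ < ⊤ := ae_lt_top (mY0 h) hYfin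
    filter_upwards [(ae_restrict_iff' hI.measurableSet).1 hfin] with a ha haI
    have := tendsto_setLIntegral_zero (μ := volume.restrict (Ioo 0 h)) (l := atTop)
      (f := fun τ => ‖G (chartMap e f (a, τ))‖ₑ) (ha haI).ne
      (s := fun k : ℕ => Ioo 0 (h / (k + 1))) ?_
    · refine this.congr fun k => ?_
      rw [hY]; dsimp only
      rw [indicator_of_mem haI, Measure.restrict_restrict measurableSet_Ioo,
        inter_eq_left.2 (Ioo_subset_Ioo_right (hYsub k))]
    · have h1 : Tendsto (fun k : ℕ => ENNReal.ofReal (h / (k + 1))) atTop (𝓝 0) := by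
        have : Tendsto (fun k : ℕ => h / ((k : ℝ) + 1)) atTop (𝓝 0) :=
          tendsto_const_nhds.div_atTop (tendsto_natCast_atTop_atTop.atTop_add tendsto_const_nhds)
        simpa using ENNReal.tendsto_ofReal this
      refine tendsto_of_tendsto_of_tendsto_of_le_of_le tendsto_const_nhds h1
        (fun _ => zero_le) fun k => ?_
      refine (Measure.restrict_apply_le _ _).trans ?_
      simp
  have hYleb : ∀ᵐ a, ∀ k, Tendsto (fun s => (∫⁻ y in s, Y k y) / volume s) (V.filterAt a)
      (𝓝 (Y k a)) :=
    ae_all_iff.2 fun k => V.ae_tendsto_lintegral_div (mY k).aemeasurable (hYint k)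
  have hTleb := V.ae_tendsto_lintegral_enorm_sub_div (f := I.indicator T)
    ((integrable_indicator_iff hI.measurableSet).2 iT).locallyIntegrable
  -- The height `(1 + K) r` of the box over the lower bound `2 (r / (2 + K))²` for the area equals
  -- `κ / (2r)`, where `2r` is the length of the base interval.
  set κ : ENNReal := ENNReal.ofReal ((1 + K) * (2 + K) ^ 2) with hκ
  filter_upwards [hYlim, hYleb, hTleb] with a hY0 hYk hTa haI
  have hTa' := hTa.comp (balls a)
  have hYk' := fun k => (hYk k).comp (balls a)
  -- the main estimate
  have est : ∀ k, ∀ᶠ r in 𝓝[>] (0 : ℝ),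
      ‖(⨍ y in Metric.ball (chartMap e f (a, 0)) r ∩ U, u y) - T a‖ₑ ≤
      κ * (((∫⁻ y in Metric.closedBall a r, ‖I.indicator T y - I.indicator T a‖ₑ) /
        volume (Metric.closedBall a r)) +
        (∫⁻ y in Metric.closedBall a r, Y k y) / volume (Metric.closedBall a r)) := by
    intro k
    have ev1 : ∀ᶠ r in 𝓝[>] (0 : ℝ), Metric.closedBall a r ⊆ I := by
      obtain ⟨ε, hε, hεI⟩ := Metric.isOpen_iff.1 hI a haI
      filter_upwards [Ioo_mem_nhdsGT hε] with r hr
      exact (Metric.closedBall_subset_ball hr.2).trans hεI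
    have ev2 : ∀ᶠ r in 𝓝[>] (0 : ℝ),
        Metric.ball (chartMap e f (a, 0)) r ⊆ Metric.ball p ρ := by
      obtain ⟨ε, hε, hεI⟩ := Metric.isOpen_iff.1 Metric.isOpen_ball _ (hI0 a haI)
      filter_upwards [Ioo_mem_nhdsGT hε] with r hr
      exact (Metric.ball_subset_ball hr.2.le).trans hεI
    have hδ : 0 < h / (k + 1) / (1 + K) := by positivity
    filter_upwards [ev1, ev2, Ioo_mem_nhdsGT hδ] with r hrI hrB hr
    have hr0 := hr.1
    have hrδ : (1 + K) * r < h / (k + 1) := by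
      have := hr.2
      rw [lt_div_iff₀ (by positivity)] at this
      linarith
    set B := Metric.ball (chartMap e f (a, 0)) r ∩ U with hB
    have hBm : MeasurableSet B := (Metric.isOpen_ball.inter hU).measurableSet
    have hvol := hc.volume_ball_inter_ge hr0 hrB
    rw [← hB] at hvol
    have hv0 : volume B ≠ 0 := by
      intro h0
      rw [h0] at hvol
      have : 0 < ENNReal.ofReal (2 * (r / (2 + K)) ^ 2) := ENNReal.ofReal_pos.2 (by positivity)
      exact absurd hvol (not_le.2 this)
    have hvt : volume B ≠ ⊤ := ((measure_mono inter_subset_left).trans_lt measure_ball_lt_top).ne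
    refine (enorm_average_sub_le hv0 hvt
      ((hu.integrableOn_fn hb).mono_set inter_subset_right) (T a)).trans ?_
    set Z : ENNReal := (∫⁻ y in Metric.closedBall a r, ‖I.indicator T y - I.indicator T a‖ₑ)
      + ∫⁻ y in Metric.closedBall a r, Y k y with hZ
    have hnum : ∫⁻ y in B, ‖u y - T a‖ₑ ≤ ENNReal.ofReal ((1 + K) * r) * Z := by
      rw [← hP.setLIntegral_comp_preimage hBm (hum.sub_const _).enorm]
      have hsub : chartMap e f ⁻¹' B ⊆ Metric.closedBall a r ×ˢ Ioo 0 ((1 + K) * r) := by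
        intro q hq
        have hq1 := Metric.mem_ball.1 hq.1
        have c0 := (abs_chart_sub_le e _ _ 0).trans_lt hq1
        have c1 := (abs_chart_sub_le e _ _ 1).trans_lt hq1
        rw [chart_chartMap_zero, chart_chartMap_zero] at c0
        rw [chart_chartMap_one, chart_chartMap_one, add_zero] at c1
        have hm := (hc.mem_iff _ (hrB hq.1)).1 hq.2
        rw [chart_chartMap_zero, chart_chartMap_one] at hm
        have hl := hc.lipschitz.dist_le_mul q.1 a
        rw [Real.dist_eq, Real.dist_eq] at hl
        refine ⟨Metric.mem_closedBall.2 c0.le, by linarith, ?_⟩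
        have l1 := (abs_le.1 hl).1
        have l2 := (abs_lt.1 c1).2
        have : (K : ℝ) * |q.1 - a| ≤ K * r := by gcongr
        simp only at l2
        linarith
      refine (lintegral_mono_set hsub).trans ?_
      rw [← Measure.prod_restrict, lintegral_prod (fun q => ‖u (chartMap e f q) - T a‖ₑ)
        ((hum.comp hPm).sub_const _).enorm.aemeasurable]
      calc _ ≤ ∫⁻ y in Metric.closedBall a r, ENNReal.ofReal ((1 + K) * r) *
            (‖I.indicator T y - I.indicator T a‖ₑ + Y k y) := by
            refine lintegral_mono_ae ?_
            filter_upwards [ae_restrict_of_ae hT,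
              ae_restrict_mem Metric.isClosed_closedBall.measurableSet] with y hy hyB
            have hyI := hrI hyB
            calc ∫⁻ s in Ioo 0 ((1 + K) * r), ‖u (chartMap e f (y, s)) - T a‖ₑ
                ≤ ∫⁻ s in Ioo 0 ((1 + K) * r),
                  (‖I.indicator T y - I.indicator T a‖ₑ + Y k y) := by
                  refine lintegral_mono_ae ?_
                  filter_upwards [ae_restrict_of_ae (hy hyI),
                    ae_restrict_mem measurableSet_Ioo] with s h1 h2
                  have h3 := h1 ⟨h2.1, h2.2.trans (hrδ.trans_le (hYsub k))⟩
                  rw [indicator_of_mem hyI, indicator_of_mem haI]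
                  have h4 : ∫⁻ τ in Ioo 0 s, ‖G (chartMap e f (y, τ))‖ₑ ≤ Y k y := by
                    rw [hY]; dsimp only
                    rw [indicator_of_mem hyI]
                    exact lintegral_mono_set (Ioo_subset_Ioo_right (h2.2.trans hrδ).le)
                  calc ‖u (chartMap e f (y, s)) - T a‖ₑ
                      = ‖(T y - T a) + (u (chartMap e f (y, s)) - T y)‖ₑ := by ring_nf
                    _ ≤ _ := (enorm_add_le _ _).trans (by gcongr; exact h3.trans h4)
              _ = _ := by simp [mul_comm]
        _ = _ := by
            rw [lintegral_const_mul' _ _ (by simp), lintegral_add_right _ (mY k)]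
    have hcb : volume (Metric.closedBall a r) = ENNReal.ofReal (2 * r) := Real.volume_closedBall a r
    rw [hcb, ← ENNReal.add_div, ← hZ]
    calc (∫⁻ y in B, ‖u y - T a‖ₑ) / volume B
        ≤ (ENNReal.ofReal ((1 + K) * r) * Z) / ENNReal.ofReal (2 * (r / (2 + K)) ^ 2) := by gcongr
      _ = κ * (Z / ENNReal.ofReal (2 * r)) := by
        rw [ENNReal.div_eq_inv_mul, ENNReal.div_eq_inv_mul, hκ,
          ← ENNReal.ofReal_inv_of_pos (by positivity), ← ENNReal.ofReal_inv_of_pos (by positivity),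
          ← mul_assoc, ← mul_assoc, ← ENNReal.ofReal_mul (by positivity),
          ← ENNReal.ofReal_mul (by positivity)]
        congr 2
        field_simp
  have hlim : Tendsto (fun r => ‖(⨍ y in Metric.ball (chartMap e f (a, 0)) r ∩ U, u y) - T a‖ₑ)
      (𝓝[>] 0) (𝓝 0) := by
    have hκt : κ ≠ ⊤ := by simp [hκ]
    rw [ENNReal.tendsto_nhds_zero]
    intro ε hε
    have hYκ : Tendsto (fun k => κ * (0 + Y k a)) atTop (𝓝 0) := by
      have := ENNReal.Tendsto.const_mul (a := κ) (hY0 haI) (Or.inr hκt)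
      simpa using this
    obtain ⟨k, hk⟩ := (hYκ.eventually_lt_const hε).exists
    have lim : Tendsto _ (𝓝[>] (0 : ℝ)) (𝓝 (κ * (0 + Y k a))) :=
      ENNReal.Tendsto.const_mul (a := κ) (hTa'.add (hYk' k)) (Or.inr hκt)
    filter_upwards [est k, lim.eventually_lt_const hk] with r h1 h2
    exact h1.trans h2.le
  rw [HasTraceAt, tendsto_iff_norm_sub_tendsto_zero]
  have := (ENNReal.tendsto_toReal (a := 0) (by simp)).comp hlim
  simpa [Function.comp_def, toReal_enorm] using this
/-- A Sobolev pair has Borel representatives. -/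
lemma IsSobolevPair.exists_measurable {U : Set E2} {u : E2 → ℝ} {G : E2 → E2}
    (hu : IsSobolevPair U u G) : ∃ u₀ G₀, IsSobolevPair U u₀ G₀ ∧ Measurable u₀ ∧ Measurable G₀ ∧
      u₀ =ᵐ[volume.restrict U] u ∧ G₀ =ᵐ[volume.restrict U] G := by
  obtain ⟨u₀, mu, eu⟩ := hu.memLp_fn.aestronglyMeasurable
  obtain ⟨G₀, mG, eG⟩ := hu.memLp_grad.aestronglyMeasurable
  refine ⟨u₀, G₀, ⟨?_, hu.memLp_fn.ae_eq eu, hu.memLp_grad.ae_eq eG⟩, mu.measurable,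
    mG.measurable, eu.symm, eG.symm⟩
  intro φ h1 h2 h3 e
  have := hu.weak φ h1 h2 h3 e
  convert this using 1
  · refine integral_congr_ae ?_
    filter_upwards [eu] with x hx
    rw [hx]
  · congr 1
    refine integral_congr_ae ?_
    filter_upwards [eG] with x hx
    rw [hx]

lemma integrableOn_of_lintegral_sq {X : Type*} [MeasurableSpace X] {μ : Measure X} {s : Set X}
    (hs : μ s ≠ ⊤) {T : X → ℝ} (hT : Measurable T) (h : ∫⁻ a in s, ‖T a‖ₑ ^ 2 ∂μ ≠ ⊤) :
    IntegrableOn T s μ := by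
  refine ⟨hT.aestronglyMeasurable, ?_⟩
  calc ∫⁻ a in s, ‖T a‖ₑ ∂μ ≤ ∫⁻ a in s, (1 + ‖T a‖ₑ ^ 2) ∂μ := by
        refine lintegral_mono fun a => ?_
        rcases le_total ‖T a‖ₑ 1 with h | h
        · exact h.trans le_self_add
        · exact (le_self_pow₀ h two_ne_zero).trans le_add_self
    _ < ⊤ := by
        rw [lintegral_add_left measurable_const]
        simp [hs.lt_top, h.lt_top]

/-- The boundary is parametrized by the `(1 + K)`-Lipschitz map `Q`, so `ℋ¹` on it is at most `1 +
K` times the image of Lebesgue measure on the base. This carries both the null sets and the `L²`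
bound for the limits along vertical lines over to the boundary. -/
lemma IsChart.exists_hasTraceBound {U : Set E2} {p : E2} {e : E2 ≃ᵃⁱ[ℝ] E2} {f : ℝ → ℝ}
    {K : NNReal} {ρ : ℝ} (hc : IsChart U p e f K ρ) (hU : IsOpen U) (hb : Bornology.IsBounded U)
    (hp : p ∈ frontier U) : ∃ r > 0, HasTraceBound U (frontier U ∩ Metric.ball p r) := by
  have hρ := hc.pos
  have hfc := hc.lipschitz.continuous
  have hK : (0 : ℝ) ≤ K := K.2
  set δ := ρ / (4 * (1 + K)) with hδ
  set h := ρ / 2 with hh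
  have hδ0 : 0 < δ := by positivity
  have hδρ : (1 + K) * δ = ρ / 4 := by rw [hδ]; field_simp
  have hh0 : 0 < h := by positivity
  set a₀ := e p 0 with ha₀
  set I := Metric.ball a₀ δ with hI
  have hp' : chartMap e f (a₀, 0) = p := by
    apply chart_ext e
    · simp [ha₀]
    · simpa [ha₀] using hc.eq_of_frontier p (Metric.mem_ball_self hρ) hp
  have hball : ∀ a ∈ I, ∀ s ∈ Ico 0 h, chartMap e f (a, s) ∈ Metric.ball p ρ := by
    intro a ha s hs
    rw [Metric.mem_ball]
    have e0 : dist (chartMap e f (a, s)) p = dist (chartMap e f (a, s)) (chartMap e f (a₀, 0)) := by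
      rw [hp']
    rw [e0]
    refine (dist_chartMap_le e hc.lipschitz _ _).trans_lt ?_
    have h1 : |a - a₀| < δ := ha
    have h2 : (1 + (K : ℝ)) * |a - a₀| ≤ (1 + K) * δ := by gcongr
    simp only [sub_zero, abs_of_nonneg hs.1]
    linarith [hs.2]
  have hR : ∀ a ∈ I, ∀ s ∈ Ioo 0 h, chartMap e f (a, s) ∈ U := by
    intro a ha s hs
    rw [hc.mem_iff _ (hball a ha s ⟨hs.1.le, hs.2⟩)]
    simp [hs.1]
  refine ⟨min ρ δ, lt_min hρ hδ0,
    (1 + K) * (Real.toNNReal (2 / h) + Real.toNNReal (2 * h)), fun u G hu => ?_⟩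
  obtain ⟨u₀, G₀, hu₀, mu, mG, eu, eG⟩ := hu.exists_measurable
  obtain ⟨T, mT, hT⟩ := hu₀.exists_line_trace hU hb mu mG e hfc Metric.isOpen_ball hh0 hR
  have hTm := lintegral_line_trace_le hU mu mG e hfc Metric.isOpen_ball hh0 hR hT
  have eum : ∀ m : ℝ, ∫⁻ z in U, ‖u₀ z - m‖ₑ ^ 2 = ∫⁻ z in U, ‖u z - m‖ₑ ^ 2 := by
    intro m
    refine lintegral_congr_ae ?_
    filter_upwards [eu] with x hx
    rw [hx]
  have eGm : ∫⁻ z in U, ‖G₀ z‖ₑ ^ 2 = ∫⁻ z in U, ‖G z‖ₑ ^ 2 := by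
    refine lintegral_congr_ae ?_
    filter_upwards [eG] with x hx
    rw [hx]
  have fin_u : ∫⁻ z in U, ‖u z‖ₑ ^ 2 ≠ ⊤ := by
    have := lintegral_rpow_enorm_lt_top_of_eLpNorm_lt_top (by norm_num) (by norm_num)
      hu.memLp_fn.eLpNorm_lt_top
    simpa using this.ne
  have fin_G : ∫⁻ z in U, ‖G z‖ₑ ^ 2 ≠ ⊤ := by
    have := lintegral_rpow_enorm_lt_top_of_eLpNorm_lt_top (by norm_num) (by norm_num)
      hu.memLp_grad.eLpNorm_lt_top
    simpa using this.ne
  have iT : IntegrableOn T I := by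
    refine integrableOn_of_lintegral_sq measure_ball_lt_top.ne mT ?_
    have := hTm 0
    rw [eum, eGm] at this
    simp only [sub_zero] at this
    refine ne_top_of_le_ne_top ?_ this
    finiteness
  have htr := hc.hasTraceAt_line_trace hU hb hu₀ mu mG Metric.isOpen_ball hh0 hR
    (fun a ha => hball a ha 0 ⟨le_rfl, hh0⟩) iT hT
  -- back to the boundary
  set Q : ℝ → E2 := fun a => chartMap e f (a, 0) with hQ
  have hQl : LipschitzWith (1 + K) Q := by
    refine LipschitzWith.of_dist_le_mul fun a b => ?_
    have := dist_chartMap_le e hc.lipschitz (a, 0) (b, 0)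
    simpa [Real.dist_eq] using this
  set S := frontier U ∩ Metric.ball p (min ρ δ) with hS
  have hSQ : ∀ x ∈ S, e x 0 ∈ I ∧ Q (e x 0) = x := by
    intro x hx
    have hx2 := Metric.mem_ball.1 hx.2
    refine ⟨?_, ?_⟩
    · rw [hI, Metric.mem_ball, Real.dist_eq]
      exact (abs_chart_sub_le e x p 0).trans_lt (hx2.trans_le (min_le_right _ _))
    · apply chart_ext e
      · simp [hQ]
      · simpa [hQ] using hc.eq_of_frontier x (Metric.ball_subset_ball (min_le_left _ _) hx.2) hx.1
  have himage : ∀ A : Set ℝ, (μH[1] : Measure E2) (Q '' A) ≤ (1 + K : NNReal) * volume A := by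
    intro A
    have := (hQl.lipschitzOnWith (s := A)).hausdorffMeasure_image_le (d := 1) zero_le_one
    rwa [ENNReal.rpow_one, hausdorffMeasure_real] at this
  have htrS : ∀ᵐ x ∂(μH[1] : Measure E2).restrict S, HasTraceAt U u x (T (e x 0)) := by
    set N : Set ℝ := {a | ¬ (a ∈ I → HasTraceAt U u₀ (Q a) (T a))} with hN
    have hN0 : volume N = 0 := htr
    have hQN : (μH[1] : Measure E2) (Q '' N) = 0 := by
      have := himage N
      rw [hN0, mul_zero] at this
      exact le_antisymm this zero_le
    have hS' : MeasurableSet S :=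
      isClosed_frontier.measurableSet.inter Metric.isOpen_ball.measurableSet
    filter_upwards [ae_restrict_mem hS', ae_restrict_of_ae (compl_mem_ae_iff.2 hQN)] with x hxS hxN
    obtain ⟨hxI, hxQ⟩ := hSQ x hxS
    by_contra hcon
    refine hxN ⟨e x 0, fun hh => hcon ?_, hxQ⟩
    have := hh hxI
    rw [hxQ] at this
    exact this.congr eu
  have heq : traceFn U u =ᵐ[(μH[1] : Measure E2).restrict S] fun x => T (e x 0) := by
    filter_upwards [htrS] with x hx using hx.traceFn_eq
  have mTe : Measurable fun x => T (e x 0) := mT.comp (continuous_chart e 0).measurable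
  refine ⟨?_, mTe.aemeasurable.congr heq.symm, fun m => ?_⟩
  · filter_upwards [htrS, heq] with x hx hx'
    rw [hx']; exact hx
  have hmeas : (μH[1] : Measure E2).restrict S
      ≤ (1 + K : NNReal) • (volume.restrict I).map Q := by
    refine Measure.le_iff.2 fun A hA => ?_
    rw [Measure.restrict_apply hA, Measure.smul_apply, Measure.map_apply hQl.continuous.measurable hA,
      Measure.restrict_apply (hA.preimage hQl.continuous.measurable)]
    refine (measure_mono ?_).trans (himage _)
    rintro x ⟨hxA, hxS⟩
    obtain ⟨hxI, hxQ⟩ := hSQ x hxS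
    exact ⟨e x 0, ⟨by rw [mem_preimage, hxQ]; exact hxA, hxI⟩, hxQ⟩
  calc ∫⁻ x in S, ‖traceFn U u x - m‖ₑ ^ 2 ∂μH[1]
      = ∫⁻ x in S, ‖T (e x 0) - m‖ₑ ^ 2 ∂μH[1] := by
        refine lintegral_congr_ae ?_
        filter_upwards [heq] with x hx
        rw [hx]
    _ ≤ ∫⁻ x, ‖T (e x 0) - m‖ₑ ^ 2 ∂((1 + K : NNReal) • (volume.restrict I).map Q) :=
        lintegral_mono' hmeas le_rfl
    _ = (1 + K : NNReal) * ∫⁻ a in I, ‖T a - m‖ₑ ^ 2 := by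
        rw [lintegral_smul_measure, lintegral_map ((mTe.sub_const m).enorm.pow_const 2)
          hQl.continuous.measurable]
        simp [hQ, ENNReal.smul_def]
    _ ≤ (1 + K : NNReal) * (ENNReal.ofReal (2 / h) * (∫⁻ z in U, ‖u z - m‖ₑ ^ 2)
      + ENNReal.ofReal (2 * h) * ∫⁻ z in U, ‖G z‖ₑ ^ 2) := by
        gcongr
        have := hTm m
        rwa [eum, eGm] at this
    _ ≤ (1 + K : NNReal) * ((ENNReal.ofReal (2 / h) + ENNReal.ofReal (2 * h)) *
        ((∫⁻ z in U, ‖u z - m‖ₑ ^ 2) + ∫⁻ z in U, ‖G z‖ₑ ^ 2)) := by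
        rw [add_mul]
        gcongr
        · exact le_self_add
        · exact le_add_self
    _ = _ := by
        rw [← mul_assoc, ENNReal.coe_mul, ENNReal.coe_add (Real.toNNReal _)]
        rfl

/-- **Trace theorem** on bounded Lipschitz domains. -/
theorem hasTraceBound_frontier {U : Set E2} (hU : IsOpen U) (hb : Bornology.IsBounded U)
    (hlip : HasLipschitzBoundary U) : HasTraceBound U (frontier U) := by
  have hcomp : IsCompact (frontier U) :=
    Metric.isCompact_of_isClosed_isBounded isClosed_frontier
      (hb.closure.subset frontier_subset_closure)
  have := hcomp.induction_on (p := fun s => HasTraceBound U (frontier U ∩ s)) (by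
    simpa using HasTraceBound.empty U) (fun s t hst ht => ht.mono (inter_subset_inter_right _ hst))
    (fun s t hs ht => by rw [inter_union_distrib_left]; exact hs.union ht) (fun p hp => by
      obtain ⟨e, f, K, ρ, hc⟩ := hlip.exists_isChart hU hp
      obtain ⟨r, hr, h⟩ := hc.exists_hasTraceBound hU hb hp
      exact ⟨_, mem_nhdsWithin_of_mem_nhds (Metric.ball_mem_nhds p hr), h⟩)
  simpa using this

/-- The chart image of a rectangle is connected and contains all of `U` close to `p`. This is what
forces `Ω`, near an outer boundary point off the arc, to lie on one side only. -/
lemma IsChart.exists_preconnected {U : Set E2} {p : E2} {e : E2 ≃ᵃⁱ[ℝ] E2} {f : ℝ → ℝ}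
    {K : NNReal} {ρ : ℝ} (hc : IsChart U p e f K ρ) (hp : p ∈ frontier U) {ρ' : ℝ} (hρ' : 0 < ρ') :
    ∃ R : Set E2, IsPreconnected R ∧ R ⊆ U ∩ Metric.ball p ρ' ∧ ∃ r > 0,
      Metric.ball p r ∩ U ⊆ R := by
  have hρ := hc.pos
  have hK : (0 : ℝ) ≤ K := K.2
  set ρ₁ := min ρ ρ' with hρ₁
  have hρ₁0 : 0 < ρ₁ := lt_min hρ hρ'
  set δ := ρ₁ / (4 * (1 + K)) with hδ
  set h := ρ₁ / 2 with hh
  have hδ0 : 0 < δ := by positivity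
  have hδρ : (1 + K) * δ = ρ₁ / 4 := by rw [hδ]; field_simp
  have hδle : δ ≤ ρ₁ := by nlinarith [mul_nonneg hK hδ0.le]
  set a₀ := e p 0 with ha₀
  have hp' : chartMap e f (a₀, 0) = p := by
    apply chart_ext e
    · simp [ha₀]
    · simpa [ha₀] using hc.eq_of_frontier p (Metric.mem_ball_self hρ) hp
  refine ⟨chartMap e f '' (Metric.ball a₀ δ ×ˢ Ioo 0 h), ?_, ?_, δ, hδ0, ?_⟩
  · exact ((convex_ball a₀ δ).prod (convex_Ioo 0 h)).isPreconnected.image _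
      (continuous_chartMap e hc.lipschitz.continuous).continuousOn
  · rintro _ ⟨q, ⟨hq1, hq2⟩, rfl⟩
    have hball : dist (chartMap e f q) p < ρ₁ := by
      have e0 : dist (chartMap e f q) p = dist (chartMap e f q) (chartMap e f (a₀, 0)) := by
        rw [hp']
      rw [e0]
      refine (dist_chartMap_le e hc.lipschitz _ _).trans_lt ?_
      have h1 : |q.1 - a₀| < δ := hq1
      have h2 : (1 + (K : ℝ)) * |q.1 - a₀| ≤ (1 + K) * δ := by gcongr
      simp only [sub_zero, abs_of_pos hq2.1]
      linarith [hq2.2]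
    refine ⟨(hc.mem_iff _ (Metric.mem_ball.2 (hball.trans_le (min_le_left _ _)))).2 ?_,
      Metric.mem_ball.2 (hball.trans_le (min_le_right _ _))⟩
    simp [hq2.1]
  · rintro y ⟨hy, hyU⟩
    have hyd := Metric.mem_ball.1 hy
    have c0 := (abs_chart_sub_le e y p 0).trans_lt hyd
    have c1 := (abs_chart_sub_le e y p 1).trans_lt hyd
    have hm := (hc.mem_iff y (Metric.mem_ball.2
      (hyd.trans_le (hδle.trans (min_le_left _ _))))).1 hyU
    have hl := hc.lipschitz.dist_le_mul (e y 0) (e p 0)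
    rw [Real.dist_eq, Real.dist_eq] at hl
    have hf0 := hc.eq_of_frontier p (Metric.mem_ball_self hρ) hp
    have h3 : (K : ℝ) * |e y 0 - e p 0| ≤ K * δ := by gcongr
    refine ⟨(e y 0, e y 1 - f (e y 0)), ⟨c0, by simpa using hm, ?_⟩, ?_⟩
    · have l1 := (abs_le.1 hl).1
      have l2 := (abs_lt.1 c1).2
      simp only
      nlinarith
    · apply chart_ext e <;> simp

lemma HasTraceAt.congr_set {U U' : Set E2} {u : E2 → ℝ} {x : E2} {c : ℝ}
    (h : HasTraceAt U u x c) {r : ℝ} (hr : 0 < r)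
    (hUU' : Metric.ball x r ∩ U = Metric.ball x r ∩ U') : HasTraceAt U' u x c := by
  refine Tendsto.congr' ?_ h
  filter_upwards [Ioo_mem_nhdsGT hr] with t ht
  have : Metric.ball x t ∩ U = Metric.ball x t ∩ U' := by
    rw [← inter_eq_left.2 (Metric.ball_subset_ball (x := x) ht.2.le), inter_assoc, hUU', inter_assoc]
  rw [this]

/-- The trace at `x` depends only on the domain near `x`, so a trace theorem on `U'` serves for `U`
wherever the two coincide locally. Enlarging the domain only increases the right-hand side. -/
lemma HasTraceBound.of_local {U U' S S' : Set E2} (h : HasTraceBound U' S') (hS : S ⊆ S')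
    (hSm : MeasurableSet S) (hU : MeasurableSet U) (hUU' : U' ⊆ U)
    (hloc : ∀ x ∈ S, ∃ r > 0, Metric.ball x r ∩ U' = Metric.ball x r ∩ U) :
    HasTraceBound U S := by
  obtain ⟨C, hC⟩ := h.mono hS
  refine ⟨C, fun u G hu => ?_⟩
  obtain ⟨h1, h2, h3⟩ := hC u G (hu.mono hUU' hU)
  have key : ∀ᵐ x ∂(μH[1] : Measure E2).restrict S, HasTraceAt U u x (traceFn U' u x) := by
    filter_upwards [h1, ae_restrict_mem hSm] with x hx hxS
    obtain ⟨r, hr, hrU⟩ := hloc x hxS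
    exact hx.congr_set hr hrU
  have heq : traceFn U u =ᵐ[(μH[1] : Measure E2).restrict S] traceFn U' u := by
    filter_upwards [key] with x hx using hx.traceFn_eq
  refine ⟨?_, h2.congr heq.symm, fun m => ?_⟩
  · filter_upwards [key, heq] with x hx hx'
    rwa [hx']
  · calc _ = ∫⁻ x in S, ‖traceFn U' u x - m‖ₑ ^ 2 ∂μH[1] := by
          refine lintegral_congr_ae ?_
          filter_upwards [heq] with x hx
          rw [hx]
      _ ≤ _ := h3 m
      _ ≤ _ := by gcongr

lemma HasTraceBound.congr_ae {U S S' : Set E2} (h : HasTraceBound U S)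
    (hS : S =ᵐ[(μH[1] : Measure E2)] S') : HasTraceBound U S' := by
  have := Measure.restrict_congr_set hS
  unfold HasTraceBound at h ⊢
  simpa only [this] using h

/-- **Poincaré inequality** for functions with zero trace on a non-negligible part of the
boundary. -/
lemma HasTraceBound.exists_poincare {U S : Set E2} (h : HasTraceBound U S)
    (hP : IsPoincareSet U U) (hU : volume U ≠ ⊤) (hS : 0 < (μH[1] : Measure E2) S) :
    ∃ C : NNReal, ∀ u G, IsSobolevPair U u G →
      (∀ᵐ x ∂(μH[1] : Measure E2).restrict S, HasTraceAt U u x 0) →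
      ∫⁻ x in U, ‖u x‖ₑ ^ 2 ≤ C * ∫⁻ x in U, ‖G x‖ₑ ^ 2 := by
  obtain ⟨C, hC⟩ := h
  obtain ⟨D, hD⟩ := hP
  -- `ℋ¹(S)` may be infinite; cutting it at 1 keeps it finite and positive, hence invertible.
  set κ := min ((μH[1] : Measure E2) S) 1 with hκ
  have hκ0 : κ ≠ 0 := (lt_min hS one_pos).ne'
  have hκt : κ ≠ ⊤ := ne_top_of_le_ne_top ENNReal.one_ne_top (min_le_right _ _)
  set v := volume U with hv
  have hL : 2 * D + 2 * (κ⁻¹ * (C * (D + 1)) * v) ≠ (⊤ : ENNReal) := by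
    have : κ⁻¹ ≠ ⊤ := ENNReal.inv_ne_top.2 hκ0
    finiteness
  refine ⟨(2 * D + 2 * (κ⁻¹ * (C * (D + 1)) * v)).toNNReal, fun u G hu htr => ?_⟩
  rw [ENNReal.coe_toNNReal hL]
  obtain ⟨m, hm⟩ := hD u G hu
  obtain ⟨-, -, h3⟩ := hC u G hu
  set I := ∫⁻ x in U, ‖G x‖ₑ ^ 2
  have h4 : ‖m‖ₑ ^ 2 * κ ≤ C * (D + 1) * I := by
    calc ‖m‖ₑ ^ 2 * κ ≤ ‖m‖ₑ ^ 2 * (μH[1] : Measure E2) S := by gcongr; exact min_le_left _ _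
      _ = ∫⁻ x in S, ‖m‖ₑ ^ 2 ∂μH[1] := by simp
      _ = ∫⁻ x in S, ‖traceFn U u x - m‖ₑ ^ 2 ∂μH[1] := by
        refine lintegral_congr_ae ?_
        filter_upwards [htr] with x hx
        rw [hx.traceFn_eq, zero_sub, enorm_neg]
      _ ≤ _ := h3 m
      _ ≤ C * (D * I + I) := by gcongr
      _ = _ := by ring
  have h5 : ‖m‖ₑ ^ 2 ≤ κ⁻¹ * (C * (D + 1)) * I := by
    calc ‖m‖ₑ ^ 2 = κ⁻¹ * (‖m‖ₑ ^ 2 * κ) := by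
          rw [mul_comm, mul_assoc, ENNReal.mul_inv_cancel hκ0 hκt, mul_one]
      _ ≤ κ⁻¹ * (C * (D + 1) * I) := by gcongr
      _ = _ := by ring
  have h6 := lintegral_enorm_sub_sq_le (X := U) u 0 m
  simp only [sub_zero] at h6
  calc _ ≤ _ := h6
    _ ≤ 2 * (D * I) + 2 * (κ⁻¹ * (C * (D + 1)) * I * v) := by gcongr
    _ = _ := by ring

/-! ### Poincaré inequality and traces on the cracked body. -/

namespace CrackModel

variable (M : CrackModel)

lemma γ_continuousOn : ContinuousOn M.γ (Icc 0 M.σmax) := M.γ_contDiff.continuousOn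

lemma isCompact_arc : IsCompact (M.γ '' Icc 0 M.σmax) :=
  isCompact_Icc.image_of_continuousOn M.γ_continuousOn

lemma Icc_σ₀_subset : Icc 0 M.σ₀ ⊆ Icc 0 M.σmax :=
  Icc_subset_Icc_right (M.σ₀_lt_σbar.trans M.σbar_lt_σmax).le

lemma isOpen_body : IsOpen M.body :=
  M.isOpen_Ω.sdiff (isCompact_Icc.image_of_continuousOn
    (M.γ_continuousOn.mono M.Icc_σ₀_subset)).isClosed

lemma body_subset : M.body ⊆ M.Ω := sdiff_subset

lemma isBounded_body : Bornology.IsBounded M.body := M.isBounded_Ω.subset M.body_subset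

lemma Ωpos_union_subset : M.Ωpos ∪ M.Ωneg ⊆ M.body := by
  rw [← M.cut]
  exact sdiff_subset_sdiff_right (image_mono M.Icc_σ₀_subset)

lemma Ωpos_subset_body : M.Ωpos ⊆ M.body := subset_union_left.trans M.Ωpos_union_subset

lemma Ωneg_subset_body : M.Ωneg ⊆ M.body := subset_union_right.trans M.Ωpos_union_subset

lemma frontier_inter_arc : frontier M.Ω ∩ M.γ '' Icc 0 M.σmax ⊆ {M.γ 0, M.γ M.σmax} := by
  rintro _ ⟨hx, s, hs, rfl⟩
  rw [M.isOpen_Ω.frontier_eq] at hx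
  rcases eq_or_lt_of_le hs.1 with h0 | h0
  · left; rw [← h0]
  rcases eq_or_lt_of_le hs.2 with h1 | h1
  · right; rw [h1]; rfl
  exact absurd (M.γ_mem s ⟨h0, h1⟩) hx.2

/-- The arc reaches the outer boundary only at its endpoints, and these are not Dirichlet points. -/
lemma dirichlet_subset_diff : M.dirichlet ⊆ frontier M.Ω \ M.γ '' Icc 0 M.σmax := by
  intro x hx
  refine ⟨M.dirichlet_subset hx, fun hxa => ?_⟩
  rcases M.frontier_inter_arc ⟨M.dirichlet_subset hx, hxa⟩ with h | h
  · exact M.γ_left.2 (h ▸ hx)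
  · exact M.γ_right.2 (h ▸ hx)

/-- The arc is the image of a segment of the horizontal axis, a null set of the plane, under `x ↦ γ
(x 0)`, which is differentiable on that segment. -/
lemma volume_arc : volume (M.γ '' Icc 0 M.σmax) = 0 := by
  set L : Submodule ℝ E2 := LinearMap.ker ((EuclideanSpace.proj (1 : Fin 2)).toLinearMap :
    E2 →ₗ[ℝ] ℝ) with hL
  have hLne : L ≠ ⊤ := by
    intro h
    have : EuclideanSpace.single (1 : Fin 2) (1 : ℝ) ∈ L := by rw [h]; trivial
    simp [hL] at this
  set s : Set E2 := {x | x 0 ∈ Icc 0 M.σmax} ∩ L with hs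
  have hs0 : volume s = 0 :=
    measure_mono_null inter_subset_right (Measure.addHaar_submodule volume L hLne)
  have hd : DifferentiableOn ℝ (fun x : E2 => M.γ (x 0)) s := by
    refine (M.γ_contDiff.differentiableOn (by norm_num)).comp ?_ fun x hx => hx.1
    exact Differentiable.differentiableOn (by fun_prop)
  have := addHaar_image_eq_zero_of_differentiableOn_of_addHaar_eq_zero volume hd hs0
  refine measure_mono_null ?_ this
  rintro _ ⟨t, ht, rfl⟩
  refine ⟨!₂[t, 0], ⟨by simpa using ht, by simp [hL]⟩, by simp⟩

/-- Near `x` the arc is absent, so a connected piece of `Ω` lies in the union of the two disjoint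
open parts, hence in one of them. -/
lemma exists_side {x : E2} (hx : x ∈ frontier M.Ω \ M.γ '' Icc 0 M.σmax) :
    ∃ r > 0, Metric.ball x r ∩ M.Ω ⊆ M.Ωpos ∨ Metric.ball x r ∩ M.Ω ⊆ M.Ωneg := by
  obtain ⟨e, f, K, ρ, hc⟩ := M.lipschitz_Ω.exists_isChart M.isOpen_Ω hx.1
  obtain ⟨ρ', hρ', hρa⟩ := Metric.isOpen_iff.1 M.isCompact_arc.isClosed.isOpen_compl x hx.2
  obtain ⟨R, hR, hRs, r, hr, hrR⟩ := hc.exists_preconnected hx.1 hρ'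
  have hRU : R ⊆ M.Ωpos ∪ M.Ωneg := by
    rw [← M.cut]
    exact fun y hy => ⟨(hRs hy).1, hρa (hRs hy).2⟩
  refine ⟨r, hr, ?_⟩
  rcases hR.subset_or_subset M.isOpen_pos M.isOpen_neg M.disjoint_parts hRU with h | h
  · exact Or.inl (hrR.trans h)
  · exact Or.inr (hrR.trans h)

lemma ball_inter_eq {x : E2} {r : ℝ} {P : Set E2} (hP : P ⊆ M.body)
    (h : Metric.ball x r ∩ M.Ω ⊆ P) : Metric.ball x r ∩ P = Metric.ball x r ∩ M.body :=
  Subset.antisymm (inter_subset_inter_right _ hP)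
    fun _ hy => ⟨hy.1, h ⟨hy.1, M.body_subset hy.2⟩⟩

/-- The points of the outer boundary around which `Ω` coincides with `P`. -/
def side (P : Set E2) : Set E2 :=
  (frontier M.Ω \ M.γ '' Icc 0 M.σmax) ∩ {x | ∃ r > 0, Metric.ball x r ∩ M.Ω ⊆ P}

lemma measurableSet_side (P : Set E2) : MeasurableSet (M.side P) := by
  refine (isClosed_frontier.measurableSet.diff M.isCompact_arc.isClosed.measurableSet).inter ?_
  refine IsOpen.measurableSet (Metric.isOpen_iff.2 ?_)
  rintro x ⟨r, hr, h⟩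
  refine ⟨r / 2, by positivity, fun y hy => ⟨r / 2, by positivity, ?_⟩⟩
  refine (inter_subset_inter_left _ (Metric.ball_subset_ball' ?_)).trans h
  linarith [Metric.mem_ball.1 hy]

lemma side_subset_frontier {P : Set E2} (hP : P ⊆ M.body) (hPo : IsOpen P) :
    M.side P ⊆ frontier P := by
  rintro x ⟨⟨hx, -⟩, r, hr, h⟩
  rw [hPo.frontier_eq]
  rw [M.isOpen_Ω.frontier_eq] at hx
  refine ⟨?_, fun hxP => hx.2 (M.body_subset (hP hxP))⟩
  have := Metric.isOpen_ball.inter_closure (s := Metric.ball x r) (t := M.Ω)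
    ⟨Metric.mem_ball_self hr, hx.1⟩
  exact closure_mono h this

/-- The body need not be Lipschitz at the crack, but near the points of `side P` it coincides with
the Lipschitz domain `P`. -/
lemma hasTraceBound_side {P : Set E2} (hP : P ⊆ M.body) (hPo : IsOpen P)
    (hPl : HasLipschitzBoundary P) : HasTraceBound M.body (M.side P) := by
  refine (hasTraceBound_frontier hPo (M.isBounded_body.subset hP) hPl).of_local
    (M.side_subset_frontier hP hPo) (M.measurableSet_side P) M.isOpen_body.measurableSet hP ?_
  rintro x ⟨-, r, hr, h⟩
  exact ⟨r, hr, M.ball_inter_eq hP h⟩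

/-- At most two points are removed, and `ℋ¹` does not charge points. -/
lemma diff_arc_ae_eq : (frontier M.Ω \ M.γ '' Icc 0 M.σmax : Set E2)
    =ᵐ[(μH[1] : Measure E2)] frontier M.Ω := by
  have := Measure.nullSingletonClass_hausdorff E2 one_pos
  have h : (μH[1] : Measure E2) (frontier M.Ω ∩ M.γ '' Icc 0 M.σmax) = 0 :=
    measure_mono_null M.frontier_inter_arc ((Set.toFinite _).measure_zero _)
  rw [← sdiff_inter_self_eq_sdiff, inter_comm]
  exact sdiff_null_ae_eq_self h

/-- The trace theorem for the cracked body, on the boundary of the reference configuration. -/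
lemma hasTraceBound_body : HasTraceBound M.body (frontier M.Ω) := by
  have h := (M.hasTraceBound_side M.Ωpos_subset_body M.isOpen_pos M.lipschitz_pos).union
    (M.hasTraceBound_side M.Ωneg_subset_body M.isOpen_neg M.lipschitz_neg)
  refine (h.mono (S := frontier M.Ω \ M.γ '' Icc 0 M.σmax) fun x hx => ?_).congr_ae
    M.diff_arc_ae_eq
  obtain ⟨r, hr, h | h⟩ := M.exists_side hx
  · exact Or.inl ⟨hx, r, hr, h⟩
  · exact Or.inr ⟨hx, r, hr, h⟩

/-- The Poincaré inequality on `P` requires zero trace as seen from `P`, whereas the hypothesis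
concerns the trace as seen from the body. Near a Dirichlet point of `frontier P` the two domains
coincide: the alternative, that `Ω` lies locally in `Q`, is excluded by disjointness. -/
lemma exists_poincare_part {P Q : Set E2} (hP : P ⊆ M.body) (hPo : IsOpen P)
    (hPc : IsConnected P) (hPl : HasLipschitzBoundary P) (hPQ : Disjoint P Q)
    (hside : ∀ x ∈ frontier M.Ω \ M.γ '' Icc 0 M.σmax,
      ∃ r > 0, Metric.ball x r ∩ M.Ω ⊆ P ∨ Metric.ball x r ∩ M.Ω ⊆ Q)
    (hD : 0 < (μH[1] : Measure E2) (M.dirichlet ∩ frontier P)) :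
    ∃ C : NNReal, ∀ u G, IsSobolevPair M.body u G →
      (∀ᵐ x ∂(μH[1] : Measure E2).restrict M.dirichlet, HasTraceAt M.body u x 0) →
      ∫⁻ x in P, ‖u x‖ₑ ^ 2 ≤ C * ∫⁻ x in M.body, ‖G x‖ₑ ^ 2 := by
  have hb := M.isBounded_body.subset hP
  have ht := (hasTraceBound_frontier hPo hb hPl).mono
    (inter_subset_right : M.dirichlet ∩ frontier P ⊆ frontier P)
  obtain ⟨C, hC⟩ := ht.exists_poincare (isPoincareSet_self hPo hPc hb hPl)
    (volume_ne_top_of_isBounded hb) hD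
  refine ⟨C, fun u G hu htr => ?_⟩
  refine (hC u G (hu.mono hP M.isOpen_body.measurableSet) ?_).trans (by gcongr)
  have hm : MeasurableSet (M.dirichlet ∩ frontier P) :=
    M.isClosed_dirichlet.measurableSet.inter isClosed_frontier.measurableSet
  filter_upwards [ae_mono (Measure.restrict_mono_set _ inter_subset_left) htr,
    ae_restrict_mem hm] with x hx hxD
  obtain ⟨r, hr, h | h⟩ := hside x (M.dirichlet_subset_diff hxD.1)
  · exact hx.congr_set hr (M.ball_inter_eq hP h).symm
  · obtain ⟨y, hyB, hyP⟩ := mem_closure_iff.1 (frontier_subset_closure hxD.2) _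
      Metric.isOpen_ball (Metric.mem_ball_self hr)
    exact (hPQ.le_bot ⟨hyP, h ⟨hyB, M.body_subset (hP hyP)⟩⟩).elim

/-- **Poincaré inequality** on the cracked body. -/
lemma exists_poincare : ∃ C : NNReal, ∀ u G, IsSobolevPair M.body u G →
      (∀ᵐ x ∂(μH[1] : Measure E2).restrict M.dirichlet, HasTraceAt M.body u x 0) →
      ∫⁻ x in M.body, ‖u x‖ₑ ^ 2 ≤ C * ∫⁻ x in M.body, ‖G x‖ₑ ^ 2 := by
  obtain ⟨C, hC⟩ := M.exists_poincare_part M.Ωpos_subset_body M.isOpen_pos M.isConnected_pos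
    M.lipschitz_pos M.disjoint_parts (fun x hx => M.exists_side hx) M.dirichlet_pos_pos
  obtain ⟨D, hD⟩ := M.exists_poincare_part M.Ωneg_subset_body M.isOpen_neg M.isConnected_neg
    M.lipschitz_neg M.disjoint_parts.symm (fun x hx => by
      obtain ⟨r, hr, h⟩ := M.exists_side hx; exact ⟨r, hr, h.symm⟩) M.dirichlet_neg_pos
  refine ⟨C + D, fun u G hu htr => ?_⟩
  have hsub : M.body ⊆ (M.Ωpos ∪ M.Ωneg) ∪ M.γ '' Icc 0 M.σmax := by
    rw [← M.cut]
    intro x hx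
    by_cases h : x ∈ M.γ '' Icc 0 M.σmax
    · exact Or.inr h
    · exact Or.inl ⟨M.body_subset hx, h⟩
  calc ∫⁻ x in M.body, ‖u x‖ₑ ^ 2
      ≤ ∫⁻ x in (M.Ωpos ∪ M.Ωneg) ∪ M.γ '' Icc 0 M.σmax, ‖u x‖ₑ ^ 2 := lintegral_mono_set hsub
    _ ≤ ((∫⁻ x in M.Ωpos, ‖u x‖ₑ ^ 2) + ∫⁻ x in M.Ωneg, ‖u x‖ₑ ^ 2)
        + ∫⁻ x in M.γ '' Icc 0 M.σmax, ‖u x‖ₑ ^ 2 :=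
      (lintegral_union_le _ _ _).trans (by gcongr; exact lintegral_union_le _ _ _)
    _ ≤ _ := by
      rw [setLIntegral_measure_zero _ _ M.volume_arc, add_zero, ENNReal.coe_add, add_mul]
      exact add_le_add (hC u G hu htr) (hD u G hu htr)

end CrackModel

/-! ### The trace operator and the Hilbert space `V`. -/

lemma lintegral_enorm_sq_Lp {X E : Type*} [MeasurableSpace X] {μ : Measure X}
    [NormedAddCommGroup E] (f : Lp E 2 μ) : ∫⁻ x, ‖f x‖ₑ ^ 2 ∂μ = ‖f‖ₑ ^ 2 := by
  rw [Lp.enorm_def, eLpNorm_eq_lintegral_rpow_enorm_toReal (by norm_num) (by norm_num)]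
  rw [← ENNReal.rpow_natCast, ← ENNReal.rpow_mul]
  simp

lemma enorm_sq_le_iff {E F : Type*} [SeminormedAddCommGroup E] [SeminormedAddCommGroup F] (C : NNReal)
    (x : E) (y : F) : ‖x‖ₑ ^ 2 ≤ C * ‖y‖ₑ ^ 2 ↔ ‖x‖ ^ 2 ≤ C * ‖y‖ ^ 2 := by
  rw [← coe_nnnorm, ← coe_nnnorm, enorm_eq_nnnorm, enorm_eq_nnnorm]
  norm_cast

lemma norm_sq_H1 {U : Set E2} (u : H1 U) : ‖u‖ ^ 2 = ‖h1Fn u‖ ^ 2 + ‖h1Grad u‖ ^ 2 :=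
  WithLp.prod_norm_sq_eq_of_L2 u.1

lemma isSobolevPair_H1 {U : Set E2} (u : H1 U) : IsSobolevPair U (h1Fn u) (h1Grad u) :=
  ⟨u.2, Lp.memLp _, Lp.memLp _⟩

lemma HasTraceAt.add {U : Set E2} {a b : L2 U} {x : E2} {α β : ℝ} (ha : HasTraceAt U a x α)
    (hb : HasTraceAt U b x β) : HasTraceAt U ↑(a + b) x (α + β) := by
  have h0 : HasTraceAt U (fun y => a y + b y) x (α + β) := by
    refine (Tendsto.add ha hb).congr fun r => ?_
    rw [setAverage_eq, setAverage_eq, setAverage_eq, integral_add, smul_add]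
    · exact integrable_ball_inter a x r
    · exact integrable_ball_inter b x r
  exact h0.congr (Lp.coeFn_add a b).symm

lemma HasTraceAt.smul {U : Set E2} {a : L2 U} {x : E2} {α : ℝ} (ha : HasTraceAt U a x α) (c : ℝ) :
    HasTraceAt U ↑(c • a) x (c * α) := by
  have h0 : HasTraceAt U (fun y => c * a y) x (c * α) := by
    refine (Tendsto.const_mul c ha).congr fun r => ?_
    rw [setAverage_eq, setAverage_eq, integral_const_mul, smul_eq_mul, smul_eq_mul]; ring
  refine h0.congr ?_
  filter_upwards [Lp.coeFn_smul c a] with y hy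
  exact hy.symm

/-- The trace as a bounded operator on `H¹(U)`. -/
lemma HasTraceBound.exists_clm {U S : Set E2} (h : HasTraceBound U S) :
    ∃ Tr : H1 U →L[ℝ] Lp ℝ 2 ((μH[1] : Measure E2).restrict S),
      ∀ u : H1 U, Tr u =ᵐ[(μH[1] : Measure E2).restrict S] traceFn U (h1Fn u) := by
  obtain ⟨C, hC⟩ := h
  have bound : ∀ u : H1 U, ∫⁻ x in S, ‖traceFn U (h1Fn u) x‖ₑ ^ 2 ∂μH[1] ≤ C * ‖u‖ₑ ^ 2 := by
    intro u
    have h3 := (hC _ _ (isSobolevPair_H1 u)).2.2 0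
    simp only [sub_zero] at h3
    refine h3.trans (le_of_eq ?_)
    rw [lintegral_enorm_sq_Lp, lintegral_enorm_sq_Lp]
    congr 1
    have := norm_sq_H1 u
    simp only [← coe_nnnorm] at this
    simp only [enorm_eq_nnnorm]
    norm_cast at this ⊢
    exact this.symm
  have mem : ∀ u : H1 U, MemLp (traceFn U (h1Fn u)) 2 ((μH[1] : Measure E2).restrict S) := by
    intro u
    refine ⟨(hC _ _ (isSobolevPair_H1 u)).2.1.aestronglyMeasurable, ?_⟩
    rw [eLpNorm_lt_top_iff_lintegral_rpow_enorm_lt_top (by norm_num) (by norm_num)]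
    simp only [ENNReal.toReal_ofNat, ENNReal.rpow_ofNat]
    exact (bound u).trans_lt (by finiteness)
  have tr := fun u : H1 U => (hC _ _ (isSobolevPair_H1 u)).1
  let L : H1 U →ₗ[ℝ] Lp ℝ 2 ((μH[1] : Measure E2).restrict S) :=
    { toFun := fun u => (mem u).toLp
      map_add' := by
        intro u w
        rw [← MemLp.toLp_add]
        refine (MemLp.toLp_eq_toLp_iff _ _).2 ?_
        filter_upwards [tr u, tr w] with x hu hw
        exact (hu.add hw).traceFn_eq
      map_smul' := by
        intro c u
        rw [RingHom.id_apply, ← MemLp.toLp_const_smul]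
        refine (MemLp.toLp_eq_toLp_iff _ _).2 ?_
        filter_upwards [tr u] with x hu
        exact (hu.smul c).traceFn_eq }
  have hL : ∀ u, L u =ᵐ[(μH[1] : Measure E2).restrict S] traceFn U (h1Fn u) := fun u =>
    (mem u).coeFn_toLp
  refine ⟨L.mkContinuous (Real.sqrt C) fun u => ?_, hL⟩
  have h1 : ‖L u‖ₑ ^ 2 ≤ C * ‖u‖ₑ ^ 2 := by
    rw [← lintegral_enorm_sq_Lp]
    refine le_trans (le_of_eq (lintegral_congr_ae ?_)) (bound u)
    filter_upwards [hL u] with x hx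
    rw [hx]
  rw [enorm_sq_le_iff] at h1
  have := Real.le_sqrt_of_sq_le h1
  rwa [Real.sqrt_mul C.coe_nonneg, Real.sqrt_sq (norm_nonneg _)] at this

lemma HasTraceBound.mem_H1Zero_iff {U D : Set E2} (h : HasTraceBound U D) (u : H1 U) :
    u ∈ H1Zero U D ↔ traceFn U (h1Fn u) =ᵐ[(μH[1] : Measure E2).restrict D] 0 := by
  obtain ⟨C, hC⟩ := h
  have tr := (hC _ _ (isSobolevPair_H1 u)).1
  constructor
  · intro hu
    filter_upwards [hu] with x hx using hx.traceFn_eq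
  · intro hu
    change ∀ᵐ x ∂(μH[1] : Measure E2).restrict D, HasTraceAt U (h1Fn u) x 0
    filter_upwards [hu, tr] with x hx hx'
    rw [hx] at hx'
    exact hx'

/-- The pointwise condition of zero limits of averages is recognized as the kernel of the continuous
trace operator. -/
lemma HasTraceBound.isClosed_H1Zero {U D : Set E2} (h : HasTraceBound U D) :
    IsClosed (H1Zero U D : Set (H1 U)) := by
  obtain ⟨Tr, hTr⟩ := h.exists_clm
  have : (H1Zero U D : Set (H1 U)) = {u | Tr u = 0} := by
    ext u
    rw [SetLike.mem_coe, h.mem_H1Zero_iff, mem_ofPred_eq, Lp.eq_zero_iff_ae_eq_zero]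
    exact ⟨fun h => (hTr u).trans h, fun h => (hTr u).symm.trans h⟩
  rw [this]
  exact isClosed_eq Tr.continuous continuous_const

namespace DirichletSpace

variable {U D : Set E2}

lemma norm_eq_norm_grad (v : DirichletSpace U D) : ‖v‖ = ‖grad v‖ := rfl

/-- A Poincaré inequality holds in the space of functions of `H¹(U)` vanishing on `D`. -/
def HasPoincare (U D : Set E2) : Prop :=
  ∃ C : NNReal, ∀ v : DirichletSpace U D, ‖v.toH1‖ ≤ C * ‖v‖

/-- By the Poincaré inequality a Cauchy sequence for the gradient norm is Cauchy in `H¹(U)`, which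
is complete; closedness keeps the boundary condition in the limit. -/
lemma completeSpace (hP : HasPoincare U D) (hc : IsClosed (H1Zero U D : Set (H1 U))) :
    CompleteSpace (DirichletSpace U D) := by
  obtain ⟨C, hC⟩ := hP
  refine Metric.complete_of_cauchySeq_tendsto fun v hv => ?_
  have hcau : CauchySeq fun n => (v n).toH1 := by
    rw [Metric.cauchySeq_iff] at hv ⊢
    intro ε hε
    obtain ⟨N, hN⟩ := hv (ε / (C + 1)) (by positivity)
    refine ⟨N, fun m hm n hn => ?_⟩
    have h1 := hN m hm n hn
    rw [dist_eq_norm] at h1 ⊢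
    have h2 : ‖(v m).toH1 - (v n).toH1‖ ≤ C * ‖v m - v n‖ := hC (v m - v n)
    rw [lt_div_iff₀ (by positivity)] at h1
    nlinarith [norm_nonneg (v m - v n)]
  obtain ⟨u, hu⟩ := cauchySeq_tendsto_of_complete hcau
  have hmem : u ∈ H1Zero U D := hc.mem_of_tendsto hu (Eventually.of_forall fun n => (v n).2)
  let w : DirichletSpace U D := (⟨u, hmem⟩ : H1Zero U D)
  refine ⟨w, ?_⟩
  rw [tendsto_iff_norm_sub_tendsto_zero] at hu ⊢
  refine squeeze_zero (fun _ => norm_nonneg _) (fun n => ?_) hu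
  have h1 := norm_sq_H1 (v n - w).toH1
  have h2 : ‖(v n - w).toH1‖ = ‖(v n).toH1 - u‖ := rfl
  have h3 : ‖v n - w‖ = ‖h1Grad (v n - w).toH1‖ := rfl
  rw [h3, ← h2]
  refine abs_le_of_sq_le_sq' ?_ (norm_nonneg _) |>.2
  rw [h1]
  nlinarith [sq_nonneg ‖h1Fn (v n - w).toH1‖]

lemma eq_zero_of_norm (hP : HasPoincare U D) (v : DirichletSpace U D) (hv : ‖v‖ = 0) : v = 0 := by
  obtain ⟨C, hC⟩ := hP
  have := hC v
  rw [hv, mul_zero] at this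
  exact Subtype.ext (norm_le_zero_iff.1 this)

end DirichletSpace

namespace CrackModel

variable (M : CrackModel)

lemma hasPoincare : DirichletSpace.HasPoincare M.body M.dirichlet := by
  obtain ⟨C, hC⟩ := M.exists_poincare
  refine ⟨NNReal.sqrt (C + 1), fun v => ?_⟩
  have h1 := hC _ _ (isSobolevPair_H1 v.toH1) v.2
  rw [lintegral_enorm_sq_Lp, lintegral_enorm_sq_Lp, enorm_sq_le_iff] at h1
  have h2 := norm_sq_H1 v.toH1
  have h3 : ‖v‖ = ‖h1Grad v.toH1‖ := rfl
  rw [← h3] at h1 h2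
  have h4 : ‖v.toH1‖ ^ 2 ≤ (C + 1) * ‖v‖ ^ 2 := by rw [h2]; linarith
  have := Real.le_sqrt_of_sq_le h4
  rw [Real.sqrt_mul (by positivity), Real.sqrt_sq (norm_nonneg _)] at this
  simpa using this

lemma isClosed_H1Zero : IsClosed (H1Zero M.body M.dirichlet : Set (H1 M.body)) :=
  (M.hasTraceBound_body.mono M.dirichlet_subset).isClosed_H1Zero

lemma completeSpace_V : CompleteSpace M.V :=
  DirichletSpace.completeSpace M.hasPoincare M.isClosed_H1Zero

/-- The trace operator on the Neumann part of the boundary, for elements of `V`. -/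
lemma exists_trace_V : ∃ Tr : M.V →L[ℝ] Lp ℝ 2 ((μH[1] : Measure E2).restrict M.neumann),
    ∀ v : M.V, Tr v =ᵐ[(μH[1] : Measure E2).restrict M.neumann] traceFn M.body v.fn := by
  obtain ⟨Tr, hTr⟩ := (M.hasTraceBound_body.mono
    (sdiff_subset : M.neumann ⊆ frontier M.Ω)).exists_clm
  obtain ⟨C, hC⟩ := M.hasPoincare
  let J : M.V →ₗ[ℝ] H1 M.body :=
    { toFun := fun v => v.toH1
      map_add' := fun _ _ => rfl
      map_smul' := fun _ _ => rfl }
  let J' : M.V →L[ℝ] H1 M.body := J.mkContinuous C hC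
  exact ⟨Tr.comp J', fun v => hTr v.toH1⟩

lemma exists_trace_Ω : ∃ Tr : H1 M.Ω →L[ℝ] Lp ℝ 2 ((μH[1] : Measure E2).restrict M.neumann),
    ∀ u : H1 M.Ω, Tr u =ᵐ[(μH[1] : Measure E2).restrict M.neumann] traceFn M.Ω (h1Fn u) :=
  ((hasTraceBound_frontier M.isOpen_Ω M.isBounded_Ω M.lipschitz_Ω).mono
    (sdiff_subset : M.neumann ⊆ frontier M.Ω)).exists_clm

/-- The gradient of a function on `Ω`, as a vector field on the cracked body. -/
lemma exists_restrict_grad : ∃ R : H1 M.Ω →L[ℝ] L2Vec M.body,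
    ∀ u : H1 M.Ω, R u =ᵐ[volume.restrict M.body] h1Grad u := by
  have hle : volume.restrict M.body ≤ volume.restrict M.Ω :=
    Measure.restrict_mono_set _ M.body_subset
  have mem : ∀ u : H1 M.Ω, MemLp (h1Grad u) 2 (volume.restrict M.body) := fun u =>
    (Lp.memLp (h1Grad u)).mono_measure hle
  let L : H1 M.Ω →ₗ[ℝ] L2Vec M.body :=
    { toFun := fun u => (mem u).toLp
      map_add' := by
        intro u w
        rw [← MemLp.toLp_add]
        refine (MemLp.toLp_eq_toLp_iff _ _).2 ?_
        exact ae_mono hle (Lp.coeFn_add (h1Grad u) (h1Grad w))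
      map_smul' := by
        intro c u
        rw [RingHom.id_apply, ← MemLp.toLp_const_smul]
        refine (MemLp.toLp_eq_toLp_iff _ _).2 ?_
        exact ae_mono hle (Lp.coeFn_smul c (h1Grad u)) }
  have hL : ∀ u, L u =ᵐ[volume.restrict M.body] h1Grad u := fun u => (mem u).coeFn_toLp
  refine ⟨L.mkContinuous 1 fun u => ?_, hL⟩
  have h1 : ‖L u‖ₑ ^ 2 ≤ (1 : NNReal) * ‖h1Grad u‖ₑ ^ 2 := by
    rw [← lintegral_enorm_sq_Lp, ← lintegral_enorm_sq_Lp, ENNReal.coe_one, one_mul]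
    refine le_trans (le_of_eq (lintegral_congr_ae ?_)) (lintegral_mono' hle le_rfl)
    filter_upwards [hL u] with x hx
    rw [hx]
  rw [enorm_sq_le_iff] at h1
  have h2 := norm_sq_H1 u
  rw [one_mul]
  refine abs_le_of_sq_le_sq' ?_ (norm_nonneg _) |>.2
  rw [NNReal.coe_one, one_mul] at h1
  nlinarith [sq_nonneg ‖h1Fn u‖]

end CrackModel

/-! ### Multiplication operators -/

/-- Extension by zero of a field of operators. -/
def extendZero {U : Set E2} (b : BoundedContinuousFunction U (E2 →L[ℝ] E2)) (y : E2) :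
    E2 →L[ℝ] E2 := by
  classical exact if h : y ∈ U then b ⟨y, h⟩ else 0

lemma extendZero_of_mem {U : Set E2} (b : BoundedContinuousFunction U (E2 →L[ℝ] E2)) {y : E2}
    (h : y ∈ U) : extendZero b y = b ⟨y, h⟩ := by simp [extendZero, h]

lemma norm_extendZero_le {U : Set E2} (b : BoundedContinuousFunction U (E2 →L[ℝ] E2)) (y : E2) :
    ‖extendZero b y‖ ≤ ‖b‖ := by
  by_cases h : y ∈ U
  · rw [extendZero_of_mem b h]; exact b.norm_coe_le_norm _
  · have : extendZero b y = 0 := by simp [extendZero, h]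
    rw [this, norm_zero]
    exact norm_nonneg b

lemma aestronglyMeasurable_extendZero {U : Set E2} (hU : IsOpen U)
    (b : BoundedContinuousFunction U (E2 →L[ℝ] E2)) :
    AEStronglyMeasurable (extendZero b) (volume.restrict U) := by
  refine ContinuousOn.aestronglyMeasurable ?_ hU.measurableSet
  rw [continuousOn_iff_continuous_domRestrict]
  exact b.continuous.congr fun y => (extendZero_of_mem b y.2).symm

lemma memLp_extendZero_apply {U U' : Set E2} (hU : IsOpen U) (hs : U' ⊆ U)
    (b : BoundedContinuousFunction U (E2 →L[ℝ] E2)) (ξ : L2Vec U') :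
    MemLp (fun y => extendZero b y (ξ y)) 2 (volume.restrict U') := by
  refine MemLp.of_le_mul (c := ‖b‖) (Lp.memLp ξ) ?_ (Eventually.of_forall fun y => ?_)
  · have h1 := (aestronglyMeasurable_extendZero hU b).mono_measure (Measure.restrict_mono_set volume hs)
    have h2 : Continuous fun p : (E2 →L[ℝ] E2) × E2 => p.1 p.2 :=
      continuous_fst.clm_apply continuous_snd
    exact h2.comp_aestronglyMeasurable (AEStronglyMeasurable.prodMk h1 (Lp.aestronglyMeasurable ξ))
  · exact (ContinuousLinearMap.le_opNorm _ _).trans (by gcongr; exact norm_extendZero_le b y)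

/-- Pointwise application of a bounded continuous field of operators. -/
def mulFun {U U' : Set E2} (hU : IsOpen U) (hs : U' ⊆ U)
    (b : BoundedContinuousFunction U (E2 →L[ℝ] E2)) (ξ : L2Vec U') : L2Vec U' :=
  (memLp_extendZero_apply hU hs b ξ).toLp

lemma coeFn_mulFun {U U' : Set E2} (hU : IsOpen U) (hs : U' ⊆ U)
    (b : BoundedContinuousFunction U (E2 →L[ℝ] E2)) (ξ : L2Vec U') :
    mulFun hU hs b ξ =ᵐ[volume.restrict U'] fun y => extendZero b y (ξ y) :=
  (memLp_extendZero_apply hU hs b ξ).coeFn_toLp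

lemma norm_mulFun_le {U U' : Set E2} (hU : IsOpen U) (hs : U' ⊆ U)
    (b : BoundedContinuousFunction U (E2 →L[ℝ] E2)) (ξ : L2Vec U') :
    ‖mulFun hU hs b ξ‖ ≤ ‖b‖ * ‖ξ‖ := by
  refine Lp.norm_le_mul_norm_of_ae_le_mul ?_
  filter_upwards [coeFn_mulFun hU hs b ξ] with y hy
  rw [hy]
  exact (ContinuousLinearMap.le_opNorm _ _).trans (by gcongr; exact norm_extendZero_le b y)

/-- The operator of multiplication by a bounded continuous field of operators. -/
def mulClm {U U' : Set E2} (hU : IsOpen U) (hs : U' ⊆ U)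
    (b : BoundedContinuousFunction U (E2 →L[ℝ] E2)) : L2Vec U' →L[ℝ] L2Vec U' :=
  LinearMap.mkContinuous
    { toFun := mulFun hU hs b
      map_add' := by
        intro ξ η
        refine Lp.ext ?_
        filter_upwards [coeFn_mulFun hU hs b ξ, coeFn_mulFun hU hs b η, coeFn_mulFun hU hs b (ξ + η),
          Lp.coeFn_add ξ η, Lp.coeFn_add (mulFun hU hs b ξ) (mulFun hU hs b η)] with y h1 h2 h3 h4 h5
        rw [h3, h4, h5, Pi.add_apply, Pi.add_apply, h1, h2, map_add]
      map_smul' := by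
        intro c ξ
        refine Lp.ext ?_
        filter_upwards [coeFn_mulFun hU hs b ξ, coeFn_mulFun hU hs b (c • ξ),
          Lp.coeFn_smul c ξ, Lp.coeFn_smul c (mulFun hU hs b ξ)] with y h1 h2 h3 h4
        rw [RingHom.id_apply, h2, h3, h4, Pi.smul_apply, Pi.smul_apply, h1, map_smul] }
    ‖b‖ (norm_mulFun_le hU hs b)

lemma coeFn_mulClm {U U' : Set E2} (hU : IsOpen U) (hs : U' ⊆ U)
    (b : BoundedContinuousFunction U (E2 →L[ℝ] E2)) (ξ : L2Vec U') :
    mulClm hU hs b ξ =ᵐ[volume.restrict U'] fun y => extendZero b y (ξ y) :=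
  coeFn_mulFun hU hs b ξ

/-- Multiplication operators depend linearly and continuously on the coefficients. -/
def mulOp {U U' : Set E2} (hU : IsOpen U) (hs : U' ⊆ U) :
    BoundedContinuousFunction U (E2 →L[ℝ] E2) →L[ℝ] L2Vec U' →L[ℝ] L2Vec U' :=
  LinearMap.mkContinuous
    { toFun := mulClm hU hs
      map_add' := by
        intro b b'
        refine ContinuousLinearMap.ext fun ξ => Lp.ext ?_
        filter_upwards [coeFn_mulClm hU hs b ξ, coeFn_mulClm hU hs b' ξ,
          coeFn_mulClm hU hs (b + b') ξ,
          Lp.coeFn_add (mulClm hU hs b ξ) (mulClm hU hs b' ξ)] with y h1 h2 h3 h4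
        refine Eq.trans ?_ h4.symm
        rw [h3, Pi.add_apply, h1, h2]
        by_cases h : y ∈ U <;> simp [extendZero, h]
      map_smul' := by
        intro c b
        refine ContinuousLinearMap.ext fun ξ => Lp.ext ?_
        filter_upwards [coeFn_mulClm hU hs b ξ, coeFn_mulClm hU hs (c • b) ξ,
          Lp.coeFn_smul c (mulClm hU hs b ξ)] with y h1 h3 h4
        refine Eq.trans ?_ h4.symm
        rw [h3, Pi.smul_apply, h1]
        by_cases h : y ∈ U <;> simp [extendZero, h] }
    1 fun b => by
      rw [one_mul]
      exact LinearMap.mkContinuous_norm_le _ (norm_nonneg b) (norm_mulFun_le hU hs b)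

lemma coeFn_mulOp {U U' : Set E2} (hU : IsOpen U) (hs : U' ⊆ U)
    (b : BoundedContinuousFunction U (E2 →L[ℝ] E2)) (ξ : L2Vec U') :
    mulOp hU hs b ξ =ᵐ[volume.restrict U'] fun y => extendZero b y (ξ y) :=
  coeFn_mulFun hU hs b ξ

lemma contDiffOn_mulOp_comp {U U' : Set E2} (hU : IsOpen U) (hs : U' ⊆ U)
    {a : ℝ → BoundedContinuousFunction U (E2 →L[ℝ] E2)} {s : Set ℝ} {n : WithTop ℕ∞}
    (ha : ContDiffOn ℝ n a s) : ContDiffOn ℝ n (fun σ => mulOp hU hs (a σ)) s := by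
  exact ContDiffOn.continuousLinearMap_comp (mulOp hU hs) ha

/-! ### Ellipticity -/

lemma pullbackCoeff_inner_comm (P : E2 → E2) (y ξ η : E2) :
    inner ℝ (pullbackCoeff P y ξ) η = inner ℝ ξ (pullbackCoeff P y η) := by
  simp only [pullbackCoeff, smul_apply, ContinuousLinearMap.comp_apply,
    inner_smul_left, inner_smul_right]
  set Q := (fderiv ℝ P y).inverse
  rw [← ContinuousLinearMap.adjoint_inner_right Q, ← ContinuousLinearMap.adjoint_inner_left Q]
  rfl

/-- In the plane, a matrix of the form `d Q Qᵀ` with `d = (det Q)⁻¹` is elliptic as soon as it is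
bounded. -/
lemma ellipticity_of_norm_le {Q : E2 →L[ℝ] E2} {d m : ℝ} (hQ : 0 < Q.det) (hd : d * Q.det = 1)
    (hm : ‖d • (Q ∘L ContinuousLinearMap.adjoint Q)‖ ≤ m) (ξ : E2) :
    ‖ξ‖ ^ 2 ≤ 2 * m * inner ℝ ((d • (Q ∘L ContinuousLinearMap.adjoint Q)) ξ) ξ := by
  set A := d • (Q ∘L ContinuousLinearMap.adjoint Q) with hA
  have hd0 : 0 < d := by
    by_contra h
    push Not at h
    nlinarith [mul_nonneg_of_nonpos_of_nonpos h (neg_nonpos.2 hQ.le)]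
  have hAξ : ∀ x, inner ℝ (A x) x = d * ‖ContinuousLinearMap.adjoint Q x‖ ^ 2 := by
    intro x
    rw [hA, smul_apply, inner_smul_left, ContinuousLinearMap.comp_apply,
      ← ContinuousLinearMap.adjoint_inner_right, real_inner_self_eq_norm_sq]
    rfl
  set e : Fin 2 → E2 := fun i => EuclideanSpace.single i 1 with he
  have hen : ∀ i, ‖e i‖ = 1 := fun i => by simp [he]
  have hAe : ∀ i, d * ‖ContinuousLinearMap.adjoint Q (e i)‖ ^ 2 ≤ m := by
    intro i
    rw [← hAξ]
    refine (real_inner_le_norm _ _).trans ?_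
    rw [hen, mul_one]
    exact (A.le_opNorm _).trans (by rw [hen, mul_one]; exact hm)
  have hadj : ∀ x j, ContinuousLinearMap.adjoint Q x j = x 0 * Q (e j) 0 + x 1 * Q (e j) 1 := by
    intro x j
    have h1 : ContinuousLinearMap.adjoint Q x j
        = inner ℝ (e j) (ContinuousLinearMap.adjoint Q x) := by
      simp [he, EuclideanSpace.inner_single_left]
    rw [h1, ContinuousLinearMap.adjoint_inner_right, PiLp.inner_apply, Fin.sum_univ_two]
    simp
  have hdet : Q.det = Q (e 0) 0 * Q (e 1) 1 - Q (e 1) 0 * Q (e 0) 1 := by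
    have : Q.det = LinearMap.det (Q : E2 →ₗ[ℝ] E2) := rfl
    rw [this, ← LinearMap.det_toMatrix (EuclideanSpace.basisFun (Fin 2) ℝ).toBasis,
      Matrix.det_fin_two]
    simp [LinearMap.toMatrix_apply, he]
  have hns : ∀ x : E2, ‖x‖ ^ 2 = x 0 ^ 2 + x 1 ^ 2 := by
    intro x
    rw [EuclideanSpace.norm_sq_eq, Fin.sum_univ_two]; simp
  have h0 := hAe 0
  have h1 := hAe 1
  rw [hAξ]
  rw [hns, hadj, hadj] at h0 h1
  rw [hns, hns, hadj, hadj]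
  simp only [he, PiLp.single_apply] at h0 h1 hdet ⊢
  norm_num at h0 h1 hdet ⊢
  set a := Q (EuclideanSpace.single 0 1) 0
  set b := Q (EuclideanSpace.single 1 1) 0
  set c := Q (EuclideanSpace.single 0 1) 1
  set f := Q (EuclideanSpace.single 1 1) 1
  set x := ξ 0
  set y := ξ 1
  set w₀ := x * a + y * c with hw₀
  set w₁ := x * b + y * f with hw₁
  -- With `w = Qᵀ ξ`, the vector `det Q • ξ` is a cofactor matrix of `Q` applied to `w`. In
  -- dimension two the cofactors are the entries of `Q` up to sign, so the Frobenius norm is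
  -- unchanged.
  have hx : Q.det * x = w₀ * f - w₁ * c := by rw [hdet]; ring
  have hy : Q.det * y = w₁ * a - w₀ * b := by rw [hdet]; ring
  have h2 : Q.det ^ 2 * (x ^ 2 + y ^ 2) ≤ (a ^ 2 + b ^ 2 + c ^ 2 + f ^ 2) * (w₀ ^ 2 + w₁ ^ 2) := by
    have : Q.det ^ 2 * (x ^ 2 + y ^ 2) = (w₀ * f - w₁ * c) ^ 2 + (w₁ * a - w₀ * b) ^ 2 := by
      rw [← hx, ← hy]; ring
    rw [this]
    nlinarith [sq_nonneg (w₀ * c + w₁ * f), sq_nonneg (w₀ * a + w₁ * b)]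
  -- The left side is the trace of `A`, a sum of two diagonal entries, each at most `m`.
  have h3 : d * (a ^ 2 + b ^ 2 + c ^ 2 + f ^ 2) ≤ 2 * m := by linarith
  have hD2 : d ^ 2 * Q.det ^ 2 = 1 := by rw [← mul_pow, hd, one_pow]
  calc x ^ 2 + y ^ 2 = d ^ 2 * (Q.det ^ 2 * (x ^ 2 + y ^ 2)) := by
        rw [← mul_assoc, hD2, one_mul]
    _ ≤ d ^ 2 * ((a ^ 2 + b ^ 2 + c ^ 2 + f ^ 2) * (w₀ ^ 2 + w₁ ^ 2)) := by gcongr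
    _ = (d * (a ^ 2 + b ^ 2 + c ^ 2 + f ^ 2)) * (d * (w₀ ^ 2 + w₁ ^ 2)) := by ring
    _ ≤ 2 * m * (d * (w₀ ^ 2 + w₁ ^ 2)) := by gcongr

lemma ContDiffOn.exists_norm_le {E : Type*} [NormedAddCommGroup E] [NormedSpace ℝ E] {a : ℝ → E}
    {s : Set ℝ} {n : WithTop ℕ∞} (ha : ContDiffOn ℝ n a s) (hs : IsCompact s) :
    ∃ m, ∀ σ ∈ s, ‖a σ‖ ≤ m :=
  hs.exists_bound_of_continuousOn ha.continuousOn

namespace CrackModel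

variable (M : CrackModel)

/-- Differentiating `Φ ∘ Ψ = id` and `Ψ ∘ Φ = id` identifies the inverse of `DΨ(y)` with `Q =
DΦ(Ψ(y))`. The coefficient thus has the form `d Q Qᵀ` with `d det Q = 1`, where `det Q > 0` by the
lower bound on the Jacobians, and the planar ellipticity estimate applies. -/
lemma coeff_elliptic {σ : ℝ} (hσ : σ ∈ Icc M.σ₀ M.σbar) {y : E2} (hy : y ∈ M.Ω) {m : ℝ}
    (hm : ‖M.A σ y‖ ≤ m) (ξ : E2) : ‖ξ‖ ^ 2 ≤ 2 * m * inner ℝ (M.A σ y ξ) ξ := by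
  obtain ⟨c, C, hc, hdet⟩ := M.Φ_det
  have hx := M.Ψ_mapsTo σ hσ hy
  set x := M.Ψ σ y with hxdef
  have dΨ : HasFDerivAt (M.Ψ σ) (fderiv ℝ (M.Ψ σ) y) y :=
    (((M.Ψ_contDiff σ hσ).differentiableOn (by norm_num)).differentiableAt
      (M.isOpen_Ω.mem_nhds hy)).hasFDerivAt
  have dΦ : HasFDerivAt (M.Φ σ) (fderiv ℝ (M.Φ σ) x) x :=
    (((M.Φ_contDiff σ hσ).differentiableOn (by norm_num)).differentiableAt
      (M.isOpen_Ω.mem_nhds hx)).hasFDerivAt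
  set P := fderiv ℝ (M.Ψ σ) y with hP
  set Q := fderiv ℝ (M.Φ σ) x with hQ
  have hΦx : M.Φ σ x = y := (M.inverse σ hσ).2 hy
  have e1 : Q ∘L P = ContinuousLinearMap.id ℝ E2 := by
    have h1 := dΦ.comp y dΨ
    have h2 : HasFDerivAt (M.Φ σ ∘ M.Ψ σ) (ContinuousLinearMap.id ℝ E2) y := by
      refine (hasFDerivAt_id y).congr_of_eventuallyEq ?_
      filter_upwards [M.isOpen_Ω.mem_nhds hy] with z hz using (M.inverse σ hσ).2 hz
    exact h1.unique h2
  have e2 : P ∘L Q = ContinuousLinearMap.id ℝ E2 := by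
    have dΨ' : HasFDerivAt (M.Ψ σ) P (M.Φ σ x) := by rw [hΦx]; exact dΨ
    have h1 := dΨ'.comp x dΦ
    have h2 : HasFDerivAt (M.Ψ σ ∘ M.Φ σ) (ContinuousLinearMap.id ℝ E2) x := by
      refine (hasFDerivAt_id x).congr_of_eventuallyEq ?_
      filter_upwards [M.isOpen_Ω.mem_nhds hx] with z hz using (M.inverse σ hσ).1 hz
    exact h1.unique h2
  have hinv : P.inverse = Q := ContinuousLinearMap.inverse_eq e2 e1
  have hdQ : 0 < Q.det := hc.trans_le (hdet σ hσ x hx).1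
  have hdd : P.det * Q.det = 1 := by
    have h1 : (P : E2 →ₗ[ℝ] E2) ∘ₗ (Q : E2 →ₗ[ℝ] E2) = LinearMap.id :=
      LinearMap.ext fun z => DFunLike.congr_fun e2 z
    have h2 := congrArg LinearMap.det h1
    rw [LinearMap.det_comp, LinearMap.det_id] at h2
    exact h2
  have hA : M.A σ y = P.det • (Q ∘L ContinuousLinearMap.adjoint Q) := by
    rw [A, pullbackCoeff, ← hP, hinv]
  rw [hA] at hm ⊢
  exact ellipticity_of_norm_le hdQ hdd hm ξ

/-- The coefficients as a family of symmetric elliptic operators in `L²`. -/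
lemma exists_coeffOp : ∃ 𝒜 : ℝ → L2Vec M.body →L[ℝ] L2Vec M.body,
    ContDiffOn ℝ 2 𝒜 (Icc M.σ₀ M.σbar) ∧
    (∀ σ ∈ Icc M.σ₀ M.σbar, ∀ ξ, 𝒜 σ ξ =ᵐ[volume.restrict M.body] fun y => M.A σ y (ξ y)) ∧
    (∀ σ ∈ Icc M.σ₀ M.σbar, ∀ ξ η, inner ℝ (𝒜 σ ξ) η = inner ℝ ξ (𝒜 σ η)) ∧
    ∃ c > 0, ∀ σ ∈ Icc M.σ₀ M.σbar, ∀ ξ, c * ‖ξ‖ ^ 2 ≤ inner ℝ (𝒜 σ ξ) ξ := by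
  obtain ⟨a, ha, haA⟩ := M.coeff_contDiff
  set B := mulOp M.isOpen_Ω M.body_subset
  have hB := coeFn_mulOp M.isOpen_Ω M.body_subset
  obtain ⟨m, hm⟩ := ha.exists_norm_le isCompact_Icc
  have hBA : ∀ σ ∈ Icc M.σ₀ M.σbar, ∀ ξ,
      B (a σ) ξ =ᵐ[volume.restrict M.body] fun y => M.A σ y (ξ y) := by
    intro σ hσ ξ
    filter_upwards [hB (a σ) ξ, ae_restrict_mem M.isOpen_body.measurableSet] with y hy hyb
    rw [hy, extendZero_of_mem _ (M.body_subset hyb), haA σ hσ ⟨y, M.body_subset hyb⟩]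
    rfl
  -- The maximum with 1 makes the ellipticity constant `(2 m')⁻¹` positive.
  set m' := max m 1 with hm'
  have hm'0 : 0 < m' := lt_max_of_lt_right one_pos
  refine ⟨fun σ => B (a σ), contDiffOn_mulOp_comp _ _ ha, hBA, ?_, (2 * m')⁻¹, by positivity, ?_⟩
  · intro σ hσ ξ η
    rw [L2.inner_def, L2.inner_def]
    refine integral_congr_ae ?_
    filter_upwards [hBA σ hσ ξ, hBA σ hσ η] with y h1 h2
    rw [h1, h2]
    exact pullbackCoeff_inner_comm _ _ _ _
  · intro σ hσ ξ
    rw [← real_inner_self_eq_norm_sq, L2.inner_def, L2.inner_def, ← integral_const_mul]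
    refine integral_mono_ae ((L2.integrable_inner ξ ξ).const_mul _)
      (L2.integrable_inner (B (a σ) ξ) ξ) ?_
    filter_upwards [hBA σ hσ ξ, ae_restrict_mem M.isOpen_body.measurableSet] with y h1 hyb
    rw [h1, real_inner_self_eq_norm_sq]
    have hyΩ := M.body_subset hyb
    have hn : ‖M.A σ y‖ ≤ m' := by
      have : M.A σ y = a σ ⟨y, hyΩ⟩ := (haA σ hσ ⟨y, hyΩ⟩).symm
      rw [this]
      exact ((a σ).norm_coe_le_norm _).trans ((hm σ hσ).trans (le_max_left _ _))
    rw [inv_mul_le_iff₀ (by positivity)]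
    exact M.coeff_elliptic hσ hyΩ hn (ξ y)

/-- The energy in operator form. -/
lemma F_eq {𝒜 : ℝ → L2Vec M.body →L[ℝ] L2Vec M.body}
    (h𝒜 : ∀ σ ∈ Icc M.σ₀ M.σbar, ∀ ξ, 𝒜 σ ξ =ᵐ[volume.restrict M.body] fun y => M.A σ y (ξ y))
    {Tr : M.V →L[ℝ] Lp ℝ 2 ((μH[1] : Measure E2).restrict M.neumann)}
    (hTr : ∀ v : M.V, Tr v =ᵐ[(μH[1] : Measure E2).restrict M.neumann] traceFn M.body v.fn)
    {Tr' : H1 M.Ω →L[ℝ] Lp ℝ 2 ((μH[1] : Measure E2).restrict M.neumann)}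
    (hTr' : ∀ u : H1 M.Ω, Tr' u =ᵐ[(μH[1] : Measure E2).restrict M.neumann] traceFn M.Ω (h1Fn u))
    {R : H1 M.Ω →L[ℝ] L2Vec M.body}
    (hR : ∀ u : H1 M.Ω, R u =ᵐ[volume.restrict M.body] h1Grad u)
    {G : ℝ → Lp ℝ 2 ((μH[1] : Measure E2).restrict M.neumann)} (hG : G = M.g)
    (t : ℝ) (v : M.V) {σ : ℝ} (hσ : σ ∈ Icc M.σ₀ M.σbar) :
    M.F t v σ = inner ℝ (𝒜 σ (DirichletSpace.grad v + R (M.ψ t)))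
        (DirichletSpace.grad v + R (M.ψ t)) + σ - inner ℝ (G t) (Tr v + Tr' (M.ψ t)) := by
  have h1 : ∫ y in M.body, inner ℝ (M.A σ y (DirichletSpace.grad v y + h1Grad (M.ψ t) y))
      (DirichletSpace.grad v y + h1Grad (M.ψ t) y)
      = inner ℝ (𝒜 σ (DirichletSpace.grad v + R (M.ψ t))) (DirichletSpace.grad v + R (M.ψ t)) := by
    rw [L2.inner_def]
    refine integral_congr_ae ?_
    filter_upwards [h𝒜 σ hσ (DirichletSpace.grad v + R (M.ψ t)),
      Lp.coeFn_add (DirichletSpace.grad v) (R (M.ψ t)), hR (M.ψ t)] with y h1 h2 h3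
    rw [h1, h2, Pi.add_apply, h3]
  have h2 : ∫ x in M.neumann, G t x * (traceFn M.body v.fn x + traceFn M.Ω (h1Fn (M.ψ t)) x) ∂μH[1]
      = inner ℝ (G t) (Tr v + Tr' (M.ψ t)) := by
    rw [L2.inner_def]
    refine integral_congr_ae ?_
    filter_upwards [Lp.coeFn_add (Tr v) (Tr' (M.ψ t)), hTr v, hTr' (M.ψ t)] with x h1 h2 h3
    rw [h1, Pi.add_apply, h2, h3]
    simp [mul_comm]
  rw [← h1, ← h2, hG]
  rfl

end CrackModel

/-! ### Gradient flows of an energy depending on time, a state and a scalar -/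

/-- An energy `E(t, v, σ)` on `[0,T] × V × [a,b]`, with its derivatives `G = grad_v E`,
`S = ∂_σ E`, `P = ∂_t E`. It is Lipschitz with Lipschitz first derivatives in `(v, σ)` on bounded
sets, and uniformly convex in `v`. -/
structure EnergySystem (V : Type*) [NormedAddCommGroup V] [InnerProductSpace ℝ V] where
  T : ℝ
  a : ℝ
  b : ℝ
  E : ℝ → V → ℝ → ℝ
  G : ℝ → V → ℝ → V
  S : ℝ → V → ℝ → ℝ
  P : ℝ → V → ℝ → ℝ
  c : ℝ
  T_pos : 0 < T
  a_lt_b : a < b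
  c_pos : 0 < c
  E_lip : ∀ R, ∃ C, ∀ t ∈ Icc 0 T, ∀ t' ∈ Icc 0 T, ∀ v, ‖v‖ ≤ R → ∀ v', ‖v'‖ ≤ R →
    ∀ σ ∈ Icc a b, ∀ σ' ∈ Icc a b,
      |E t v σ - E t' v' σ'| ≤ C * (|t - t'| + ‖v - v'‖ + |σ - σ'|)
  G_lip : ∀ R, ∃ C, ∀ t ∈ Icc 0 T, ∀ t' ∈ Icc 0 T, ∀ v, ‖v‖ ≤ R → ∀ v', ‖v'‖ ≤ R →
    ∀ σ ∈ Icc a b, ∀ σ' ∈ Icc a b,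
      ‖G t v σ - G t' v' σ'‖ ≤ C * (|t - t'| + ‖v - v'‖ + |σ - σ'|)
  S_lip : ∀ R, ∃ C, ∀ t ∈ Icc 0 T, ∀ t' ∈ Icc 0 T, ∀ v, ‖v‖ ≤ R → ∀ v', ‖v'‖ ≤ R →
    ∀ σ ∈ Icc a b, ∀ σ' ∈ Icc a b,
      |S t v σ - S t' v' σ'| ≤ C * (|t - t'| + ‖v - v'‖ + |σ - σ'|)
  P_bound : ∀ R, ∃ C, ∀ᵐ t ∂volume.restrict (Icc 0 T), ∀ v, ‖v‖ ≤ R → ∀ σ ∈ Icc a b,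
    |P t v σ| ≤ C
  P_cont : ∀ᵐ t ∂volume.restrict (Icc 0 T),
    ContinuousOn (fun x : V × ℝ => P t x.1 x.2) (univ ×ˢ Icc a b)
  P_meas : ∀ (v : ℝ → V) (s : ℝ → ℝ), (∀ t ∈ Icc 0 T, s t ∈ Icc a b) →
    AEStronglyMeasurable v (volume.restrict (Icc 0 T)) →
    AEStronglyMeasurable s (volume.restrict (Icc 0 T)) →
    AEStronglyMeasurable (fun t => P t (v t) (s t)) (volume.restrict (Icc 0 T))
  monotone : ∀ t ∈ Icc 0 T, ∀ σ ∈ Icc a b, ∀ v v',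
    c * ‖v - v'‖ ^ 2 ≤ inner ℝ (G t v σ - G t v' σ) (v - v')
  chain : ∀ᵐ t ∂volume.restrict (Icc 0 T), ∀ (v : ℝ → V) (s : ℝ → ℝ) (v' : V) (s' : ℝ),
    (∀ τ ∈ Icc 0 T, s τ ∈ Icc a b) →
    HasDerivWithinAt v v' (Icc 0 T) t → HasDerivWithinAt s s' (Icc 0 T) t →
    HasDerivWithinAt (fun τ => E τ (v τ) (s τ))
      (P t (v t) (s t) + inner ℝ (G t (v t) (s t)) v' + S t (v t) (s t) * s') (Icc 0 T) t
  exists_zero : ∀ t ∈ Icc 0 T, ∀ σ ∈ Icc a b, ∃ v, G t v σ = 0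

/-- The radial retraction onto the ball of radius `R`. -/
def radialRetract {V : Type*} [NormedAddCommGroup V] [InnerProductSpace ℝ V] (R : ℝ) (v : V) : V :=
  (R / max R ‖v‖) • v

section Retract

variable {V : Type*} [NormedAddCommGroup V] [InnerProductSpace ℝ V] {R : ℝ}

lemma radialRetract_of_norm_le (hR : 0 < R) {v : V} (hv : ‖v‖ ≤ R) : radialRetract R v = v := by
  rw [radialRetract, max_eq_left hv, div_self hR.ne', one_smul]

lemma norm_radialRetract_le (hR : 0 < R) (v : V) : ‖radialRetract R v‖ ≤ R := by
  have hM : 0 < max R ‖v‖ := lt_max_of_lt_left hR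
  rw [radialRetract, norm_smul, Real.norm_of_nonneg (by positivity), div_mul_eq_mul_div,
    div_le_iff₀ hM]
  gcongr
  exact le_max_right _ _

/-- The crude constant 2 comes from varying the vector and the scaling factor separately; any
uniform Lipschitz constant would do. -/
lemma norm_radialRetract_sub_le (hR : 0 < R) (v w : V) :
    ‖radialRetract R v - radialRetract R w‖ ≤ 2 * ‖v - w‖ := by
  have hM : 0 < max R ‖v‖ := lt_max_of_lt_left hR
  have hN : 0 < max R ‖w‖ := lt_max_of_lt_left hR
  have e : radialRetract R v - radialRetract R w
      = (R / max R ‖v‖) • (v - w) + (R / max R ‖v‖ - R / max R ‖w‖) • w := by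
    rw [radialRetract, radialRetract, smul_sub, sub_smul]; abel
  have h1 : R / max R ‖v‖ ≤ 1 := (div_le_one hM).2 (le_max_left _ _)
  have h2 : ‖w‖ / max R ‖w‖ ≤ 1 := (div_le_one hN).2 (le_max_right _ _)
  have h3 : |max R ‖w‖ - max R ‖v‖| ≤ ‖v - w‖ := by
    have h := abs_max_sub_max_le_max R ‖w‖ R ‖v‖
    rw [sub_self, abs_zero, max_eq_right (abs_nonneg (‖w‖ - ‖v‖))] at h
    refine h.trans ?_
    rw [norm_sub_rev]; exact abs_norm_sub_norm_le w v
  have h4 : ‖(R / max R ‖v‖ - R / max R ‖w‖) • w‖ ≤ ‖v - w‖ := by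
    have e2 : (R / max R ‖v‖ - R / max R ‖w‖) * ‖w‖
        = (R / max R ‖v‖) * (‖w‖ / max R ‖w‖) * (max R ‖w‖ - max R ‖v‖) := by
      field_simp
    rw [norm_smul, Real.norm_eq_abs, ← abs_of_nonneg (norm_nonneg w), ← abs_mul,
      abs_of_nonneg (norm_nonneg w), e2, abs_mul, abs_of_nonneg (by positivity)]
    have : R / max R ‖v‖ * (‖w‖ / max R ‖w‖) ≤ 1 := mul_le_one₀ h1 (by positivity) h2
    calc _ ≤ 1 * ‖v - w‖ := by gcongr
      _ = _ := one_mul _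
  have h5 : ‖(R / max R ‖v‖) • (v - w)‖ ≤ ‖v - w‖ := by
    rw [norm_smul, Real.norm_of_nonneg (by positivity)]
    exact mul_le_of_le_one_left (norm_nonneg _) h1
  rw [e]
  linarith [norm_add_le ((R / max R ‖v‖) • (v - w)) ((R / max R ‖v‖ - R / max R ‖w‖) • w)]

end Retract

/-- Global solvability on `[0,T]` for a bounded, uniformly Lipschitz vector field. -/
lemma exists_solution_of_bounded_lipschitz {Y : Type*} [NormedAddCommGroup Y] [NormedSpace ℝ Y]
    [CompleteSpace Y] {T : ℝ} (hT : 0 ≤ T) (X : ℝ → Y → Y) (L K : NNReal)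
    (hL : ∀ t x, ‖X t x‖ ≤ L) (hK : ∀ t, LipschitzWith K (X t)) (hc : ∀ x, Continuous fun t => X t x)
    (x₀ : Y) : ∃ x : ℝ → Y, x 0 = x₀ ∧
      ∀ t ∈ Icc 0 T, HasDerivWithinAt x (X t (x t)) (Icc 0 T) t := by
  have h : IsPicardLindelof X (⟨0, left_mem_Icc.2 hT⟩ : Icc 0 T) x₀ (L * T.toNNReal) 0 L K := by
    constructor
    · exact fun t _ => (hK t).lipschitzOnWith
    · exact fun x _ => (hc x).continuousOn
    · exact fun t _ x _ => hL t x
    · simp [hT]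
  exact h.exists_eq_forall_mem_Icc_hasDerivWithinAt₀

/-- `(v, s)` solves `ε v' = -grad_v E`, `ε s' = (-∂_σ E)⁺ λ(s)` on `[0,T]`. -/
structure EnergySystem.IsFlow {V : Type*} [NormedAddCommGroup V] [InnerProductSpace ℝ V]
    (M : EnergySystem V) (lam : ℝ → ℝ) (u₀ : V) (ε : ℝ) (v : ℝ → V) (s : ℝ → ℝ) : Prop where
  mem : ∀ t ∈ Icc 0 M.T, s t ∈ Icc M.a M.b
  monotone : MonotoneOn s (Icc 0 M.T)
  deriv_v : ∀ t ∈ Icc 0 M.T,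
    HasDerivWithinAt v (-(ε⁻¹ • M.G t (v t) (s t))) (Icc 0 M.T) t
  deriv_s : ∀ t ∈ Icc 0 M.T,
    HasDerivWithinAt s (ε⁻¹ * (max (-M.S t (v t) (s t)) 0 * lam (s t))) (Icc 0 M.T) t
  init_v : v 0 = u₀
  init_s : s 0 = M.a

namespace EnergySystem

variable {V : Type*} [NormedAddCommGroup V] [InnerProductSpace ℝ V] (M : EnergySystem V)

lemma G_bound (R : ℝ) : ∃ C, 0 ≤ C ∧ ∀ t ∈ Icc 0 M.T, ∀ v, ‖v‖ ≤ R → ∀ σ ∈ Icc M.a M.b,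
    ‖M.G t v σ‖ ≤ C := by
  obtain ⟨C, hC⟩ := M.G_lip (max R 0)
  have h0 : (0 : ℝ) ∈ Icc 0 M.T := left_mem_Icc.2 M.T_pos.le
  have ha : M.a ∈ Icc M.a M.b := left_mem_Icc.2 M.a_lt_b.le
  refine ⟨‖M.G 0 0 M.a‖ + |C| * (M.T + max R 0 + (M.b - M.a)), ?_, fun t ht v hv σ hσ => ?_⟩
  · have := M.T_pos; have := M.a_lt_b
    have : 0 ≤ M.b - M.a := by linarith
    positivity
  have h := hC t ht 0 h0 v (hv.trans (le_max_left _ _)) 0 (by simp) σ hσ M.a ha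
  have h1 : |t - 0| ≤ M.T := by rw [sub_zero, abs_of_nonneg ht.1]; exact ht.2
  have h2 : ‖v - 0‖ ≤ max R 0 := by rw [sub_zero]; exact hv.trans (le_max_left _ _)
  have h3 : |σ - M.a| ≤ M.b - M.a := by
    rw [abs_of_nonneg (by linarith [hσ.1])]; linarith [hσ.2]
  calc ‖M.G t v σ‖ ≤ ‖M.G 0 0 M.a‖ + ‖M.G t v σ - M.G 0 0 M.a‖ := norm_le_norm_add_norm_sub' _ _
    _ ≤ _ := by
      gcongr
      refine h.trans ?_
      calc _ ≤ |C| * (|t - 0| + ‖v - 0‖ + |σ - M.a|) := by gcongr; exact le_abs_self C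
        _ ≤ _ := by gcongr

lemma S_bound (R : ℝ) : ∃ C, 0 ≤ C ∧ ∀ t ∈ Icc 0 M.T, ∀ v, ‖v‖ ≤ R → ∀ σ ∈ Icc M.a M.b,
    |M.S t v σ| ≤ C := by
  obtain ⟨C, hC⟩ := M.S_lip (max R 0)
  have h0 : (0 : ℝ) ∈ Icc 0 M.T := left_mem_Icc.2 M.T_pos.le
  have ha : M.a ∈ Icc M.a M.b := left_mem_Icc.2 M.a_lt_b.le
  refine ⟨|M.S 0 0 M.a| + |C| * (M.T + max R 0 + (M.b - M.a)), ?_, fun t ht v hv σ hσ => ?_⟩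
  · have := M.T_pos; have := M.a_lt_b
    have : 0 ≤ M.b - M.a := by linarith
    positivity
  have h := hC t ht 0 h0 v (hv.trans (le_max_left _ _)) 0 (by simp) σ hσ M.a ha
  have h1 : |t - 0| ≤ M.T := by rw [sub_zero, abs_of_nonneg ht.1]; exact ht.2
  have h2 : ‖v - 0‖ ≤ max R 0 := by rw [sub_zero]; exact hv.trans (le_max_left _ _)
  have h3 : |σ - M.a| ≤ M.b - M.a := by
    rw [abs_of_nonneg (by linarith [hσ.1])]; linarith [hσ.2]
  calc |M.S t v σ| ≤ |M.S 0 0 M.a| + |M.S t v σ - M.S 0 0 M.a| :=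
        norm_le_norm_add_norm_sub' (M.S t v σ) (M.S 0 0 M.a)
    _ ≤ _ := by
      gcongr
      refine h.trans ?_
      calc _ ≤ |C| * (|t - 0| + ‖v - 0‖ + |σ - M.a|) := by gcongr; exact le_abs_self C
        _ ≤ _ := by gcongr

/-- Coercivity: on large spheres the gradient points outwards. -/
lemma exists_radius (r : ℝ) : ∃ R, 0 < R ∧ r ≤ R ∧ ∀ t ∈ Icc 0 M.T, ∀ σ ∈ Icc M.a M.b, ∀ v,
    ‖v‖ = R → 0 < inner ℝ v (M.G t v σ) := by
  obtain ⟨C, hC0, hC⟩ := M.G_bound 0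
  refine ⟨max r (C / M.c + 1), ?_, le_max_left _ _, fun t ht σ hσ v hv => ?_⟩
  · have := M.c_pos
    exact lt_max_of_lt_right (by positivity)
  have hc := M.c_pos
  have h1 := M.monotone t ht σ hσ v 0
  rw [sub_zero, inner_sub_left] at h1
  have h2 : -(C * ‖v‖) ≤ inner ℝ (M.G t 0 σ) v := by
    have h3 := abs_real_inner_le_norm (M.G t 0 σ) v
    have h4 : ‖M.G t 0 σ‖ * ‖v‖ ≤ C * ‖v‖ := by gcongr; exact hC t ht 0 (by simp) σ hσ
    linarith [neg_abs_le (inner ℝ (M.G t 0 σ) v)]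
  have h5 : C < M.c * ‖v‖ := by
    have : C / M.c + 1 ≤ ‖v‖ := hv ▸ le_max_right _ _
    have h6 : C / M.c < ‖v‖ := by linarith
    rwa [div_lt_iff₀' hc] at h6
  have h6 : 0 < ‖v‖ := by nlinarith
  rw [real_inner_comm]
  nlinarith

/-- The truncated vector field of the flow on `V × ℝ`. -/
def field (lam : ℝ → ℝ) (R ε : ℝ) (t : ℝ) (x : V × ℝ) : V × ℝ :=
  (-(ε⁻¹ • M.G (projIcc 0 M.T M.T_pos.le t) (radialRetract R x.1)
      (projIcc M.a M.b M.a_lt_b.le x.2)),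
    ε⁻¹ * (max (-M.S (projIcc 0 M.T M.T_pos.le t) (radialRetract R x.1)
      (projIcc M.a M.b M.a_lt_b.le x.2)) 0 * lam (projIcc M.a M.b M.a_lt_b.le x.2)))

variable {M} {lam : ℝ → ℝ} {K : NNReal}

/-- Clamping `t` and `σ` to their intervals and `v` to a ball confines the arguments to a set where
`G`, `S` and `lam` are bounded and Lipschitz; the second component is a product of such functions.
These global bounds let Picard–Lindelöf reach time `T` in one step. -/
lemma field_bounds (hlam : LipschitzOnWith K lam (Icc M.a M.b)) {R ε : ℝ} (hR : 0 < R) (hε : 0 < ε) :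
    ∃ C : NNReal, (∀ t x, ‖M.field lam R ε t x‖ ≤ C) ∧
      ∀ t t' x x', ‖M.field lam R ε t x - M.field lam R ε t' x'‖ ≤ C * (|t - t'| + ‖x - x'‖) := by
  obtain ⟨B₁, hB₁, hG⟩ := M.G_bound R
  obtain ⟨B₂, hB₂, hS⟩ := M.S_bound R
  obtain ⟨C₁, hG'⟩ := M.G_lip R
  obtain ⟨C₂, hS'⟩ := M.S_lip R
  obtain ⟨B₃, hB₃⟩ : ∃ B, ∀ σ ∈ Icc M.a M.b, |lam σ| ≤ B := by
    obtain ⟨B, hB⟩ := isCompact_Icc.exists_bound_of_continuousOn hlam.continuousOn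
    exact ⟨B, fun σ hσ => hB σ hσ⟩
  have hB₃0 : 0 ≤ B₃ := (abs_nonneg _).trans (hB₃ M.a (left_mem_Icc.2 M.a_lt_b.le))
  set pt : ℝ → ℝ := fun t => projIcc 0 M.T M.T_pos.le t with hpt
  set ps : ℝ → ℝ := fun t => projIcc M.a M.b M.a_lt_b.le t with hps
  have mt : ∀ t, pt t ∈ Icc 0 M.T := fun t => (projIcc 0 M.T M.T_pos.le t).2
  have ms : ∀ t, ps t ∈ Icc M.a M.b := fun t => (projIcc M.a M.b M.a_lt_b.le t).2
  have lt : ∀ t t', |pt t - pt t'| ≤ |t - t'| := fun t t' => abs_projIcc_sub_projIcc _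
  have ls : ∀ t t', |ps t - ps t'| ≤ |t - t'| := fun t t' => abs_projIcc_sub_projIcc _
  -- The factor 3 adds the Lipschitz constant 2 of the retraction to the constant 1 of the clamp in
  -- `σ`.
  have key : ∀ t t' (x x' : V × ℝ), |pt t - pt t'| + ‖radialRetract R x.1 - radialRetract R x'.1‖
      + |ps x.2 - ps x'.2| ≤ 3 * (|t - t'| + ‖x - x'‖) := by
    intro t t' x x'
    have h1 := norm_radialRetract_sub_le hR x.1 x'.1
    have h2 := norm_fst_le (x - x')
    have h3 := norm_snd_le (x - x')
    rw [Prod.fst_sub] at h2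
    rw [Prod.snd_sub, Real.norm_eq_abs] at h3
    linarith [lt t t', ls x.2 x'.2, abs_nonneg (t - t')]
  have dG : ∀ t t' (x x' : V × ℝ), ‖M.G (pt t) (radialRetract R x.1) (ps x.2)
      - M.G (pt t') (radialRetract R x'.1) (ps x'.2)‖ ≤ |C₁| * 3 * (|t - t'| + ‖x - x'‖) := by
    intro t t' x x'
    refine (hG' _ (mt t) _ (mt t') _ (norm_radialRetract_le hR _) _ (norm_radialRetract_le hR _)
      _ (ms _) _ (ms _)).trans ?_
    rw [mul_assoc]
    exact mul_le_mul (le_abs_self _) (key t t' x x') (by positivity) (abs_nonneg _)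
  have dS : ∀ t t' (x x' : V × ℝ), |M.S (pt t) (radialRetract R x.1) (ps x.2)
      - M.S (pt t') (radialRetract R x'.1) (ps x'.2)| ≤ |C₂| * 3 * (|t - t'| + ‖x - x'‖) := by
    intro t t' x x'
    refine (hS' _ (mt t) _ (mt t') _ (norm_radialRetract_le hR _) _ (norm_radialRetract_le hR _)
      _ (ms _) _ (ms _)).trans ?_
    rw [mul_assoc]
    exact mul_le_mul (le_abs_self _) (key t t' x x') (by positivity) (abs_nonneg _)
  have bS : ∀ t (x : V × ℝ), |max (-M.S (pt t) (radialRetract R x.1) (ps x.2)) 0| ≤ B₂ := by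
    intro t x
    rw [abs_of_nonneg (le_max_right _ _)]
    refine max_le ?_ hB₂
    exact (neg_le_abs _).trans (hS _ (mt t) _ (norm_radialRetract_le hR _) _ (ms _))
  have dl : ∀ x x' : V × ℝ, |lam (ps x.2) - lam (ps x'.2)| ≤ K * ‖x - x'‖ := by
    intro x x'
    have h := hlam.dist_le_mul _ (ms x.2) _ (ms x'.2)
    rw [Real.dist_eq, Real.dist_eq] at h
    have h3 := norm_snd_le (x - x')
    rw [Prod.snd_sub, Real.norm_eq_abs] at h3
    exact h.trans (by gcongr; exact (ls _ _).trans h3)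
  have hε' : 0 < ε⁻¹ := inv_pos.2 hε
  refine ⟨⟨ε⁻¹ * (B₁ + B₂ * B₃ + |C₁| * 3 + (|C₂| * 3 * B₃ + B₂ * K)), by positivity⟩, ?_, ?_⟩
  · intro t x
    rw [Prod.norm_def]
    refine max_le ?_ ?_
    · change ‖-(ε⁻¹ • M.G (pt t) (radialRetract R x.1) (ps x.2))‖ ≤ ε⁻¹ * _
      rw [norm_neg, norm_smul, Real.norm_of_nonneg hε'.le]
      gcongr
      have := hG _ (mt t) _ (norm_radialRetract_le hR x.1) _ (ms x.2)
      have : 0 ≤ B₂ * B₃ + |C₁| * 3 + (|C₂| * 3 * B₃ + B₂ * K) := by positivity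
      linarith
    · change ‖ε⁻¹ * (max (-M.S (pt t) (radialRetract R x.1) (ps x.2)) 0 * lam (ps x.2))‖ ≤ ε⁻¹ * _
      rw [norm_mul, norm_mul, Real.norm_of_nonneg hε'.le, Real.norm_eq_abs, Real.norm_eq_abs]
      gcongr
      have h1 : |max (-M.S (pt t) (radialRetract R x.1) (ps x.2)) 0| * |lam (ps x.2)| ≤ B₂ * B₃ :=
        mul_le_mul (bS t x) (hB₃ _ (ms _)) (abs_nonneg _) hB₂
      have : 0 ≤ B₁ + |C₁| * 3 + (|C₂| * 3 * B₃ + B₂ * K) := by positivity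
      linarith
  · intro t t' x x'
    rw [Prod.norm_def]
    have hd : 0 ≤ |t - t'| + ‖x - x'‖ := by positivity
    refine max_le ?_ ?_
    · change ‖-(ε⁻¹ • M.G (pt t) (radialRetract R x.1) (ps x.2))
        - -(ε⁻¹ • M.G (pt t') (radialRetract R x'.1) (ps x'.2))‖ ≤ ε⁻¹ * _ * _
      rw [neg_sub_neg, ← smul_sub, norm_smul, Real.norm_of_nonneg hε'.le, norm_sub_rev, mul_assoc]
      gcongr
      refine (dG t t' x x').trans ?_
      gcongr
      have : 0 ≤ B₁ + B₂ * B₃ + (|C₂| * 3 * B₃ + B₂ * K) := by positivity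
      linarith
    · change ‖ε⁻¹ * (max (-M.S (pt t) (radialRetract R x.1) (ps x.2)) 0 * lam (ps x.2))
        - ε⁻¹ * (max (-M.S (pt t') (radialRetract R x'.1) (ps x'.2)) 0 * lam (ps x'.2))‖
          ≤ ε⁻¹ * _ * _
      rw [← mul_sub, norm_mul, Real.norm_of_nonneg hε'.le, mul_assoc]
      gcongr
      set m := max (-M.S (pt t) (radialRetract R x.1) (ps x.2)) 0
      set m' := max (-M.S (pt t') (radialRetract R x'.1) (ps x'.2)) 0
      have hm : |m - m'| ≤ |C₂| * 3 * (|t - t'| + ‖x - x'‖) := by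
        refine (abs_max_sub_max_le_abs _ _ _).trans ?_
        rw [neg_sub_neg, abs_sub_comm]
        exact dS t t' x x'
      have e : m * lam (ps x.2) - m' * lam (ps x'.2)
          = (m - m') * lam (ps x.2) + m' * (lam (ps x.2) - lam (ps x'.2)) := by ring
      rw [e, Real.norm_eq_abs]
      refine (abs_add_le _ _).trans ?_
      rw [abs_mul, abs_mul]
      have h1 : |m - m'| * |lam (ps x.2)| ≤ |C₂| * 3 * (|t - t'| + ‖x - x'‖) * B₃ :=
        mul_le_mul hm (hB₃ _ (ms _)) (abs_nonneg _) (by positivity)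
      have h2 : |m'| * |lam (ps x.2) - lam (ps x'.2)| ≤ B₂ * (K * (|t - t'| + ‖x - x'‖)) := by
        refine mul_le_mul (bS t' x') ((dl x x').trans ?_) (abs_nonneg _) hB₂
        gcongr
        linarith [abs_nonneg (t - t')]
      have h3 : 0 ≤ (B₁ + B₂ * B₃ + |C₁| * 3) * (|t - t'| + ‖x - x'‖) := by positivity
      nlinarith

/-- Differential inequality: `f` stays below `B` if `f' ≤ 0` wherever `f > B`. -/
lemma _root_.le_of_deriv_nonpos_of_gt {f f' : ℝ → ℝ} {T B : ℝ}
    (hf : ∀ t ∈ Icc 0 T, HasDerivWithinAt f (f' t) (Icc 0 T) t) (h0 : f 0 ≤ B)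
    (h : ∀ t ∈ Icc 0 T, B < f t → f' t ≤ 0) : ∀ t ∈ Icc 0 T, f t ≤ B := by
  intro t ht
  refine le_of_forall_pos_le_add fun δ hδ => ?_
  have hT : 0 < 1 + T := by linarith [ht.1.trans ht.2]
  -- The comparison function has slope `δ / (1 + T) > 0`, which makes the differential inequality
  -- strict, and it exceeds `B` by at most `δ` up to time `T`.
  have key := image_le_of_deriv_right_lt_deriv_boundary' (f := f) (f' := f') (a := 0) (b := T)
    (B := fun t => B + δ / (1 + T) * (1 + t)) (B' := fun _ => δ / (1 + T))
    (fun t ht => (hf t ht).continuousWithinAt)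
    (fun t ht => (hf t ⟨ht.1, ht.2.le⟩).mono_of_mem_nhdsWithin (Icc_mem_nhdsGE_of_mem ht))
    (by have : 0 < δ / (1 + T) := by positivity
        linarith) (by fun_prop)
    (fun t _ => by
      have : HasDerivAt (fun t : ℝ => B + δ / (1 + T) * (1 + t)) (δ / (1 + T)) t := by
        simpa using (((hasDerivAt_id t).const_add 1).const_mul (δ / (1 + T))).const_add B
      exact this.hasDerivWithinAt)
    (fun t ht he => by
      have hp : 0 < δ / (1 + T) := by positivity
      refine (h t ⟨ht.1, ht.2.le⟩ ?_).trans_lt hp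
      rw [he]
      have : 0 < δ / (1 + T) * (1 + t) := mul_pos hp (by linarith [ht.1])
      linarith) ht
  refine key.trans ?_
  have : δ / (1 + T) * (1 + t) ≤ δ := by
    rw [div_mul_eq_mul_div, div_le_iff₀ hT]
    gcongr; exact ht.2
  linarith

/-- Existence of the flow on `[0,T]`, with a bound that does not depend on `ε`. -/
theorem exists_flow [CompleteSpace V] (hlam : LipschitzOnWith K lam (Icc M.a M.b))
    (hlam0 : ∀ σ ∈ Icc M.a M.b, 0 ≤ lam σ) (hlamb : lam M.b = 0) (u₀ : V) :
    ∃ R, ∀ ε, 0 < ε → ∃ v s, M.IsFlow lam u₀ ε v s ∧ ∀ t ∈ Icc 0 M.T, ‖v t‖ ≤ R := by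
  -- `R` is fixed before `ε`: the outward condition concerns the sign of `⟨v, G⟩`, which the factor
  -- `ε⁻¹` does not change.
  obtain ⟨R, hR, hu, hout⟩ := M.exists_radius ‖u₀‖
  refine ⟨R, fun ε hε => ?_⟩
  obtain ⟨C, hb, hl⟩ := field_bounds hlam hR hε
  obtain ⟨x, hx0, hx⟩ := exists_solution_of_bounded_lipschitz M.T_pos.le (M.field lam R ε) C C hb
    (fun t => LipschitzWith.of_dist_le_mul fun y z => by
      have := hl t t y z
      rwa [sub_self, abs_zero, zero_add, ← dist_eq_norm, ← dist_eq_norm] at this)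
    (fun y => (LipschitzWith.of_dist_le_mul (K := C) fun t t' => by
      have := hl t t' y y
      rwa [sub_self y, norm_zero, add_zero, ← dist_eq_norm, ← Real.dist_eq] at this).continuous)
    (u₀, M.a)
  have hε' : 0 < ε⁻¹ := inv_pos.2 hε
  have hv : ∀ t ∈ Icc 0 M.T, HasDerivWithinAt (fun t => (x t).1) (M.field lam R ε t (x t)).1
      (Icc 0 M.T) t := fun t ht =>
    (ContinuousLinearMap.fst ℝ V ℝ).hasFDerivAt.comp_hasDerivWithinAt t (hx t ht)
  have hs : ∀ t ∈ Icc 0 M.T, HasDerivWithinAt (fun t => (x t).2) (M.field lam R ε t (x t)).2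
      (Icc 0 M.T) t := fun t ht =>
    (ContinuousLinearMap.snd ℝ V ℝ).hasFDerivAt.comp_hasDerivWithinAt t (hx t ht)
  have hpt : ∀ t ∈ Icc 0 M.T, (projIcc 0 M.T M.T_pos.le t : ℝ) = t := fun t ht => by
    rw [projIcc_of_mem _ ht]
  have hmono : MonotoneOn (fun t => (x t).2) (Icc 0 M.T) := by
    refine monotoneOn_of_hasDerivWithinAt_nonneg (convex_Icc 0 M.T)
      (fun t ht => (hs t ht).continuousWithinAt)
      (fun t ht => (hs t (interior_subset ht)).mono interior_subset) fun t _ => ?_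
    exact mul_nonneg hε'.le (mul_nonneg (le_max_right _ _) (hlam0 _ (Subtype.prop _)))
  -- Above `b` the clamped length is `b`, where `lam` vanishes, so the growth stops.
  have hsb : ∀ t ∈ Icc 0 M.T, (x t).2 ≤ M.b := by
    refine le_of_deriv_nonpos_of_gt hs (by rw [hx0]; exact M.a_lt_b.le) fun t _ h => ?_
    change ε⁻¹ * (_ * lam _) ≤ 0
    rw [projIcc_of_right_le _ h.le, hlamb, mul_zero, mul_zero]
  have hmem : ∀ t ∈ Icc 0 M.T, (x t).2 ∈ Icc M.a M.b := fun t ht => by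
    refine ⟨?_, hsb t ht⟩
    have := hmono (left_mem_Icc.2 M.T_pos.le) ht ht.1
    simpa [hx0] using this
  have hps : ∀ t ∈ Icc 0 M.T, (projIcc M.a M.b M.a_lt_b.le (x t).2 : ℝ) = (x t).2 := fun t ht => by
    rw [projIcc_of_mem _ (hmem t ht)]
  -- On the sphere of radius `R` the derivative of `‖v‖²` is strictly negative, so the trajectory
  -- stays in the ball. All truncations are then inactive and the truncated flow is the true one.
  have hbd : ∀ t ∈ Icc 0 M.T, ‖(x t).1‖ ≤ R := by
    have h2 : ∀ t ∈ Icc 0 M.T, HasDerivWithinAt (fun t => ‖(x t).1‖ ^ 2)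
        (2 * inner ℝ (x t).1 (M.field lam R ε t (x t)).1) (Icc 0 M.T) t := fun t ht =>
      (hv t ht).norm_sq
    intro t ht
    have key := image_le_of_deriv_right_lt_deriv_boundary' (B := fun _ => R ^ 2)
      (B' := fun _ => 0) (fun t ht => (h2 t ht).continuousWithinAt)
      (fun t ht => (h2 t ⟨ht.1, ht.2.le⟩).mono_of_mem_nhdsWithin (Icc_mem_nhdsGE_of_mem ht))
      (by rw [hx0]; gcongr) (by fun_prop)
      (fun t _ => hasDerivWithinAt_const _ _ _) (fun t ht he => by
        have ht' : t ∈ Icc 0 M.T := ⟨ht.1, ht.2.le⟩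
        have hn : ‖(x t).1‖ = R := by
          have := (pow_left_inj₀ (norm_nonneg _) hR.le two_ne_zero).1 he
          exact this
        have := hout t ht' _ (hmem t ht') _ hn
        change 2 * inner ℝ (x t).1 (-(ε⁻¹ • M.G _ _ _)) < 0
        rw [hpt t ht', hps t ht', radialRetract_of_norm_le hR hn.le, inner_neg_right,
          real_inner_smul_right]
        have := mul_pos hε' this
        linarith) ht
    exact (pow_le_pow_iff_left₀ (norm_nonneg _) hR.le two_ne_zero).1 key
  refine ⟨fun t => (x t).1, fun t => (x t).2, ⟨hmem, hmono, fun t ht => ?_, fun t ht => ?_,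
    by rw [hx0], by rw [hx0]⟩, hbd⟩
  · have := hv t ht
    simp only [field] at this
    rwa [hpt t ht, hps t ht, radialRetract_of_norm_le hR (hbd t ht)] at this
  · have := hs t ht
    simp only [field] at this
    rwa [hpt t ht, hps t ht, radialRetract_of_norm_le hR (hbd t ht)] at this

end EnergySystem

/-! ### Compactness tools: Helly selection and summable integrals. -/

/-- Helly's selection theorem on the line, with convergence at the continuity points of the
limit. -/
lemma exists_helly_subseq {a b : ℝ} (s : ℕ → ℝ → ℝ) (hmono : ∀ n, Monotone (s n))
    (hmem : ∀ n x, s n x ∈ Icc a b) : ∃ (φ : ℕ → ℕ) (m : ℝ → ℝ), StrictMono φ ∧ Monotone m ∧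
      (∀ x, m x ∈ Icc a b) ∧
      ∀ x, ContinuousAt m x → Tendsto (fun n => s (φ n) x) atTop (𝓝 (m x)) := by
  -- The countable product of copies of `[a, b]` indexed by `ℚ` is sequentially compact, which gives
  -- convergence at every rational.
  obtain ⟨L, φ, hφ, hL⟩ := CompactSpace.tendsto_subseq
    (fun n => fun q : ℚ => (⟨s n q, hmem n q⟩ : Icc a b))
  have hL' : ∀ q : ℚ, Tendsto (fun n => s (φ n) q) atTop (𝓝 (L q : ℝ)) := fun q =>
    (continuous_subtype_val.tendsto _).comp ((continuous_apply q).tendsto L |>.comp hL)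
  have hLm : ∀ p q : ℚ, p ≤ q → (L p : ℝ) ≤ L q := fun p q hpq =>
    le_of_tendsto_of_tendsto' (hL' p) (hL' q) fun n => hmono _ (by exact_mod_cast hpq)
  have hne : ∀ x : ℝ, Nonempty {q : ℚ // x < q} := fun x =>
    let ⟨q, hq⟩ := exists_rat_gt x; ⟨⟨q, hq⟩⟩
  have hbdd : ∀ x : ℝ, BddBelow (range fun q : {q : ℚ // x < q} => (L q : ℝ)) := fun x =>
    ⟨a, by rintro _ ⟨q, rfl⟩; exact (L q).2.1⟩
  -- With rationals strictly to the right of `x`, one has `L q ≤ m x` for `q ≤ x` and `m x ≤ L q`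
  -- for `x < q`. By monotonicity this squeezes the sequence at each continuity point of `m`.
  set m : ℝ → ℝ := fun x => ⨅ q : {q : ℚ // x < q}, (L q : ℝ) with hm
  have hmle : ∀ (x : ℝ) (q : ℚ), x < q → m x ≤ L q := fun x q hq => ciInf_le (hbdd x) ⟨q, hq⟩
  have hlem : ∀ (x : ℝ) (q : ℚ), (q : ℝ) ≤ x → L q ≤ m x := fun x q hq => by
    have := hne x
    exact le_ciInf fun p => hLm _ _ (by exact_mod_cast hq.trans p.2.le)
  have hmm : Monotone m := fun x y hxy => by
    have := hne y
    exact le_ciInf fun p => hmle x p (hxy.trans_lt p.2)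
  refine ⟨φ, m, hφ, hmm, fun x => ?_, fun x hx => ?_⟩
  · have := hne x
    obtain ⟨q, hq⟩ := hne x
    exact ⟨le_ciInf fun p => (L p).2.1, (hmle x q hq).trans (L q).2.2⟩
  · rw [tendsto_order]
    constructor
    · intro y hy
      obtain ⟨l, u, hxl, hu⟩ := mem_nhds_iff_exists_Ioo_subset.1 (hx.eventually (lt_mem_nhds hy))
      obtain ⟨z, hz1, hz2⟩ := exists_between hxl.1
      obtain ⟨q, hq1, hq2⟩ := exists_rat_btwn hz2
      have h1 : y < m z := hu ⟨hz1, hz2.trans hxl.2⟩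
      have h2 : y < L q := h1.trans_le (hmle z q hq1)
      filter_upwards [(hL' q).eventually (lt_mem_nhds h2)] with n hn
      exact lt_of_lt_of_le hn (hmono _ hq2.le)
    · intro y hy
      have := hne x
      obtain ⟨q, hq⟩ := exists_lt_of_ciInf_lt hy
      filter_upwards [(hL' q).eventually (gt_mem_nhds hq)] with n hn
      exact lt_of_le_of_lt (hmono _ q.2.le) hn

/-- Nonnegative functions with summable integrals tend to zero almost everywhere. -/
lemma ae_tendsto_zero_of_summable_integral {α : Type*} [MeasurableSpace α] {μ : Measure α}
    {f : ℕ → α → ℝ} (hf : ∀ n, Integrable (f n) μ) (h0 : ∀ n, 0 ≤ᵐ[μ] f n) {c : ℕ → ℝ}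
    (hc : Summable c) (hfc : ∀ n, ∫ x, f n x ∂μ ≤ c n) :
    ∀ᵐ x ∂μ, Tendsto (fun n => f n x) atTop (𝓝 0) := by
  have h1 : ∀ n, ∫⁻ x, ENNReal.ofReal (f n x) ∂μ ≤ ENNReal.ofReal (c n) := fun n => by
    rw [← ofReal_integral_eq_lintegral_ofReal (hf n) (h0 n)]
    exact ENNReal.ofReal_le_ofReal (hfc n)
  have hc0 : ∀ n, 0 ≤ c n := fun n => (integral_nonneg_of_ae (h0 n)).trans (hfc n)
  -- The series has finite integral, so it converges almost everywhere and its terms tend to zero.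
  have h2 : ∫⁻ x, ∑' n, ENNReal.ofReal (f n x) ∂μ ≠ ⊤ := by
    rw [lintegral_tsum fun n => (hf n).1.aemeasurable.ennreal_ofReal]
    refine ne_top_of_le_ne_top ?_ (ENNReal.tsum_le_tsum h1)
    rw [← ENNReal.ofReal_tsum_of_nonneg hc0 hc]
    exact ENNReal.ofReal_ne_top
  have h3 := ae_lt_top' (AEMeasurable.tsum fun n =>
    (hf n).1.aemeasurable.ennreal_ofReal) h2
  have h4 : ∀ᵐ x ∂μ, ∀ n, 0 ≤ f n x := ae_all_iff.2 h0
  filter_upwards [h3, h4] with x hx hx0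
  have h5 := ENNReal.tendsto_atTop_zero_of_tsum_ne_top hx.ne
  have h6 := (ENNReal.tendsto_toReal ENNReal.zero_ne_top).comp h5
  simpa [Function.comp_def, ENNReal.toReal_ofReal (hx0 _)] using h6

/-! ### Critical points, energy balance and dissipation along the flow. -/

namespace EnergySystem

variable {V : Type*} [NormedAddCommGroup V] [InnerProductSpace ℝ V] (M : EnergySystem V)

lemma integrableOn_P {v : ℝ → V} {s : ℝ → ℝ} {R : ℝ} (hs : ∀ t ∈ Icc 0 M.T, s t ∈ Icc M.a M.b)
    (hR : ∀ t ∈ Icc 0 M.T, ‖v t‖ ≤ R) (hv' : AEStronglyMeasurable v (volume.restrict (Icc 0 M.T)))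
    (hs' : AEStronglyMeasurable s (volume.restrict (Icc 0 M.T))) :
    IntegrableOn (fun t => M.P t (v t) (s t)) (Icc 0 M.T) := by
  obtain ⟨C, hC⟩ := M.P_bound R
  refine Integrable.of_bound (M.P_meas v s hs hv' hs') C ?_
  filter_upwards [hC, ae_restrict_mem measurableSet_Icc] with t ht hm
  exact ht _ (hR t hm) _ (hs t hm)

lemma norm_sub_le_norm_grad_sub {t : ℝ} (ht : t ∈ Icc 0 M.T) {σ : ℝ} (hσ : σ ∈ Icc M.a M.b) (v v' : V) :
    M.c * ‖v - v'‖ ≤ ‖M.G t v σ - M.G t v' σ‖ := by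
  have h1 := M.monotone t ht σ hσ v v'
  have h2 := real_inner_le_norm (M.G t v σ - M.G t v' σ) (v - v')
  rcases (norm_nonneg (v - v')).eq_or_lt with h | h
  · rw [← h, mul_zero]; exact norm_nonneg _
  · refine le_of_mul_le_mul_right ?_ h
    calc _ = M.c * ‖v - v'‖ ^ 2 := by ring
      _ ≤ _ := h1.trans h2

/-- The unique critical point of `E(t, ·, σ)`, as a Lipschitz function of `(t, σ)`. -/
lemma exists_critical : ∃ (w : ℝ → ℝ → V) (R C : ℝ),
    (∀ t ∈ Icc 0 M.T, ∀ σ ∈ Icc M.a M.b, M.G t (w t σ) σ = 0 ∧ ‖w t σ‖ ≤ R) ∧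
    ∀ t ∈ Icc 0 M.T, ∀ t' ∈ Icc 0 M.T, ∀ σ ∈ Icc M.a M.b, ∀ σ' ∈ Icc M.a M.b,
      ‖w t σ - w t' σ'‖ ≤ C * (|t - t'| + |σ - σ'|) := by
  have hex : ∀ t σ, ∃ v, t ∈ Icc 0 M.T → σ ∈ Icc M.a M.b → M.G t v σ = 0 := fun t σ => by
    by_cases h : t ∈ Icc 0 M.T ∧ σ ∈ Icc M.a M.b
    · obtain ⟨v, hv⟩ := M.exists_zero t h.1 σ h.2
      exact ⟨v, fun _ _ => hv⟩
    · exact ⟨0, fun h1 h2 => (h ⟨h1, h2⟩).elim⟩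
  choose w hw using hex
  have hc := M.c_pos
  obtain ⟨B, -, hB⟩ := M.G_bound 0
  have hR : ∀ t ∈ Icc 0 M.T, ∀ σ ∈ Icc M.a M.b, ‖w t σ‖ ≤ B / M.c := fun t ht σ hσ => by
    rw [le_div_iff₀' hc]
    have := M.norm_sub_le_norm_grad_sub ht hσ (w t σ) 0
    rw [sub_zero, hw t σ ht hσ, zero_sub, norm_neg] at this
    exact this.trans (hB t ht 0 (by simp) σ hσ)
  obtain ⟨C, hC⟩ := M.G_lip (B / M.c)
  refine ⟨w, B / M.c, C / M.c, fun t ht σ hσ => ⟨hw t σ ht hσ, hR t ht σ hσ⟩,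
    fun t ht t' ht' σ hσ σ' hσ' => ?_⟩
  rw [div_mul_eq_mul_div, le_div_iff₀' hc]
  -- Strong monotonicity at `(t, σ)` leaves `‖G t (w t' σ') σ‖`. Since `G t' (w t' σ') σ' = 0`, this
  -- is a difference of values of `G` at the same state, hence Lipschitz in `(t, σ)`.
  refine (M.norm_sub_le_norm_grad_sub ht hσ _ _).trans ?_
  have h1 := hC t ht t' ht' (w t' σ') (hR t' ht' σ' hσ') (w t' σ') (hR t' ht' σ' hσ') σ hσ σ' hσ'
  rw [sub_self (w t' σ'), norm_zero, add_zero, hw t' σ' ht' hσ', sub_zero] at h1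
  rwa [hw t σ ht hσ, zero_sub, norm_neg]

variable {M} {lam : ℝ → ℝ} {u₀ : V} {ε : ℝ} {v : ℝ → V} {s : ℝ → ℝ} {R : ℝ}

lemma IsFlow.continuousOn_v (h : M.IsFlow lam u₀ ε v s) : ContinuousOn v (Icc 0 M.T) :=
  fun t ht => (h.deriv_v t ht).continuousWithinAt

lemma IsFlow.continuousOn_s (h : M.IsFlow lam u₀ ε v s) : ContinuousOn s (Icc 0 M.T) :=
  fun t ht => (h.deriv_s t ht).continuousWithinAt

lemma continuousOn_of_lip {F : Type*} [SeminormedAddCommGroup F] {f : ℝ → V → ℝ → F}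
    (hf : ∃ C, ∀ t ∈ Icc 0 M.T, ∀ t' ∈ Icc 0 M.T, ∀ v, ‖v‖ ≤ R → ∀ v', ‖v'‖ ≤ R →
      ∀ σ ∈ Icc M.a M.b, ∀ σ' ∈ Icc M.a M.b,
        ‖f t v σ - f t' v' σ'‖ ≤ C * (|t - t'| + ‖v - v'‖ + |σ - σ'|)) :
    ContinuousOn (fun x : ℝ × V × ℝ => f x.1 x.2.1 x.2.2)
      (Icc 0 M.T ×ˢ Metric.closedBall 0 R ×ˢ Icc M.a M.b) := by
  obtain ⟨C, hC⟩ := hf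
  have : LipschitzOnWith (3 * |C|).toNNReal (fun x : ℝ × V × ℝ => f x.1 x.2.1 x.2.2)
      (Icc 0 M.T ×ˢ Metric.closedBall 0 R ×ˢ Icc M.a M.b) := by
    refine LipschitzOnWith.of_dist_le_mul fun x hx y hy => ?_
    rw [Real.coe_toNNReal _ (by positivity), dist_eq_norm, dist_eq_norm]
    refine (hC _ hx.1 _ hy.1 _ (mem_closedBall_zero_iff.1 hx.2.1) _
      (mem_closedBall_zero_iff.1 hy.2.1) _ hx.2.2 _ hy.2.2).trans ?_
    have h1 : |x.1 - y.1| ≤ ‖x - y‖ := norm_fst_le (x - y)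
    have h0 : ‖(x - y).2‖ ≤ ‖x - y‖ := norm_snd_le (x - y)
    have h2 : ‖x.2.1 - y.2.1‖ ≤ ‖x - y‖ := (norm_fst_le (x - y).2).trans h0
    have h3 : |x.2.2 - y.2.2| ≤ ‖x - y‖ := (norm_snd_le (x - y).2).trans h0
    calc _ ≤ |C| * (‖x - y‖ + ‖x - y‖ + ‖x - y‖) := by gcongr; exact le_abs_self C
      _ = _ := by ring
  exact this.continuousOn

lemma continuousOn_comp_of_lip {F : Type*} [SeminormedAddCommGroup F] {f : ℝ → V → ℝ → F}
    (hf : ∃ C, ∀ t ∈ Icc 0 M.T, ∀ t' ∈ Icc 0 M.T, ∀ v, ‖v‖ ≤ R → ∀ v', ‖v'‖ ≤ R →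
      ∀ σ ∈ Icc M.a M.b, ∀ σ' ∈ Icc M.a M.b,
        ‖f t v σ - f t' v' σ'‖ ≤ C * (|t - t'| + ‖v - v'‖ + |σ - σ'|))
    (hv : ContinuousOn v (Icc 0 M.T)) (hs : ContinuousOn s (Icc 0 M.T))
    (hm : ∀ t ∈ Icc 0 M.T, s t ∈ Icc M.a M.b) (hR : ∀ t ∈ Icc 0 M.T, ‖v t‖ ≤ R) :
    ContinuousOn (fun t => f t (v t) (s t)) (Icc 0 M.T) :=
  (continuousOn_of_lip hf).comp (continuousOn_id.prodMk (hv.prodMk hs))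
    fun t ht => ⟨ht, mem_closedBall_zero_iff.2 (hR t ht), hm t ht⟩

lemma tendsto_of_lip {F : Type*} [SeminormedAddCommGroup F] {f : ℝ → V → ℝ → F}
    (hf : ∃ C, ∀ t ∈ Icc 0 M.T, ∀ t' ∈ Icc 0 M.T, ∀ v, ‖v‖ ≤ R → ∀ v', ‖v'‖ ≤ R →
      ∀ σ ∈ Icc M.a M.b, ∀ σ' ∈ Icc M.a M.b,
        ‖f t v σ - f t' v' σ'‖ ≤ C * (|t - t'| + ‖v - v'‖ + |σ - σ'|))
    {τ : ℕ → ℝ} {vn : ℕ → V} {sn : ℕ → ℝ} {t : ℝ} {x : V} {σ : ℝ}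
    (hτ : ∀ n, τ n ∈ Icc 0 M.T) (hvn : ∀ n, ‖vn n‖ ≤ R) (hsn : ∀ n, sn n ∈ Icc M.a M.b)
    (h1 : Tendsto τ atTop (𝓝 t)) (h2 : Tendsto vn atTop (𝓝 x)) (h3 : Tendsto sn atTop (𝓝 σ)) :
    Tendsto (fun n => f (τ n) (vn n) (sn n)) atTop (𝓝 (f t x σ)) := by
  have ht : t ∈ Icc 0 M.T := isClosed_Icc.mem_of_tendsto h1 (Eventually.of_forall hτ)
  have hσ : σ ∈ Icc M.a M.b := isClosed_Icc.mem_of_tendsto h3 (Eventually.of_forall hsn)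
  have hx : x ∈ Metric.closedBall 0 R := Metric.isClosed_closedBall.mem_of_tendsto h2
    (Eventually.of_forall fun n => mem_closedBall_zero_iff.2 (hvn n))
  have hc := continuousOn_of_lip (M := M) hf (t, x, σ) ⟨ht, hx, hσ⟩
  refine hc.tendsto.comp (tendsto_nhdsWithin_iff.2 ⟨h1.prodMk_nhds (h2.prodMk_nhds h3), ?_⟩)
  exact Eventually.of_forall fun n => ⟨hτ n, mem_closedBall_zero_iff.2 (hvn n), hsn n⟩

/-- The energy inequality along the flow, with the dissipated energy. -/
lemma IsFlow.energy (hε : 0 < ε) (hlam : ContinuousOn lam (Icc M.a M.b))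
    (hlam0 : ∀ σ ∈ Icc M.a M.b, 0 ≤ lam σ) (h : M.IsFlow lam u₀ ε v s)
    (hR : ∀ t ∈ Icc 0 M.T, ‖v t‖ ≤ R) {α β : ℝ} (hα : α ∈ Icc 0 M.T) (hβ : β ∈ Icc 0 M.T)
    (hαβ : α ≤ β) :
    M.E β (v β) (s β) + ε⁻¹ * ∫ t in α..β, ‖M.G t (v t) (s t)‖ ^ 2
      ≤ M.E α (v α) (s α) + ∫ t in α..β, M.P t (v t) (s t) := by
  have hε' : 0 < ε⁻¹ := inv_pos.2 hε
  have hsub : Icc α β ⊆ Icc 0 M.T := Icc_subset_Icc hα.1 hβ.2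
  have cG : ContinuousOn (fun t => M.G t (v t) (s t)) (Icc 0 M.T) :=
    continuousOn_comp_of_lip (M.G_lip R) h.continuousOn_v h.continuousOn_s h.mem hR
  have cS : ContinuousOn (fun t => M.S t (v t) (s t)) (Icc 0 M.T) :=
    continuousOn_comp_of_lip (M.S_lip R) h.continuousOn_v h.continuousOn_s h.mem hR
  have cs' : ContinuousOn (fun t => ε⁻¹ * (max (-M.S t (v t) (s t)) 0 * lam (s t)))
      (Icc 0 M.T) := by
    refine continuousOn_const.mul (ContinuousOn.mul ?_ (hlam.comp h.continuousOn_s h.mem))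
    exact (continuous_id.max continuous_const).comp_continuousOn cS.neg
  obtain ⟨L₁, hL₁⟩ := isCompact_Icc.exists_bound_of_continuousOn (cG.const_smul ε⁻¹).neg
  obtain ⟨L₂, hL₂⟩ := isCompact_Icc.exists_bound_of_continuousOn cs'
  have lv : LipschitzOnWith L₁.toNNReal v (Icc 0 M.T) := by
    refine (convex_Icc 0 M.T).lipschitzOnWith_of_nnnorm_hasDerivWithin_le h.deriv_v fun t ht => ?_
    rw [← NNReal.coe_le_coe, coe_nnnorm]
    exact (hL₁ t ht).trans (Real.le_coe_toNNReal _)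
  have ls : LipschitzOnWith L₂.toNNReal s (Icc 0 M.T) := by
    refine (convex_Icc 0 M.T).lipschitzOnWith_of_nnnorm_hasDerivWithin_le h.deriv_s fun t ht => ?_
    rw [← NNReal.coe_le_coe, coe_nnnorm]
    exact (hL₂ t ht).trans (Real.le_coe_toNNReal _)
  obtain ⟨C, hC⟩ := M.E_lip R
  set φ : ℝ → ℝ := fun t => M.E t (v t) (s t) with hφ
  -- The chain rule is available only at almost every time. Lipschitz continuity makes the energy
  -- along the flow absolutely continuous, so that it is the integral of its derivative.
  have lφ : LipschitzOnWith (|C| * (1 + L₁.toNNReal + L₂.toNNReal)).toNNReal φ (Icc 0 M.T) := by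
    refine LipschitzOnWith.of_dist_le_mul fun t ht t' ht' => ?_
    rw [Real.coe_toNNReal _ (by positivity), Real.dist_eq, Real.dist_eq]
    refine (hC t ht t' ht' _ (hR t ht) _ (hR t' ht') _ (h.mem t ht) _ (h.mem t' ht')).trans ?_
    have h1 := lv.dist_le_mul t ht t' ht'
    have h2 := ls.dist_le_mul t ht t' ht'
    rw [dist_eq_norm, Real.dist_eq] at h1
    rw [Real.dist_eq, Real.dist_eq] at h2
    calc _ ≤ |C| * (|t - t'| + L₁.toNNReal * |t - t'| + L₂.toNNReal * |t - t'|) := by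
          gcongr; exact le_abs_self C
      _ = _ := by ring
  have ac : AbsolutelyContinuousOnInterval φ α β :=
    (lφ.mono (by rwa [uIcc_of_le hαβ])).absolutelyContinuousOnInterval
  have iP : IntervalIntegrable (fun t => M.P t (v t) (s t)) volume α β := by
    rw [intervalIntegrable_iff_integrableOn_Icc_of_le hαβ]
    exact (M.integrableOn_P h.mem hR (h.continuousOn_v.aestronglyMeasurable measurableSet_Icc)
      (h.continuousOn_s.aestronglyMeasurable measurableSet_Icc)).mono_set hsub
  have iG : IntervalIntegrable (fun t => ‖M.G t (v t) (s t)‖ ^ 2) volume α β := by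
    refine ContinuousOn.intervalIntegrable ?_
    rw [uIcc_of_le hαβ]
    exact (cG.mono hsub).norm.pow 2
  have key : ∀ᵐ t ∂volume.restrict (Icc α β), deriv φ t
      ≤ M.P t (v t) (s t) - ε⁻¹ * ‖M.G t (v t) (s t)‖ ^ 2 := by
    have h1 := ae_restrict_of_ae_restrict_of_subset hsub M.chain
    have h2 : ∀ᵐ t ∂volume.restrict (Icc α β), t ∈ Ioo 0 M.T := by
      rw [ae_restrict_iff' measurableSet_Icc]
      have h3 : ∀ᵐ t : ℝ, t ∉ ({0, M.T} : Set ℝ) :=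
        measure_eq_zero_iff_ae_notMem.1 (Set.Finite.measure_zero (by simp) volume)
      filter_upwards [h3] with t ht hm
      have := hsub hm
      simp only [mem_insert_iff, mem_singleton_iff, not_or] at ht
      exact ⟨this.1.lt_of_ne' ht.1, this.2.lt_of_ne ht.2⟩
    filter_upwards [h1, h2] with t ht hm
    have hm' : t ∈ Icc 0 M.T := Ioo_subset_Icc_self hm
    have hd := (ht v s _ _ h.mem (h.deriv_v t hm') (h.deriv_s t hm')).hasDerivAt
      (Icc_mem_nhds hm.1 hm.2)
    rw [hd.deriv, inner_neg_right, real_inner_smul_right, real_inner_self_eq_norm_sq]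
    -- Growth of `s` occurs only where `S < 0`, so it can only lower the energy; this term is
    -- dropped.
    have : M.S t (v t) (s t) * (ε⁻¹ * (max (-M.S t (v t) (s t)) 0 * lam (s t))) ≤ 0 := by
      have h3 : M.S t (v t) (s t) * max (-M.S t (v t) (s t)) 0 ≤ 0 := by
        rcases le_total (-M.S t (v t) (s t)) 0 with h4 | h4
        · rw [max_eq_right h4, mul_zero]
        · rw [max_eq_left h4]; nlinarith
      have h4 := mul_nonneg hε'.le (hlam0 _ (h.mem t hm'))
      calc _ = M.S t (v t) (s t) * max (-M.S t (v t) (s t)) 0 * (ε⁻¹ * lam (s t)) := by ring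
        _ ≤ 0 := mul_nonpos_of_nonpos_of_nonneg h3 h4
    linarith
  have h5 := intervalIntegral.integral_mono_ae_restrict hαβ ac.intervalIntegrable_deriv
    (iP.sub (iG.const_mul ε⁻¹)) key
  rw [ac.integral_deriv_eq_sub, intervalIntegral.integral_sub iP (iG.const_mul ε⁻¹),
    intervalIntegral.integral_const_mul] at h5
  simp only [hφ] at h5
  linarith

/-- The dissipation of the flow is of order `ε`. -/
lemma exists_dissipation_bound (R : ℝ) (hlam : ContinuousOn lam (Icc M.a M.b))
    (hlam0 : ∀ σ ∈ Icc M.a M.b, 0 ≤ lam σ) (u₀ : V) : ∃ C, ∀ ε v s, 0 < ε →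
      M.IsFlow lam u₀ ε v s → (∀ t ∈ Icc 0 M.T, ‖v t‖ ≤ R) →
      IntegrableOn (fun t => ‖M.G t (v t) (s t)‖ ^ 2 + max (-M.S t (v t) (s t)) 0 * lam (s t))
        (Icc 0 M.T) ∧
      ∫ t in Icc 0 M.T, (‖M.G t (v t) (s t)‖ ^ 2 + max (-M.S t (v t) (s t)) 0 * lam (s t))
        ≤ C * ε := by
  obtain ⟨C₁, hC₁⟩ := M.E_lip R
  obtain ⟨C₂, hC₂⟩ := M.P_bound R
  have hT := M.T_pos.le
  have h0 : (0 : ℝ) ∈ Icc 0 M.T := left_mem_Icc.2 hT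
  have h1 : M.T ∈ Icc 0 M.T := right_mem_Icc.2 hT
  refine ⟨|C₁| * (M.T + 2 * R + (M.b - M.a)) + |C₂| * M.T + (M.b - M.a),
    fun ε v s hε h hR => ?_⟩
  have cG : ContinuousOn (fun t => M.G t (v t) (s t)) (Icc 0 M.T) :=
    continuousOn_comp_of_lip (M.G_lip R) h.continuousOn_v h.continuousOn_s h.mem hR
  have cS : ContinuousOn (fun t => M.S t (v t) (s t)) (Icc 0 M.T) :=
    continuousOn_comp_of_lip (M.S_lip R) h.continuousOn_v h.continuousOn_s h.mem hR
  have cl : ContinuousOn (fun t => max (-M.S t (v t) (s t)) 0 * lam (s t)) (Icc 0 M.T) :=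
    ((continuous_id.max continuous_const).comp_continuousOn cS.neg).mul (hlam.comp h.continuousOn_s h.mem)
  have iG : IntegrableOn (fun t => ‖M.G t (v t) (s t)‖ ^ 2) (Icc 0 M.T) :=
    (cG.norm.pow 2).integrableOn_Icc
  have il := cl.integrableOn_Icc (μ := volume)
  refine ⟨iG.add il, ?_⟩
  rw [integral_add iG il, integral_Icc_eq_integral_Ioc, integral_Icc_eq_integral_Ioc,
    ← intervalIntegral.integral_of_le hT, ← intervalIntegral.integral_of_le hT]
  -- The scalar part of the dissipation needs no energy estimate: it is `ε s'`, whose integral is at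
  -- most `ε (b - a)`.
  have e1 : ∫ t in (0 : ℝ)..M.T, ε⁻¹ * (max (-M.S t (v t) (s t)) 0 * lam (s t))
      = s M.T - s 0 := by
    refine intervalIntegral.integral_eq_sub_of_hasDerivAt_of_le hT h.continuousOn_s
      (fun t ht => (h.deriv_s t (Ioo_subset_Icc_self ht)).hasDerivAt (Icc_mem_nhds ht.1 ht.2)) ?_
    refine ContinuousOn.intervalIntegrable ?_
    rw [uIcc_of_le hT]
    exact continuousOn_const.mul cl
  rw [intervalIntegral.integral_const_mul] at e1
  have e2 := h.energy hε hlam hlam0 hR h0 h1 hT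
  have e3 : ∫ t in (0 : ℝ)..M.T, M.P t (v t) (s t) ≤ |C₂| * M.T := by
    refine (le_abs_self _).trans ?_
    have := intervalIntegral.norm_integral_le_of_norm_le_const_ae (a := 0) (b := M.T) (C := |C₂|)
      (f := fun t => M.P t (v t) (s t)) ?_
    · rwa [sub_zero, abs_of_nonneg hT] at this
    · rw [uIoc_of_le hT]
      rw [ae_restrict_iff' measurableSet_Icc] at hC₂
      filter_upwards [hC₂] with t ht hm
      have hm' := Ioc_subset_Icc_self hm
      exact (ht hm' _ (hR t hm') _ (h.mem t hm')).trans (le_abs_self _)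
  have m0 := h.mem 0 h0
  have m1 := h.mem _ h1
  have e4 : M.E 0 (v 0) (s 0) - M.E M.T (v M.T) (s M.T)
      ≤ |C₁| * (M.T + 2 * R + (M.b - M.a)) := by
    refine (le_abs_self _).trans
      ((hC₁ 0 h0 M.T h1 _ (hR 0 h0) _ (hR _ h1) _ m0 _ m1).trans ?_)
    have a1 : |0 - M.T| ≤ M.T := by rw [zero_sub, abs_neg, abs_of_nonneg hT]
    have a2 : ‖v 0 - v M.T‖ ≤ 2 * R := by
      linarith [norm_sub_le (v 0) (v M.T), hR 0 h0, hR _ h1]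
    have a3 : |s 0 - s M.T| ≤ M.b - M.a := abs_le.2 ⟨by linarith [m0.1, m1.2], by
      linarith [m0.2, m1.1]⟩
    calc _ ≤ |C₁| * (|0 - M.T| + ‖v 0 - v M.T‖ + |s 0 - s M.T|) := by
          gcongr; exact le_abs_self _
      _ ≤ _ := by gcongr
  have e5 : ε⁻¹ * ((∫ t in (0 : ℝ)..M.T, ‖M.G t (v t) (s t)‖ ^ 2)
      + ∫ t in (0 : ℝ)..M.T, max (-M.S t (v t) (s t)) 0 * lam (s t))
      ≤ |C₁| * (M.T + 2 * R + (M.b - M.a)) + |C₂| * M.T + (M.b - M.a) := by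
    rw [mul_add, e1]
    linarith [m0.1, m1.2]
  rwa [inv_mul_le_iff₀' hε] at e5

end EnergySystem

/-! ### Passage to the limit as `ε` tends to zero. -/

namespace EnergySystem

variable {V : Type*} [NormedAddCommGroup V] [InnerProductSpace ℝ V]

/-- Approximable quasistatic evolutions of an energy system. -/
structure IsEvolution (M : EnergySystem V) (lam : ℝ → ℝ) (u₀ : V) (v : ℝ → V) (σ : ℝ → ℝ) :
    Prop where
  mem : ∀ t ∈ Icc 0 M.T, σ t ∈ Icc M.a M.b
  left_continuous : ∀ t ∈ Icc 0 M.T,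
    ContinuousWithinAt v (Icc 0 t) t ∧ ContinuousWithinAt σ (Icc 0 t) t
  equilibrium : ∀ t ∈ Icc 0 M.T, M.G t (v t) (σ t) = 0
  stability : ∀ t ∈ Icc 0 M.T, 0 ≤ M.S t (v t) (σ t) * lam (σ t)
  irreversibility : MonotoneOn σ (Icc 0 M.T)
  energy_integrable : IntegrableOn (fun τ => M.P τ (v τ) (σ τ)) (Icc 0 M.T)
  energy_inequality : ∀ s t, 0 ≤ s → s < t → t ≤ M.T →
    M.E t (v t) (σ t) ≤ M.E s (v s) (σ s) + ∫ τ in s..t, M.P τ (v τ) (σ τ)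
  approximable : ∃ (ε : ℕ → ℝ) (vε : ℕ → ℝ → V) (σε : ℕ → ℝ → ℝ),
    (∀ n, 0 < ε n) ∧ Tendsto ε atTop (𝓝 0) ∧
    (∀ n, M.IsFlow lam u₀ (ε n) (vε n) (σε n)) ∧
    ∀ᵐ t ∂volume.restrict (Icc 0 M.T),
      Tendsto (fun n => σε n t) atTop (𝓝 (σ t)) ∧ Tendsto (fun n => vε n t) atTop (𝓝 (v t))

/-- The left-continuous modification of a monotone function on `(0, ∞)`, continuous at `0`. -/
def _root_.leftModification (m : ℝ → ℝ) (t : ℝ) : ℝ :=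
  if 0 < t then Function.leftLim m t else Function.rightLim m 0

section Modification

variable {m : ℝ → ℝ} (hm : Monotone m)
include hm

lemma _root_.Monotone.leftModification_monotoneOn : MonotoneOn (leftModification m) (Ici 0) := by
  intro x hx y hy hxy
  rcases (mem_Ici.1 hx).eq_or_lt with rfl | hx'
  · rcases hxy.eq_or_lt with rfl | hy'
    · exact le_rfl
    · rw [leftModification, leftModification, if_neg (lt_irrefl _), if_pos hy']
      exact hm.rightLim_le_leftLim hy'
  · rw [leftModification, leftModification, if_pos hx', if_pos (hx'.trans_le hxy)]
    exact hm.leftLim hxy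

lemma _root_.Monotone.leftModification_continuousWithinAt {t : ℝ} (ht : 0 < t) :
    ContinuousWithinAt (leftModification m) (Iic t) t := by
  have h := continuousWithinAt_leftLim_Iic (hm.tendsto_leftLim t)
  refine h.congr_of_eventuallyEq ?_ (by rw [leftModification, if_pos ht])
  filter_upwards [mem_nhdsWithin_of_mem_nhds (lt_mem_nhds ht)] with x hx
  rw [leftModification, if_pos hx]

/-- Since the value at `0` is the right limit there, properties known at almost every time extend to
the initial time as well, along times decreasing to `0`. -/
lemma _root_.Monotone.tendsto_leftModification_zero :
    Tendsto (leftModification m) (𝓝[>] 0) (𝓝 (leftModification m 0)) := by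
  have e : leftModification m 0 = Function.rightLim m 0 := by
    rw [leftModification, if_neg (lt_irrefl _)]
  rw [e]
  refine tendsto_of_tendsto_of_tendsto_of_le_of_le' tendsto_const_nhds (hm.tendsto_rightLim 0) ?_ ?_
  · filter_upwards [self_mem_nhdsWithin] with x hx
    rw [leftModification, if_pos (mem_Ioi.1 hx)]
    exact hm.rightLim_le_leftLim hx
  · filter_upwards [self_mem_nhdsWithin] with x hx
    rw [leftModification, if_pos (mem_Ioi.1 hx)]
    exact hm.leftLim_le le_rfl

omit hm in
lemma _root_.leftModification_eq {t : ℝ} (ht : 0 < t) (hc : ContinuousAt m t) :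
    leftModification m t = m t := by
  rw [leftModification, if_pos ht]
  exact hc.continuousWithinAt.leftLim_eq

/-- Every time can be approached by times in a set of full measure, along which the modification
converges. -/
lemma _root_.Monotone.exists_seq_leftModification {T : ℝ} (hT : 0 < T) {p : ℝ → Prop}
    (hp : ∀ᵐ t ∂volume.restrict (Icc 0 T), p t) {t : ℝ} (ht : t ∈ Icc 0 T) :
    ∃ τ : ℕ → ℝ, (∀ n, p (τ n)) ∧ (∀ n, τ n ∈ Icc 0 T) ∧ Tendsto τ atTop (𝓝 t) ∧
      Tendsto (fun n => leftModification m (τ n)) atTop (𝓝 (leftModification m t)) := by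
  have hex : ∀ α β, 0 ≤ α → α < β → β ≤ T → ∃ x ∈ Ioo α β, p x := by
    intro α β h1 h2 h3
    have hsub : Ioo α β ⊆ Icc 0 T := fun x hx => ⟨h1.trans hx.1.le, hx.2.le.trans h3⟩
    have h4 := ae_restrict_of_ae_restrict_of_subset hsub hp
    have : (ae (volume.restrict (Ioo α β))).NeBot := by
      rw [ae_neBot, Ne, Measure.restrict_eq_zero, Real.volume_Ioo]
      simpa using h2
    obtain ⟨x, hx⟩ := (h4.and (ae_restrict_mem measurableSet_Ioo)).exists
    exact ⟨x, hx.2, hx.1⟩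
  rcases ht.1.eq_or_lt with rfl | h0
  · obtain ⟨u, -, hu, hlim⟩ := exists_seq_strictAnti_tendsto' hT
    choose τ hτ hpτ using fun n => hex 0 (u n) le_rfl (hu n).1 (hu n).2.le
    have hl : Tendsto τ atTop (𝓝 0) := tendsto_of_tendsto_of_tendsto_of_le_of_le
      tendsto_const_nhds hlim (fun n => (hτ n).1.le) fun n => (hτ n).2.le
    exact ⟨τ, hpτ, fun n => ⟨(hτ n).1.le, (hτ n).2.le.trans (hu n).2.le⟩, hl,
      hm.tendsto_leftModification_zero.comp
        (tendsto_nhdsWithin_iff.2 ⟨hl, Eventually.of_forall fun n => (hτ n).1⟩)⟩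
  · obtain ⟨u, -, hu, hlim⟩ := exists_seq_strictMono_tendsto' h0
    choose τ hτ hpτ using fun n => hex (u n) t (hu n).1.le (hu n).2 ht.2
    have hl : Tendsto τ atTop (𝓝 t) := tendsto_of_tendsto_of_tendsto_of_le_of_le
      hlim tendsto_const_nhds (fun n => (hτ n).1.le) fun n => (hτ n).2.le
    exact ⟨τ, hpτ, fun n => ⟨(hu n).1.le.trans (hτ n).1.le, (hτ n).2.le.trans ht.2⟩, hl,
      (hm.leftModification_continuousWithinAt h0).tendsto.comp
        (tendsto_nhdsWithin_iff.2 ⟨hl, Eventually.of_forall fun n => (hτ n).2.le⟩)⟩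

end Modification

variable {M : EnergySystem V} {lam : ℝ → ℝ} {K : NNReal}

/-- Flows with summable parameters have a subsequence converging, at almost every time, to
equilibrium states satisfying the stability condition. -/
lemma exists_limit_of_flows (hlam : ContinuousOn lam (Icc M.a M.b))
    (hlam0 : ∀ σ ∈ Icc M.a M.b, 0 ≤ lam σ) {u₀ : V} {R : ℝ} {ε : ℕ → ℝ} (hε : ∀ n, 0 < ε n)
    (hsum : Summable ε) {v : ℕ → ℝ → V} {s : ℕ → ℝ → ℝ}
    (hflow : ∀ n, M.IsFlow lam u₀ (ε n) (v n) (s n)) (hR : ∀ n, ∀ t ∈ Icc 0 M.T, ‖v n t‖ ≤ R)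
    {w : ℝ → ℝ → V} (hw0 : ∀ t ∈ Icc 0 M.T, ∀ σ ∈ Icc M.a M.b, M.G t (w t σ) σ = 0)
    (hw : ContinuousOn (fun x : ℝ × ℝ => w x.1 x.2) (Icc 0 M.T ×ˢ Icc M.a M.b)) :
    ∃ (φ : ℕ → ℕ) (m : ℝ → ℝ), StrictMono φ ∧ Monotone m ∧ (∀ x, m x ∈ Icc M.a M.b) ∧
      ∀ᵐ t ∂volume.restrict (Icc 0 M.T), t ∈ Icc 0 M.T ∧ leftModification m t = m t ∧
        Tendsto (fun n => s (φ n) t) atTop (𝓝 (m t)) ∧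
        Tendsto (fun n => v (φ n) t) atTop (𝓝 (w t (m t))) ∧
        0 ≤ M.S t (w t (m t)) (m t) * lam (m t) := by
  have hT := M.T_pos.le
  -- `projIcc` extends the lengths to the whole line by constants, keeping them monotone.
  obtain ⟨φ, m, hφ, hm, hmm, hconv⟩ := exists_helly_subseq (a := M.a) (b := M.b)
    (fun n x => s n (projIcc 0 M.T hT x))
    (fun n x y hxy => (hflow n).monotone (Subtype.prop _) (Subtype.prop _) (monotone_projIcc hT hxy))
    (fun n x => (hflow n).mem _ (Subtype.prop _))
  obtain ⟨C, hC⟩ := exists_dissipation_bound (M := M) R hlam hlam0 u₀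
  -- The integrals are at most `C ε (φ n)`, and summability gives convergence to zero at almost
  -- every time without a further subsequence.
  have hae := ae_tendsto_zero_of_summable_integral (μ := volume.restrict (Icc 0 M.T))
    (fun n => (hC _ _ _ (hε (φ n)) (hflow (φ n)) (hR _)).1)
    (fun n => (ae_restrict_iff' measurableSet_Icc).2 (Eventually.of_forall fun t ht =>
      add_nonneg (sq_nonneg _) (mul_nonneg (le_max_right _ _) (hlam0 _ ((hflow _).mem t ht)))))
    ((hsum.comp_injective hφ.injective).mul_left C)
    (fun n => (hC _ _ _ (hε (φ n)) (hflow (φ n)) (hR _)).2)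
  refine ⟨φ, m, hφ, hm, hmm, ?_⟩
  have hne0 : ∀ᵐ t : ℝ, t ≠ 0 := by
    simpa using (measure_eq_zero_iff_ae_notMem (s := {(0 : ℝ)}) (μ := volume)).1 (by simp)
  have hcont : ∀ᵐ t : ℝ, ContinuousAt m t := by
    have := measure_eq_zero_iff_ae_notMem.1 (hm.countable_not_continuousAt.measure_zero volume)
    filter_upwards [this] with t ht
    simpa using ht
  filter_upwards [hae, ae_restrict_of_ae hne0, ae_restrict_of_ae hcont,
    ae_restrict_mem measurableSet_Icc] with t h1 h2 h3 ht
  have ht0 : 0 < t := ht.1.lt_of_ne' h2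
  have hs : Tendsto (fun n => s (φ n) t) atTop (𝓝 (m t)) := by
    have := hconv t h3
    simpa only [projIcc_of_mem hT ht] using this
  have hG : Tendsto (fun n => ‖M.G t (v (φ n) t) (s (φ n) t)‖ ^ 2) atTop (𝓝 0) :=
    squeeze_zero (fun n => sq_nonneg _) (fun n => le_add_of_nonneg_right
      (mul_nonneg (le_max_right _ _) (hlam0 _ ((hflow _).mem t ht)))) h1
  have hS : Tendsto (fun n => max (-M.S t (v (φ n) t) (s (φ n) t)) 0 * lam (s (φ n) t)) atTop
      (𝓝 0) :=
    squeeze_zero (fun n => mul_nonneg (le_max_right _ _) (hlam0 _ ((hflow _).mem t ht)))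
      (fun n => le_add_of_nonneg_left (sq_nonneg _)) h1
  have hG' : Tendsto (fun n => ‖M.G t (v (φ n) t) (s (φ n) t)‖) atTop (𝓝 0) := by
    have := hG.sqrt
    simpa [Real.sqrt_sq (norm_nonneg _)] using this
  have hwn : Tendsto (fun n => w t (s (φ n) t)) atTop (𝓝 (w t (m t))) :=
    (hw (t, m t) ⟨ht, hmm t⟩).tendsto.comp (tendsto_nhdsWithin_iff.2
      ⟨tendsto_const_nhds.prodMk_nhds hs,
        Eventually.of_forall fun n => ⟨ht, (hflow _).mem t ht⟩⟩)
  have hv : Tendsto (fun n => v (φ n) t) atTop (𝓝 (w t (m t))) := by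
    -- Strong convergence comes from uniform convexity: the distance to the critical point for `(t,
    -- s_n(t))` is at most `c⁻¹ ‖G‖`, which vanishes in the limit.
    have h4 : Tendsto (fun n => v (φ n) t - w t (s (φ n) t)) atTop (𝓝 0) := by
      refine squeeze_zero_norm (a := fun n => M.c⁻¹ * ‖M.G t (v (φ n) t) (s (φ n) t)‖)
        (fun n => ?_) (by simpa using hG'.const_mul M.c⁻¹)
      have := M.norm_sub_le_norm_grad_sub ht ((hflow (φ n)).mem t ht) (v (φ n) t)
        (w t (s (φ n) t))
      rw [hw0 t ht _ ((hflow _).mem t ht), sub_zero] at this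
      rwa [inv_mul_eq_div, le_div_iff₀' M.c_pos]
    simpa using h4.add hwn
  refine ⟨ht, leftModification_eq ht0 h3, hs, hv, ?_⟩
  have hSlim := tendsto_of_lip (f := M.S) (M.S_lip R) (fun _ => ht) (fun n => hR (φ n) t ht)
    (fun n => (hflow (φ n)).mem t ht) tendsto_const_nhds hv hs
  have hlim : Tendsto (fun n => lam (s (φ n) t)) atTop (𝓝 (lam (m t))) :=
    (hlam (m t) (hmm t)).tendsto.comp (tendsto_nhdsWithin_iff.2
      ⟨hs, Eventually.of_forall fun n => (hflow _).mem t ht⟩)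
  -- The limit of `(-S)⁺ λ` is zero, so at `m t` either `S ≥ 0` or `λ = 0`.
  have h5 := tendsto_nhds_unique hS ((hSlim.neg.max tendsto_const_nhds).mul hlim)
  rcases mul_eq_zero.1 h5.symm with h6 | h6
  · exact mul_nonneg (by simpa using h6) (hlam0 _ (hmm t))
  · rw [h6, mul_zero]

/-- The selected limit is controlled only at almost every time. Taking for `σ` its left-continuous
modification and for `v t` the critical point `w t (σ t)` gives equilibrium at every time, and left
continuity of `v` follows from that of `σ`. Stability and the energy inequality reach all times by
approximation with good times, as `S`, `lam` and `E` are continuous. -/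
theorem exists_evolution [CompleteSpace V] (hlam : LipschitzOnWith K lam (Icc M.a M.b))
    (hlam0 : ∀ σ ∈ Icc M.a M.b, 0 ≤ lam σ) (hlamb : lam M.b = 0) (u₀ : V) :
    ∃ v σ, M.IsEvolution lam u₀ v σ := by
  have hT := M.T_pos.le
  obtain ⟨R₀, hR₀⟩ := exists_flow (M := M) hlam hlam0 hlamb u₀
  -- Geometric parameters, so that the dissipations are summable.
  have hε : ∀ n : ℕ, (0 : ℝ) < (1 / 2) ^ n := fun n => by positivity
  choose vn sn hflow hbd using fun n : ℕ => hR₀ _ (hε n)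
  obtain ⟨w, R₁, C, hw, hwlip⟩ := M.exists_critical
  have hwc : ContinuousOn (fun x : ℝ × ℝ => w x.1 x.2) (Icc 0 M.T ×ˢ Icc M.a M.b) := by
    have : LipschitzOnWith (2 * |C|).toNNReal (fun x : ℝ × ℝ => w x.1 x.2)
        (Icc 0 M.T ×ˢ Icc M.a M.b) := by
      refine LipschitzOnWith.of_dist_le_mul fun x hx y hy => ?_
      rw [Real.coe_toNNReal _ (by positivity), dist_eq_norm, dist_eq_norm]
      refine (hwlip _ hx.1 _ hy.1 _ hx.2 _ hy.2).trans ?_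
      have h1 : |x.1 - y.1| ≤ ‖x - y‖ := norm_fst_le (x - y)
      have h2 : |x.2 - y.2| ≤ ‖x - y‖ := norm_snd_le (x - y)
      calc _ ≤ |C| * (‖x - y‖ + ‖x - y‖) := by gcongr; exact le_abs_self C
        _ = _ := by ring
    exact this.continuousOn
  obtain ⟨φ, m, hφ, hm, hmm, hgood⟩ := exists_limit_of_flows hlam.continuousOn hlam0 hε
    summable_geometric_two hflow hbd (fun t ht σ hσ => (hw t ht σ hσ).1) hwc
  set σ : ℝ → ℝ := leftModification m with hσdef
  set v : ℝ → V := fun t => w t (σ t) with hvdef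
  set R := max R₀ R₁ with hRdef
  have hmem : ∀ t ∈ Icc 0 M.T, σ t ∈ Icc M.a M.b := fun t ht => by
    obtain ⟨τ, h1, -, -, h2⟩ := hm.exists_seq_leftModification M.T_pos hgood ht
    refine isClosed_Icc.mem_of_tendsto h2 (Eventually.of_forall fun n => ?_)
    change σ (τ n) ∈ _
    rw [(h1 n).2.1]
    exact hmm (τ n)
  have hvR : ∀ t ∈ Icc 0 M.T, ‖v t‖ ≤ R := fun t ht =>
    ((hw t ht _ (hmem t ht)).2).trans (le_max_right _ _)
  have hnR : ∀ n, ∀ t ∈ Icc 0 M.T, ‖vn n t‖ ≤ R := fun n t ht => (hbd n t ht).trans (le_max_left _ _)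
  have hmono : MonotoneOn σ (Icc 0 M.T) :=
    hm.leftModification_monotoneOn.mono Icc_subset_Ici_self
  have hconv : ∀ t ∈ Icc 0 M.T, ∃ τ : ℕ → ℝ, (∀ n, τ n ∈ Icc 0 M.T) ∧ Tendsto τ atTop (𝓝 t) ∧
      (∀ n, Tendsto (fun k => sn (φ k) (τ n)) atTop (𝓝 (σ (τ n))) ∧
        Tendsto (fun k => vn (φ k) (τ n)) atTop (𝓝 (v (τ n))) ∧
        0 ≤ M.S (τ n) (v (τ n)) (σ (τ n)) * lam (σ (τ n))) ∧
      Tendsto (fun n => σ (τ n)) atTop (𝓝 (σ t)) ∧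
      Tendsto (fun n => v (τ n)) atTop (𝓝 (v t)) := fun t ht => by
    obtain ⟨τ, h1, h2, h3, h4⟩ := hm.exists_seq_leftModification M.T_pos hgood ht
    refine ⟨τ, h2, h3, fun n => ?_, h4, ?_⟩
    · obtain ⟨-, h5, h6⟩ := h1 n
      simp only [hvdef, h5]
      exact h6
    · exact (hwc (t, σ t) ⟨ht, hmem t ht⟩).tendsto.comp (tendsto_nhdsWithin_iff.2
        ⟨h3.prodMk_nhds h4, Eventually.of_forall fun n => ⟨h2 n, hmem _ (h2 n)⟩⟩)
  have hgood' : ∀ᵐ t ∂volume.restrict (Icc 0 M.T),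
      Tendsto (fun n => sn (φ n) t) atTop (𝓝 (σ t)) ∧
        Tendsto (fun n => vn (φ n) t) atTop (𝓝 (v t)) := by
    filter_upwards [hgood] with t ht
    simp only [hvdef, ht.2.1]
    exact ⟨ht.2.2.1, ht.2.2.2.1⟩
  have msn : ∀ n, AEStronglyMeasurable (sn n) (volume.restrict (Icc 0 M.T)) := fun n =>
    (hflow n).continuousOn_s.aestronglyMeasurable measurableSet_Icc
  have mvn : ∀ n, AEStronglyMeasurable (vn n) (volume.restrict (Icc 0 M.T)) := fun n =>
    (hflow n).continuousOn_v.aestronglyMeasurable measurableSet_Icc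
  have hint : IntegrableOn (fun τ => M.P τ (v τ) (σ τ)) (Icc 0 M.T) :=
    M.integrableOn_P hmem hvR
      (aestronglyMeasurable_of_tendsto_ae atTop (fun n => mvn (φ n)) (hgood'.mono fun t h => h.2))
      (aestronglyMeasurable_of_tendsto_ae atTop (fun n => msn (φ n)) (hgood'.mono fun t h => h.1))
  have hlimint : ∀ α ∈ Icc 0 M.T, ∀ β ∈ Icc 0 M.T, α ≤ β →
      Tendsto (fun n => ∫ t in α..β, M.P t (vn (φ n) t) (sn (φ n) t)) atTop
        (𝓝 (∫ t in α..β, M.P t (v t) (σ t))) := by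
    intro α hα β hβ hαβ
    have hsub : Ioc α β ⊆ Icc 0 M.T := Ioc_subset_Icc_self.trans (Icc_subset_Icc hα.1 hβ.2)
    obtain ⟨B, hB⟩ := M.P_bound R
    simp only [intervalIntegral.integral_of_le hαβ]
    refine tendsto_integral_filter_of_dominated_convergence (fun _ => B)
      (Eventually.of_forall fun n => ?_) (Eventually.of_forall fun n => ?_) ?_ ?_
    · exact (M.integrableOn_P (hflow (φ n)).mem (hnR _) (mvn _) (msn _)).1.mono_measure
        (Measure.restrict_mono_set _ hsub)
    · filter_upwards [ae_restrict_of_ae_restrict_of_subset hsub hB,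
        ae_restrict_mem measurableSet_Ioc] with t h1 h2
      exact h1 _ (hnR _ t (hsub h2)) _ ((hflow _).mem t (hsub h2))
    · exact integrable_const B
    · filter_upwards [ae_restrict_of_ae_restrict_of_subset hsub M.P_cont,
        ae_restrict_of_ae_restrict_of_subset hsub hgood', ae_restrict_mem measurableSet_Ioc]
        with t h1 h2 h3
      exact (h1 (v t, σ t) ⟨mem_univ _, hmem t (hsub h3)⟩).tendsto.comp
        (tendsto_nhdsWithin_iff.2 ⟨h2.2.prodMk_nhds h2.1,
          Eventually.of_forall fun n => ⟨mem_univ _, (hflow _).mem t (hsub h3)⟩⟩)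
  refine ⟨v, σ, hmem, fun t ht => ?_, fun t ht => (hw t ht _ (hmem t ht)).1, fun t ht => ?_, hmono,
    hint, ?_, fun n => (1 / 2) ^ φ n, fun n => vn (φ n), fun n => sn (φ n), fun n => hε _, ?_,
    fun n => hflow _, hgood'⟩
  · have hσc : ContinuousWithinAt σ (Icc 0 t) t := by
      rcases ht.1.eq_or_lt with rfl | h0
      · rw [Icc_self]; exact continuousWithinAt_singleton
      · exact (hm.leftModification_continuousWithinAt h0).mono Icc_subset_Iic_self
    refine ⟨?_, hσc⟩
    have : MapsTo (fun x => (x, σ x)) (Icc 0 t) (Icc 0 M.T ×ˢ Icc M.a M.b) := fun x hx =>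
      have hx' : x ∈ Icc 0 M.T := ⟨hx.1, hx.2.trans ht.2⟩
      ⟨hx', hmem x hx'⟩
    exact ContinuousWithinAt.comp (f := fun x => (x, σ x)) (x := t)
      (hwc (t, σ t) ⟨ht, hmem t ht⟩) (continuousWithinAt_id.prodMk hσc) this
  · obtain ⟨τ, h1, h2, h3, h4, h5⟩ := hconv t ht
    have hlim : Tendsto (fun n => lam (σ (τ n))) atTop (𝓝 (lam (σ t))) :=
      (hlam.continuousOn (σ t) (hmem t ht)).tendsto.comp (tendsto_nhdsWithin_iff.2
        ⟨h4, Eventually.of_forall fun n => hmem _ (h1 n)⟩)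
    exact ge_of_tendsto' ((tendsto_of_lip (f := M.S) (M.S_lip R) h1 (fun n => hvR _ (h1 n))
      (fun n => hmem _ (h1 n)) h2 h5 h4).mul hlim) fun n => (h3 n).2.2
  · intro α β h0 hαβ hβT
    obtain ⟨x, x1, x2, x3, x4, x5⟩ := hconv α ⟨h0, hαβ.le.trans hβT⟩
    obtain ⟨y, y1, y2, y3, y4, y5⟩ := hconv β ⟨h0.trans hαβ.le, hβT⟩
    -- Between good times the inequality for the flows passes to the limit by dominated convergence;
    -- the dissipated energy is nonnegative and is discarded.
    have key : ∀ n, x n ≤ y n → M.E (y n) (v (y n)) (σ (y n)) ≤ M.E (x n) (v (x n)) (σ (x n))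
        + ∫ τ in (x n)..(y n), M.P τ (v τ) (σ τ) := fun n hn => by
      refine le_of_tendsto_of_tendsto'
        (tendsto_of_lip (f := M.E) (M.E_lip R) (fun _ => y1 n) (fun k => hnR (φ k) _ (y1 n))
          (fun k => (hflow (φ k)).mem _ (y1 n)) tendsto_const_nhds (y3 n).2.1 (y3 n).1)
        ((tendsto_of_lip (f := M.E) (M.E_lip R) (fun _ => x1 n) (fun k => hnR (φ k) _ (x1 n))
          (fun k => (hflow (φ k)).mem _ (x1 n)) tendsto_const_nhds (x3 n).2.1 (x3 n).1).add
          (hlimint _ (x1 n) _ (y1 n) hn)) fun k => ?_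
      have := (hflow (φ k)).energy (hε _) hlam.continuousOn hlam0 (hnR _) (x1 n) (y1 n) hn
      refine le_trans (le_add_of_nonneg_right (mul_nonneg (inv_nonneg.2 (hε _).le) ?_)) this
      exact intervalIntegral.integral_nonneg hn fun _ _ => sq_nonneg _
    have hint' : IntervalIntegrable (fun τ => M.P τ (v τ) (σ τ)) volume 0 M.T :=
      (intervalIntegrable_iff_integrableOn_Icc_of_le hT).2 hint
    have hprim : ContinuousOn (fun z => ∫ τ in (0 : ℝ)..z, M.P τ (v τ) (σ τ)) (Icc 0 M.T) := by
      have := intervalIntegral.continuousOn_primitive_interval (a := 0) (b := M.T)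
        (f := fun τ => M.P τ (v τ) (σ τ)) (μ := volume) (by rwa [uIcc_of_le hT])
      rwa [uIcc_of_le hT] at this
    have hsubint : ∀ z ∈ Icc 0 M.T, IntervalIntegrable (fun τ => M.P τ (v τ) (σ τ)) volume 0 z :=
      fun z hz => hint'.mono_set (by
        rw [uIcc_of_le hz.1, uIcc_of_le hT]; exact Icc_subset_Icc_right hz.2)
    have hI : ∀ x ∈ Icc 0 M.T, ∀ y ∈ Icc 0 M.T, ∫ τ in x..y, M.P τ (v τ) (σ τ)
        = (∫ τ in (0 : ℝ)..y, M.P τ (v τ) (σ τ)) - ∫ τ in (0 : ℝ)..x, M.P τ (v τ) (σ τ) :=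
      fun x hx y hy => (intervalIntegral.integral_interval_sub_left (hsubint y hy)
        (hsubint x hx)).symm
    have hα : α ∈ Icc 0 M.T := ⟨h0, hαβ.le.trans hβT⟩
    have hβ : β ∈ Icc 0 M.T := ⟨h0.trans hαβ.le, hβT⟩
    have hlim : Tendsto (fun n => ∫ τ in (x n)..(y n), M.P τ (v τ) (σ τ)) atTop
        (𝓝 (∫ τ in α..β, M.P τ (v τ) (σ τ))) := by
      rw [hI α hα β hβ]
      simp only [hI _ (x1 _) _ (y1 _)]
      exact ((hprim β hβ).tendsto.comp (tendsto_nhdsWithin_iff.2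
          ⟨y2, Eventually.of_forall y1⟩)).sub
        ((hprim α hα).tendsto.comp (tendsto_nhdsWithin_iff.2 ⟨x2, Eventually.of_forall x1⟩))
    -- For arbitrary endpoints, approach each by good times. As `α < β`, these are eventually in the
    -- right order, and the primitive of the power is continuous.
    refine le_of_tendsto_of_tendsto
      (tendsto_of_lip (f := M.E) (M.E_lip R) y1 (fun n => hvR _ (y1 n)) (fun n => hmem _ (y1 n)) y2 y5 y4)
      ((tendsto_of_lip (f := M.E) (M.E_lip R) x1 (fun n => hvR _ (x1 n)) (fun n => hmem _ (x1 n)) x2 x5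
        x4).add hlim) ?_
    filter_upwards [x2.eventually_lt y2 hαβ] with n hn using key n hn.le
  · exact (tendsto_pow_atTop_nhds_zero_of_lt_one (by norm_num) (by norm_num)).comp hφ.tendsto_atTop

end EnergySystem

/-! ### Lipschitz loads -/

/-- `f` is a bounded Lipschitz function on `[0,T]` with almost everywhere derivative `f'`. -/
structure IsLipLoad {X : Type*} [NormedAddCommGroup X] [NormedSpace ℝ X] (T : ℝ) (f f' : ℝ → X) :
    Prop where
  bound : ∃ C, 0 ≤ C ∧ (∀ t ∈ Icc 0 T, ‖f t‖ ≤ C) ∧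
    (∀ t ∈ Icc 0 T, ∀ t' ∈ Icc 0 T, ‖f t - f t'‖ ≤ C * |t - t'|) ∧
    ∀ᵐ t ∂volume.restrict (Icc 0 T), ‖f' t‖ ≤ C
  meas : AEStronglyMeasurable f' (volume.restrict (Icc 0 T))
  deriv : ∀ᵐ t ∂volume.restrict (Icc 0 T), HasDerivWithinAt f (f' t) (Icc 0 T) t

section Load

variable {X : Type*} [NormedAddCommGroup X] [NormedSpace ℝ X] {T : ℝ} {f f' : ℝ → X}

lemma IsLipLoad.continuousOn (h : IsLipLoad T f f') : ContinuousOn f (Icc 0 T) := by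
  obtain ⟨C, hC, -, h2, -⟩ := h.bound
  have : LipschitzOnWith ⟨C, hC⟩ f (Icc 0 T) := LipschitzOnWith.of_dist_le_mul fun t ht t' ht' => by
    rw [dist_eq_norm, Real.dist_eq]; exact h2 t ht t' ht'
  exact this.continuousOn

lemma IsLipLoad.clm {Y : Type*} [NormedAddCommGroup Y] [NormedSpace ℝ Y] (h : IsLipLoad T f f')
    (L : X →L[ℝ] Y) : IsLipLoad T (fun t => L (f t)) (fun t => L (f' t)) := by
  obtain ⟨C, hC, h1, h2, h3⟩ := h.bound
  refine ⟨⟨‖L‖ * C, by positivity, fun t ht => L.le_opNorm_of_le (h1 t ht), fun t ht t' ht' => ?_,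
    h3.mono fun t ht => L.le_opNorm_of_le ht⟩, L.continuous.comp_aestronglyMeasurable h.meas,
    h.deriv.mono fun t ht => L.hasFDerivAt.comp_hasDerivWithinAt t ht⟩
  rw [← map_sub, mul_assoc]
  exact L.le_opNorm_of_le (h2 t ht t' ht')

/-- A primitive of an essentially bounded function is Lipschitz with the essential supremum as
constant, and Lebesgue differentiation recovers the integrand almost everywhere. -/
lemma MemW1Infty.exists_isLipLoad [CompleteSpace X] (hT : 0 ≤ T) (h : MemW1Infty T f) :
    ∃ f', IsLipLoad T f f' := by
  obtain ⟨f', hf', hf⟩ := h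
  have hint : IntervalIntegrable f' volume 0 T :=
    (intervalIntegrable_iff_integrableOn_Ioc_of_le hT).2 (hf'.integrable le_top)
  have hsub : ∀ t ∈ Icc 0 T, IntervalIntegrable f' volume 0 t := fun t ht =>
    hint.mono_set (by rw [uIcc_of_le ht.1, uIcc_of_le hT]; exact Icc_subset_Icc_right ht.2)
  set B := (eLpNorm f' ⊤ (volume.restrict (Ioc 0 T))).toReal with hB
  have hB0 : 0 ≤ B := ENNReal.toReal_nonneg
  have hae : ∀ᵐ t ∂volume.restrict (Ioc 0 T), ‖f' t‖ ≤ B := by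
    filter_upwards [ae_le_eLpNormEssSup (f := f') (μ := volume.restrict (Ioc 0 T))] with t ht
    rw [← eLpNorm_exponent_top] at ht
    rw [hB, ← toReal_enorm]
    exact ENNReal.toReal_mono hf'.2.ne ht
  have hlip : ∀ t ∈ Icc 0 T, ∀ t' ∈ Icc 0 T, ‖f t - f t'‖ ≤ B * |t - t'| := fun t ht t' ht' => by
    rw [hf t ht, hf t' ht', add_sub_add_left_eq_sub,
      intervalIntegral.integral_interval_sub_left (hsub t ht) (hsub t' ht')]
    refine intervalIntegral.norm_integral_le_of_norm_le_const_ae ?_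
    filter_upwards [(ae_restrict_iff' measurableSet_Ioc).1 hae] with s hs hm
    refine hs ⟨?_, ?_⟩
    · exact lt_of_le_of_lt (le_min ht'.1 ht.1) hm.1
    · exact hm.2.trans (max_le ht'.2 ht.2)
  have h0 : (0 : ℝ) ∈ Icc 0 T := left_mem_Icc.2 hT
  refine ⟨f', ⟨⟨‖f 0‖ + B * T + B, by positivity, fun t ht => ?_, fun t ht t' ht' => ?_, ?_⟩,
    ?_, ?_⟩⟩
  · have h1 := hlip t ht 0 h0
    rw [sub_zero, abs_of_nonneg ht.1] at h1
    have h2 : B * t ≤ B * T := by gcongr; exact ht.2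
    linarith [norm_le_norm_add_norm_sub' (f t) (f 0)]
  · refine (hlip t ht t' ht').trans ?_
    gcongr
    have : 0 ≤ ‖f 0‖ + B * T := by positivity
    linarith
  · rw [← restrict_Ioc_eq_restrict_Icc]
    filter_upwards [hae] with t ht
    have : 0 ≤ ‖f 0‖ + B * T := by positivity
    linarith
  · rw [← restrict_Ioc_eq_restrict_Icc]
    exact hf'.1
  · rw [ae_restrict_iff' measurableSet_Icc]
    filter_upwards [hint.ae_hasDerivAt_integral] with t ht hm
    have h1 := (ht (by rwa [uIcc_of_le hT]) 0 (by rwa [uIcc_of_le hT])).hasDerivWithinAt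
      (s := Icc 0 T)
    exact (h1.const_add (f 0)).congr hf (hf t hm)

end Load

/-! ### Bounded Lipschitz functions on a set -/

/-- `f` is bounded and Lipschitz on `S`. -/
def BddLipOn {Y F : Type*} [SeminormedAddCommGroup Y] [SeminormedAddCommGroup F] (S : Set Y)
    (f : Y → F) : Prop :=
  ∃ C, 0 ≤ C ∧ (∀ x ∈ S, ‖f x‖ ≤ C) ∧ ∀ x ∈ S, ∀ y ∈ S, ‖f x - f y‖ ≤ C * ‖x - y‖

namespace BddLipOn

variable {Y F G H : Type*} [SeminormedAddCommGroup Y] [NormedAddCommGroup F] [NormedSpace ℝ F]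
  [NormedAddCommGroup G] [NormedSpace ℝ G] [NormedAddCommGroup H] [NormedSpace ℝ H]
  {S : Set Y} {f : Y → F} {g : Y → G}

omit [NormedSpace ℝ F] in
lemma const (c : F) : BddLipOn S fun _ => c :=
  ⟨‖c‖, norm_nonneg _, fun _ _ => le_rfl, fun x _ y _ => by rw [sub_self, norm_zero]; positivity⟩

omit [NormedSpace ℝ F] in
lemma add {f' : Y → F} (hf : BddLipOn S f) (hf' : BddLipOn S f') :
    BddLipOn S fun x => f x + f' x := by
  obtain ⟨C, hC, h1, h2⟩ := hf
  obtain ⟨C', hC', h1', h2'⟩ := hf'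
  refine ⟨C + C', by positivity, fun x hx => (norm_add_le _ _).trans (add_le_add (h1 x hx)
    (h1' x hx)), fun x hx y hy => ?_⟩
  rw [add_sub_add_comm, add_mul]
  exact (norm_add_le _ _).trans (add_le_add (h2 x hx y hy) (h2' x hx y hy))

lemma clm (hf : BddLipOn S f) (L : F →L[ℝ] G) : BddLipOn S fun x => L (f x) := by
  obtain ⟨C, hC, h1, h2⟩ := hf
  refine ⟨‖L‖ * C, by positivity, fun x hx => L.le_opNorm_of_le (h1 x hx), fun x hx y hy => ?_⟩
  rw [← map_sub, mul_assoc]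
  exact L.le_opNorm_of_le (h2 x hx y hy)

lemma sub {f' : Y → F} (hf : BddLipOn S f) (hf' : BddLipOn S f') :
    BddLipOn S fun x => f x - f' x := by
  have := hf.add (hf'.clm (-ContinuousLinearMap.id ℝ F))
  simpa [sub_eq_add_neg] using this

/-- The difference of products is split as `B (f x - f y) (g x) + B (f y) (g x - g y)`. This is why
boundedness is carried along with the Lipschitz property. -/
lemma bilin (hf : BddLipOn S f) (hg : BddLipOn S g) (B : F →L[ℝ] G →L[ℝ] H) :
    BddLipOn S fun x => B (f x) (g x) := by
  obtain ⟨C, hC, h1, h2⟩ := hf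
  obtain ⟨C', hC', h1', h2'⟩ := hg
  have hB : ∀ a b p q, ‖a‖ ≤ p → ‖b‖ ≤ q → 0 ≤ p → 0 ≤ q → ‖B a b‖ ≤ ‖B‖ * (p * q) :=
    fun a b p q ha hb hp hq => (B.le_opNorm₂ a b).trans (by rw [mul_assoc]; gcongr)
  refine ⟨‖B‖ * (2 * (C * C')), by positivity, fun x hx => ?_, fun x hx y hy => ?_⟩
  · refine (hB _ _ _ _ (h1 x hx) (h1' x hx) hC hC').trans ?_
    refine mul_le_mul_of_nonneg_left ?_ B.opNorm_nonneg
    linarith [mul_nonneg hC hC']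
  · have e : B (f x) (g x) - B (f y) (g y) = B (f x - f y) (g x) + B (f y) (g x - g y) := by
      simp
    rw [e]
    refine (norm_add_le _ _).trans ((add_le_add
      (hB _ _ _ _ (h2 x hx y hy) (h1' x hx) (by positivity) hC')
      (hB _ _ _ _ (h1 y hy) (h2' x hx y hy) hC (by positivity))).trans (le_of_eq ?_))
    ring

lemma inner {F : Type*} [NormedAddCommGroup F] [InnerProductSpace ℝ F] {f f' : Y → F}
    (hf : BddLipOn S f) (hf' : BddLipOn S f') : BddLipOn S fun x => inner ℝ (f x) (f' x) :=
  hf.bilin hf' (innerSL ℝ)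

lemma apply {f : Y → F →L[ℝ] G} {f' : Y → F} (hf : BddLipOn S f) (hf' : BddLipOn S f') :
    BddLipOn S fun x => f x (f' x) :=
  hf.bilin hf' (ContinuousLinearMap.id ℝ (F →L[ℝ] G))

omit [NormedSpace ℝ F] in
lemma comp {Z : Type*} [SeminormedAddCommGroup Z] {S' : Set Z} {h : Z → Y} (hf : BddLipOn S f)
    (hm : MapsTo h S' S) (hh : ∀ x ∈ S', ∀ y ∈ S', ‖h x - h y‖ ≤ ‖x - y‖) :
    BddLipOn S' fun x => f (h x) := by
  obtain ⟨C, hC, h1, h2⟩ := hf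
  exact ⟨C, hC, fun x hx => h1 _ (hm hx), fun x hx y hy => (h2 _ (hm hx) _ (hm hy)).trans
    (by gcongr; exact hh x hx y hy)⟩

lemma of_contDiffOn {a b : ℝ} {f : ℝ → F} (hab : a < b) (hf : ContDiffOn ℝ 1 f (Icc a b)) :
    BddLipOn (Icc a b) f := by
  obtain ⟨C₁, h1⟩ := isCompact_Icc.exists_bound_of_continuousOn hf.continuousOn
  obtain ⟨C₂, h2⟩ := isCompact_Icc.exists_bound_of_continuousOn
    (hf.continuousOn_derivWithin (uniqueDiffOn_Icc hab) le_rfl)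
  have ha : a ∈ Icc a b := left_mem_Icc.2 hab.le
  refine ⟨max C₁ C₂, (norm_nonneg _).trans ((h1 a ha).trans (le_max_left _ _)),
    fun x hx => (h1 x hx).trans (le_max_left _ _), fun x hx y hy => ?_⟩
  exact (convex_Icc a b).norm_image_sub_le_of_norm_derivWithin_le
    (hf.differentiableOn one_ne_zero) (fun z hz => (h2 z hz).trans (le_max_right _ _)) hy hx

end BddLipOn

lemma IsLipLoad.bddLipOn {X : Type*} [NormedAddCommGroup X] [NormedSpace ℝ X] {T : ℝ}
    {f f' : ℝ → X} (h : IsLipLoad T f f') : BddLipOn (Icc 0 T) f := by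
  obtain ⟨C, hC, h1, h2, -⟩ := h.bound
  exact ⟨C, hC, h1, h2⟩

/-! ### Quadratic energies -/

/-- The data of the energy
`(𝒜(σ)(Dv + p(t)) | Dv + p(t)) + σ - (g(t) | Tr v + k(t))`. -/
structure QuadraticData (V W X : Type*) [NormedAddCommGroup V] [InnerProductSpace ℝ V]
    [NormedAddCommGroup W] [InnerProductSpace ℝ W] [NormedAddCommGroup X]
    [InnerProductSpace ℝ X] where
  T : ℝ
  a : ℝ
  b : ℝ
  T_pos : 0 < T
  a_lt_b : a < b
  D : V →L[ℝ] W
  norm_D : ∀ v, ‖D v‖ = ‖v‖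
  Tr : V →L[ℝ] X
  A : ℝ → W →L[ℝ] W
  A_contDiff : ContDiffOn ℝ 2 A (Icc a b)
  A_symm : ∀ σ ∈ Icc a b, ∀ ξ η, inner ℝ (A σ ξ) η = inner ℝ ξ (A σ η)
  c : ℝ
  c_pos : 0 < c
  A_coercive : ∀ σ ∈ Icc a b, ∀ ξ, c * ‖ξ‖ ^ 2 ≤ inner ℝ (A σ ξ) ξ
  p : ℝ → W
  p' : ℝ → W
  p_load : IsLipLoad T p p'
  g : ℝ → X
  g' : ℝ → X
  g_load : IsLipLoad T g g'
  k : ℝ → X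
  k' : ℝ → X
  k_load : IsLipLoad T k k'

namespace QuadraticData

variable {V W X : Type*} [NormedAddCommGroup V] [InnerProductSpace ℝ V]
  [NormedAddCommGroup W] [InnerProductSpace ℝ W] [NormedAddCommGroup X] [InnerProductSpace ℝ X]
  (Q : QuadraticData V W X)

/-- The energy. -/
def energy (t : ℝ) (v : V) (σ : ℝ) : ℝ :=
  inner ℝ (Q.A σ (Q.D v + Q.p t)) (Q.D v + Q.p t) + σ - inner ℝ (Q.g t) (Q.Tr v + Q.k t)

/-- The derivative of `A`. -/
def A' (σ : ℝ) : W →L[ℝ] W := derivWithin Q.A (Icc Q.a Q.b) σ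

/-- The derivative of the energy with respect to `σ`. -/
def slope (t : ℝ) (v : V) (σ : ℝ) : ℝ :=
  inner ℝ (Q.A' σ (Q.D v + Q.p t)) (Q.D v + Q.p t) + 1

/-- The derivative of the energy with respect to `t`. -/
def power (t : ℝ) (v : V) (σ : ℝ) : ℝ :=
  2 * inner ℝ (Q.A σ (Q.D v + Q.p t)) (Q.p' t) - inner ℝ (Q.g' t) (Q.Tr v + Q.k t)
    - inner ℝ (Q.g t) (Q.k' t)

lemma hasDerivWithinAt_A {σ : ℝ} (hσ : σ ∈ Icc Q.a Q.b) :
    HasDerivWithinAt Q.A (Q.A' σ) (Icc Q.a Q.b) σ :=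
  (Q.A_contDiff.differentiableOn two_ne_zero σ hσ).hasDerivWithinAt

lemma hasDerivWithinAt_slope {t σ : ℝ} (v : V) (hσ : σ ∈ Icc Q.a Q.b) :
    HasDerivWithinAt (fun s => Q.energy t v s) (Q.slope t v σ) (Icc Q.a Q.b) σ := by
  have h1 := ((Q.hasDerivWithinAt_A hσ).clm_apply
    (hasDerivWithinAt_const σ _ (Q.D v + Q.p t))).inner ℝ
    (hasDerivWithinAt_const σ _ (Q.D v + Q.p t))
  refine ((h1.add (hasDerivWithinAt_id σ _)).sub_const _).congr_deriv ?_
  simp [slope]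

lemma A_bddLipOn : BddLipOn (Icc Q.a Q.b) Q.A :=
  BddLipOn.of_contDiffOn Q.a_lt_b (Q.A_contDiff.of_le one_le_two)

/-- Here the class `C²` in `σ` is used: `A'` is `C¹` on a compact interval, hence Lipschitz, and the
right-hand side of the equation for `σ` is Lipschitz as Picard–Lindelöf requires. -/
lemma A'_bddLipOn : BddLipOn (Icc Q.a Q.b) Q.A' :=
  BddLipOn.of_contDiffOn Q.a_lt_b
    (Q.A_contDiff.derivWithin (uniqueDiffOn_Icc Q.a_lt_b) (by norm_num))

/-- The bounded sets on which the energy is Lipschitz. -/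
def box (R : ℝ) : Set (ℝ × V × ℝ) :=
  Icc 0 Q.T ×ˢ Metric.closedBall 0 R ×ˢ Icc Q.a Q.b

variable {Q} in
lemma bddLipOn_time {F : Type*} [NormedAddCommGroup F] [NormedSpace ℝ F] {f : ℝ → F}
    (h : BddLipOn (Icc 0 Q.T) f) (R : ℝ) : BddLipOn (Q.box R) fun x => f x.1 :=
  h.comp (fun _ hx => hx.1) fun x _ y _ => norm_fst_le (x - y)

variable {Q} in
lemma bddLipOn_length {F : Type*} [NormedAddCommGroup F] [NormedSpace ℝ F] {f : ℝ → F}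
    (h : BddLipOn (Icc Q.a Q.b) f) (R : ℝ) : BddLipOn (Q.box R) fun x => f x.2.2 :=
  h.comp (fun _ hx => hx.2.2) fun x _ y _ =>
    (norm_snd_le (x - y).2).trans (norm_snd_le (x - y))

lemma bddLipOn_state (R : ℝ) : BddLipOn (Q.box R) fun x => x.2.1 :=
  ⟨max 1 R, by positivity, fun x hx => (mem_closedBall_zero_iff.1 hx.2.1).trans (le_max_right _ _),
    fun x _ y _ => by
      refine ((norm_fst_le (x - y).2).trans (norm_snd_le (x - y))).trans ?_
      exact le_mul_of_one_le_left (norm_nonneg _) (le_max_left _ _)⟩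

lemma bddLipOn_strain (R : ℝ) : BddLipOn (Q.box R) fun x => Q.D x.2.1 + Q.p x.1 :=
  ((Q.bddLipOn_state R).clm Q.D).add (bddLipOn_time Q.p_load.bddLipOn R)

variable {Q} in
lemma lip_of_bddLipOn {F : Type*} [NormedAddCommGroup F] {f : ℝ → V → ℝ → F} {R : ℝ}
    (h : BddLipOn (Q.box R) fun x => f x.1 x.2.1 x.2.2) :
    ∃ C, ∀ t ∈ Icc 0 Q.T, ∀ t' ∈ Icc 0 Q.T, ∀ v, ‖v‖ ≤ R → ∀ v', ‖v'‖ ≤ R →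
      ∀ σ ∈ Icc Q.a Q.b, ∀ σ' ∈ Icc Q.a Q.b,
        ‖f t v σ - f t' v' σ'‖ ≤ C * (|t - t'| + ‖v - v'‖ + |σ - σ'|) := by
  obtain ⟨C, hC, -, h2⟩ := h
  refine ⟨C, fun t ht t' ht' v hv v' hv' σ hσ σ' hσ' => ?_⟩
  refine (h2 (t, v, σ) ⟨ht, mem_closedBall_zero_iff.2 hv, hσ⟩ (t', v', σ')
    ⟨ht', mem_closedBall_zero_iff.2 hv', hσ'⟩).trans ?_
  gcongr
  rw [Prod.mk_sub_mk, Prod.mk_sub_mk, Prod.norm_def, Prod.norm_def]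
  simp only [Real.norm_eq_abs]
  have := abs_nonneg (t - t'); have := norm_nonneg (v - v'); have := abs_nonneg (σ - σ')
  exact max_le (by linarith) (max_le (by linarith) (by linarith))

lemma energy_lip (R : ℝ) : BddLipOn (Q.box R) fun x => Q.energy x.1 x.2.1 x.2.2 := by
  have h1 := ((bddLipOn_length Q.A_bddLipOn R).apply (Q.bddLipOn_strain R)).inner
    (Q.bddLipOn_strain R)
  have h2 : BddLipOn (Q.box R) fun x => x.2.2 :=
    bddLipOn_length (f := fun s => s)
      (BddLipOn.of_contDiffOn Q.a_lt_b contDiffOn_id) R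
  have h3 := (bddLipOn_time Q.g_load.bddLipOn R).inner
    (((Q.bddLipOn_state R).clm Q.Tr).add (bddLipOn_time Q.k_load.bddLipOn R))
  exact (h1.add h2).sub h3

lemma slope_lip (R : ℝ) : BddLipOn (Q.box R) fun x => Q.slope x.1 x.2.1 x.2.2 :=
  (((bddLipOn_length Q.A'_bddLipOn R).apply (Q.bddLipOn_strain R)).inner
    (Q.bddLipOn_strain R)).add (BddLipOn.const 1)

lemma power_bound (R : ℝ) : ∃ C, ∀ᵐ t ∂volume.restrict (Icc 0 Q.T), ∀ v, ‖v‖ ≤ R →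
    ∀ σ ∈ Icc Q.a Q.b, |Q.power t v σ| ≤ C := by
  obtain ⟨C₁, hC₁, h1, -⟩ := (bddLipOn_length Q.A_bddLipOn R).apply (Q.bddLipOn_strain R)
  obtain ⟨C₂, hC₂, h2, -⟩ := ((Q.bddLipOn_state R).clm Q.Tr).add
    (bddLipOn_time Q.k_load.bddLipOn R)
  obtain ⟨Cp, hCp, -, -, hp⟩ := Q.p_load.bound
  obtain ⟨Cg, hCg, hg, -, hg'⟩ := Q.g_load.bound
  obtain ⟨Ck, hCk, -, -, hk⟩ := Q.k_load.bound
  refine ⟨2 * (C₁ * Cp) + Cg * C₂ + Cg * Ck, ?_⟩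
  filter_upwards [hp, hg', hk, ae_restrict_mem measurableSet_Icc] with t h3 h4 h5 ht v hv σ hσ
  have hx : (t, v, σ) ∈ Q.box R := ⟨ht, mem_closedBall_zero_iff.2 hv, hσ⟩
  have e1 := (abs_real_inner_le_norm (Q.A σ (Q.D v + Q.p t)) (Q.p' t)).trans
    (mul_le_mul (h1 _ hx) h3 (norm_nonneg _) hC₁)
  have e2 := (abs_real_inner_le_norm (Q.g' t) (Q.Tr v + Q.k t)).trans
    (mul_le_mul h4 (h2 _ hx) (norm_nonneg _) hCg)
  have e3 := (abs_real_inner_le_norm (Q.g t) (Q.k' t)).trans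
    (mul_le_mul (hg t ht) h5 (norm_nonneg _) hCg)
  rw [abs_le] at e1 e2 e3 ⊢
  rw [power]
  constructor <;> linarith [e1.1, e1.2, e2.1, e2.2, e3.1, e3.2]

lemma power_continuousOn (t : ℝ) :
    ContinuousOn (fun x : V × ℝ => Q.power t x.1 x.2) (univ ×ˢ Icc Q.a Q.b) := by
  have h1 : ContinuousOn (fun x : V × ℝ => Q.A x.2) (univ ×ˢ Icc Q.a Q.b) :=
    Q.A_contDiff.continuousOn.comp continuousOn_snd fun x hx => hx.2
  have h2 : Continuous fun x : V × ℝ => Q.D x.1 + Q.p t := by fun_prop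
  have h3 : Continuous fun x : V × ℝ => Q.Tr x.1 + Q.k t := by fun_prop
  exact ((((h1.clm_apply h2.continuousOn).inner continuousOn_const).const_smul (2 : ℝ)).sub
    (continuousOn_const.inner h3.continuousOn)).sub continuousOn_const

lemma power_aestronglyMeasurable (v : ℝ → V) (s : ℝ → ℝ) (hs : ∀ t ∈ Icc 0 Q.T, s t ∈ Icc Q.a Q.b)
    (mv : AEStronglyMeasurable v (volume.restrict (Icc 0 Q.T)))
    (ms : AEStronglyMeasurable s (volume.restrict (Icc 0 Q.T))) :
    AEStronglyMeasurable (fun t => Q.power t (v t) (s t)) (volume.restrict (Icc 0 Q.T)) := by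
  have mA : AEStronglyMeasurable (fun t => Q.A (s t)) (volume.restrict (Icc 0 Q.T)) := by
    have h1 : Continuous (IccExtend Q.a_lt_b.le ((Icc Q.a Q.b).domRestrict Q.A)) :=
      (continuousOn_iff_continuous_domRestrict.1 Q.A_contDiff.continuousOn).Icc_extend'
    refine (h1.comp_aestronglyMeasurable ms).congr ?_
    filter_upwards [ae_restrict_mem measurableSet_Icc] with t ht
    exact IccExtend_of_mem _ _ (hs t ht)
  have mp := Q.p_load.continuousOn.aestronglyMeasurable (μ := volume) measurableSet_Icc
  have mk := Q.k_load.continuousOn.aestronglyMeasurable (μ := volume) measurableSet_Icc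
  have mg := Q.g_load.continuousOn.aestronglyMeasurable (μ := volume) measurableSet_Icc
  have mξ := (Q.D.continuous.comp_aestronglyMeasurable mv).add mp
  have mAξ := (ContinuousLinearMap.id ℝ (W →L[ℝ] W)).aestronglyMeasurable_comp₂ mA mξ
  have mTr := (Q.Tr.continuous.comp_aestronglyMeasurable mv).add mk
  exact (((mAξ.inner Q.p_load.meas).const_mul 2).sub (Q.g_load.meas.inner mTr)).sub
    (mg.inner Q.k_load.meas)

variable [CompleteSpace V] [CompleteSpace W] [CompleteSpace X]

/-- The gradient of the energy with respect to `v`. -/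
def gradient (t : ℝ) (v : V) (σ : ℝ) : V :=
  (2 : ℝ) • ContinuousLinearMap.adjoint Q.D (Q.A σ (Q.D v + Q.p t))
    - ContinuousLinearMap.adjoint Q.Tr (Q.g t)

lemma inner_gradient (t : ℝ) (v : V) (σ : ℝ) (h : V) : inner ℝ (Q.gradient t v σ) h
    = 2 * inner ℝ (Q.A σ (Q.D v + Q.p t)) (Q.D h) - inner ℝ (Q.g t) (Q.Tr h) := by
  rw [gradient, inner_sub_left, real_inner_smul_left, ContinuousLinearMap.adjoint_inner_left,
    ContinuousLinearMap.adjoint_inner_left]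

/-- Symmetry of `A σ` makes the two terms of the product rule equal, whence the factor 2 in the
gradient. -/
lemma hasFDerivAt_gradient {t σ : ℝ} (v : V) (hσ : σ ∈ Icc Q.a Q.b) :
    HasFDerivAt (fun w => Q.energy t w σ) (innerSL ℝ (Q.gradient t v σ)) v := by
  have hξ : HasFDerivAt (fun w => Q.D w + Q.p t) Q.D v := Q.D.hasFDerivAt.add_const _
  have hTr : HasFDerivAt (fun w => Q.Tr w + Q.k t) Q.Tr v := Q.Tr.hasFDerivAt.add_const _
  have h1 := ((Q.A σ).hasFDerivAt.comp v hξ).inner ℝ hξ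
  have h2 := (hasFDerivAt_const (Q.g t) v).inner ℝ hTr
  refine ((h1.add_const σ).sub h2).congr_fderiv ?_
  ext h
  rw [innerSL_apply_apply, Q.inner_gradient]
  simp only [fderivInnerCLM_apply, sub_apply, ContinuousLinearMap.comp_apply,
    ContinuousLinearMap.prod_apply, Function.comp_apply, zero_apply,
    inner_zero_left, add_zero, Q.A_symm σ hσ (Q.D h)]
  rw [real_inner_comm (Q.A σ (Q.D v + Q.p t)) (Q.D h), two_mul]

lemma gradient_lip (R : ℝ) : BddLipOn (Q.box R) fun x => Q.gradient x.1 x.2.1 x.2.2 :=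
  ((((bddLipOn_length Q.A_bddLipOn R).apply (Q.bddLipOn_strain R)).clm
    (ContinuousLinearMap.adjoint Q.D)).clm ((2 : ℝ) • ContinuousLinearMap.id ℝ V)).sub
    ((bddLipOn_time Q.g_load.bddLipOn R).clm (ContinuousLinearMap.adjoint Q.Tr))

/-- The gradient is affine in `v` with linear part twice the form of `A σ` pulled back by `D`, and
`D` preserves norms, so coercivity carries over with constant `2 c`. -/
lemma gradient_monotone (t : ℝ) {σ : ℝ} (hσ : σ ∈ Icc Q.a Q.b) (v v' : V) :
    2 * Q.c * ‖v - v'‖ ^ 2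
      ≤ inner ℝ (Q.gradient t v σ - Q.gradient t v' σ) (v - v') := by
  have e : inner ℝ (Q.gradient t v σ - Q.gradient t v' σ) (v - v')
      = 2 * inner ℝ (Q.A σ (Q.D (v - v'))) (Q.D (v - v')) := by
    rw [inner_sub_left, Q.inner_gradient, Q.inner_gradient, sub_sub_sub_cancel_right, ← mul_sub,
      ← inner_sub_left, ← map_sub, add_sub_add_right_eq_sub, ← map_sub]
  have := Q.A_coercive σ hσ (Q.D (v - v'))
  rw [Q.norm_D] at this
  rw [e]; linarith

/-- Lax–Milgram: the linear part of the gradient is coercive, hence invertible, and the loads form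
the right-hand side. -/
lemma exists_gradient_eq_zero (t : ℝ) {σ : ℝ} (hσ : σ ∈ Icc Q.a Q.b) :
    ∃ v, Q.gradient t v σ = 0 := by
  obtain ⟨L, hLdef⟩ : ∃ L : V →L[ℝ] V,
      ∀ x, L x = ContinuousLinearMap.adjoint Q.D (Q.A σ (Q.D x)) :=
    ⟨ContinuousLinearMap.adjoint Q.D ∘L Q.A σ ∘L Q.D, fun _ => rfl⟩
  have hL : IsUnit L := by
    refine ContinuousLinearMap.isUnit_of_forall_le_norm_inner_map L (c := Q.c.toNNReal)
      (Real.toNNReal_pos.2 Q.c_pos) fun x => ?_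
    have h2 := Q.A_coercive σ hσ (Q.D x)
    rw [Q.norm_D] at h2
    rw [hLdef, ContinuousLinearMap.adjoint_inner_left, Real.coe_toNNReal _ Q.c_pos.le, mul_comm]
    exact h2.trans (le_abs_self _)
  obtain ⟨v, hv⟩ := (ContinuousLinearMap.isUnit_iff_bijective.1 hL).2
    ((2 : ℝ)⁻¹ • ContinuousLinearMap.adjoint Q.Tr (Q.g t)
      - ContinuousLinearMap.adjoint Q.D (Q.A σ (Q.p t)))
  refine ⟨v, ?_⟩
  rw [hLdef] at hv
  rw [gradient, map_add, map_add, hv]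
  simp

/-- The exceptional null set is that of the derivatives of the three loads. It does not depend on
the curves, so one set serves all flows at once. -/
lemma hasDerivWithinAt_energy : ∀ᵐ t ∂volume.restrict (Icc 0 Q.T),
    ∀ (v : ℝ → V) (s : ℝ → ℝ) (v' : V) (s' : ℝ), (∀ τ ∈ Icc 0 Q.T, s τ ∈ Icc Q.a Q.b) →
    HasDerivWithinAt v v' (Icc 0 Q.T) t → HasDerivWithinAt s s' (Icc 0 Q.T) t →
    HasDerivWithinAt (fun τ => Q.energy τ (v τ) (s τ))
      (Q.power t (v t) (s t) + inner ℝ (Q.gradient t (v t) (s t)) v' + Q.slope t (v t) (s t) * s')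
      (Icc 0 Q.T) t := by
  filter_upwards [Q.p_load.deriv, Q.g_load.deriv, Q.k_load.deriv,
    ae_restrict_mem measurableSet_Icc] with t hp hg hk ht v s v' s' hs hv hs'
  have hA : HasDerivWithinAt (fun τ => Q.A (s τ)) (s' • Q.A' (s t)) (Icc 0 Q.T) t :=
    (Q.hasDerivWithinAt_A (hs t ht)).scomp t hs' hs
  have hξ : HasDerivWithinAt (fun τ => Q.D (v τ) + Q.p τ) (Q.D v' + Q.p' t) (Icc 0 Q.T) t :=
    (Q.D.hasFDerivAt.comp_hasDerivWithinAt t hv).add hp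
  have hTr : HasDerivWithinAt (fun τ => Q.Tr (v τ) + Q.k τ) (Q.Tr v' + Q.k' t) (Icc 0 Q.T) t :=
    (Q.Tr.hasFDerivAt.comp_hasDerivWithinAt t hv).add hk
  refine ((((hA.clm_apply hξ).inner ℝ hξ).add hs').sub (hg.inner ℝ hTr)).congr_deriv ?_
  rw [Q.inner_gradient, power, slope]
  have e1 := Q.A_symm (s t) (hs t ht) (Q.D v' + Q.p' t) (Q.D (v t) + Q.p t)
  rw [real_inner_comm] at e1
  rw [inner_add_left, real_inner_comm _ (Q.A (s t) (Q.D v' + Q.p' t)), e1]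
  simp only [smul_apply, real_inner_smul_left, inner_add_right, inner_add_left,
    real_inner_comm (Q.A (s t) (Q.D (v t) + Q.p t)) (Q.D v'),
    real_inner_comm (Q.A (s t) (Q.D (v t) + Q.p t)) (Q.p' t)]
  ring

/-- The energy system of a quadratic energy. -/
def toEnergySystem : EnergySystem V where
  T := Q.T
  a := Q.a
  b := Q.b
  E := Q.energy
  G := Q.gradient
  S := Q.slope
  P := Q.power
  c := 2 * Q.c
  T_pos := Q.T_pos
  a_lt_b := Q.a_lt_b
  c_pos := mul_pos two_pos Q.c_pos
  E_lip R := lip_of_bddLipOn (Q.energy_lip R)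
  G_lip R := lip_of_bddLipOn (Q.gradient_lip R)
  S_lip R := lip_of_bddLipOn (Q.slope_lip R)
  P_bound := Q.power_bound
  P_cont := Eventually.of_forall Q.power_continuousOn
  P_meas := Q.power_aestronglyMeasurable
  monotone t _ _ hσ := Q.gradient_monotone t hσ
  chain := Q.hasDerivWithinAt_energy
  exists_zero t _ _ hσ := Q.exists_gradient_eq_zero t hσ

end QuadraticData

/-! ### Transfer to the crack model. -/

namespace EnergySystem

variable {V : Type*} [NormedAddCommGroup V] [InnerProductSpace ℝ V] {M : EnergySystem V}
  {lam : ℝ → ℝ} {u₀ : V} {ε : ℝ} {v : ℝ → V} {s : ℝ → ℝ}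

lemma IsFlow.exists_bound (h : M.IsFlow lam u₀ ε v s) : ∃ R, ∀ t ∈ Icc 0 M.T, ‖v t‖ ≤ R :=
  isCompact_Icc.exists_bound_of_continuousOn h.continuousOn_v

lemma IsFlow.continuousOn_G (h : M.IsFlow lam u₀ ε v s) :
    ContinuousOn (fun t => M.G t (v t) (s t)) (Icc 0 M.T) :=
  let ⟨R, hR⟩ := h.exists_bound
  continuousOn_comp_of_lip (M.G_lip R) h.continuousOn_v h.continuousOn_s h.mem hR

lemma IsFlow.continuousOn_S (h : M.IsFlow lam u₀ ε v s) :
    ContinuousOn (fun t => M.S t (v t) (s t)) (Icc 0 M.T) :=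
  let ⟨R, hR⟩ := h.exists_bound
  continuousOn_comp_of_lip (M.S_lip R) h.continuousOn_v h.continuousOn_s h.mem hR

end EnergySystem

namespace CrackModel

variable (M : CrackModel)

/-- `V` carries a priori only the seminorm `‖Dv‖₂`; the Poincaré inequality makes it definite, and
the norm and topology are unchanged. -/
instance normedAddCommGroupV : NormedAddCommGroup M.V :=
  NormedAddCommGroup.ofSeparation fun v hv => DirichletSpace.eq_zero_of_norm M.hasPoincare v hv

instance completeSpaceV : CompleteSpace M.V := M.completeSpace_V

/-- The energy of the crack model is a quadratic energy. -/
lemma exists_quadraticData : ∃ Q : QuadraticData M.V (L2Vec M.body)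
      (Lp ℝ 2 ((μH[1] : Measure E2).restrict M.neumann)),
    Q.T = M.T ∧ Q.a = M.σ₀ ∧ Q.b = M.σbar ∧
      ∀ t v, ∀ σ ∈ Icc M.σ₀ M.σbar, M.F t v σ = Q.energy t v σ := by
  obtain ⟨A, hA, hAF, hsymm, c, hc, hcoer⟩ := M.exists_coeffOp
  obtain ⟨Tr, hTr⟩ := M.exists_trace_V
  obtain ⟨Tr', hTr'⟩ := M.exists_trace_Ω
  obtain ⟨R, hR⟩ := M.exists_restrict_grad
  obtain ⟨ψ', hψ'⟩ := M.ψ_mem.exists_isLipLoad M.T_pos.le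
  obtain ⟨g', hg'⟩ := M.g_mem.exists_isLipLoad M.T_pos.le
  let D : M.V →L[ℝ] L2Vec M.body :=
    (DirichletSpace.grad : M.V →ₗ[ℝ] L2Vec M.body).mkContinuous 1 fun v => by
      rw [one_mul]; exact (DirichletSpace.norm_eq_norm_grad v).ge
  refine ⟨{ T := M.T, a := M.σ₀, b := M.σbar, T_pos := M.T_pos, a_lt_b := M.σ₀_lt_σbar
            D := D, norm_D := fun v => (DirichletSpace.norm_eq_norm_grad v).symm
            Tr := Tr, A := A, A_contDiff := hA, A_symm := hsymm, c := c, c_pos := hc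
            A_coercive := hcoer, p := _, p' := _, p_load := hψ'.clm R
            g := M.g, g' := g', g_load := hg', k := _, k' := _, k_load := hψ'.clm Tr' },
    rfl, rfl, rfl, fun t v σ hσ => ?_⟩
  exact M.F_eq hAF hTr hTr' hR rfl t v hσ

section Derivatives

variable {M} {Q : QuadraticData M.V (L2Vec M.body)
  (Lp ℝ 2 ((μH[1] : Measure E2).restrict M.neumann))}
  (hF : ∀ t v, ∀ σ ∈ Icc Q.a Q.b, M.F t v σ = Q.energy t v σ)
include hF

lemma isGradV_gradient (t : ℝ) (v : M.V) {σ : ℝ} (hσ : σ ∈ Icc Q.a Q.b) :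
    M.IsGradV t v σ (Q.gradient t v σ) := by
  have h : (fun w : M.V => M.F t w σ) = fun w => Q.energy t w σ := funext fun w => hF t w σ hσ
  rw [IsGradV, h]
  exact Q.hasFDerivAt_gradient v hσ

lemma dσF_eq_slope (ha : Q.a = M.σ₀) (hb : Q.b = M.σbar) (t : ℝ) (v : M.V) {σ : ℝ}
    (hσ : σ ∈ Icc Q.a Q.b) : M.dσF t v σ = Q.slope t v σ := by
  rw [dσF, ← ha, ← hb]
  exact ((Q.hasDerivWithinAt_slope v hσ).congr (fun s hs => hF t v s hs)
    (hF t v σ hσ)).derivWithin (uniqueDiffOn_Icc Q.a_lt_b σ hσ)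

/-- The chain rule along constant curves gives the partial derivative in time, off a null set common
to all `(v, σ)`. Hence the identity may be evaluated along a moving state. -/
lemma dtF_eq_power (hT : Q.T = M.T) : ∀ᵐ t ∂volume.restrict (Icc 0 Q.T), ∀ (v : M.V),
    ∀ σ ∈ Icc Q.a Q.b, M.dtF t v σ = Q.power t v σ := by
  filter_upwards [Q.hasDerivWithinAt_energy, ae_restrict_mem measurableSet_Icc] with t h ht v σ hσ
  have h1 := h (fun _ => v) (fun _ => σ) 0 0 (fun _ _ => hσ) (hasDerivWithinAt_const _ _ _)
    (hasDerivWithinAt_const _ _ _)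
  rw [inner_zero_right, mul_zero, add_zero, add_zero] at h1
  rw [dtF, ← hT]
  exact (h1.congr (fun s _ => hF s v σ hσ) (hF t v σ hσ)).derivWithin
    (uniqueDiffOn_Icc Q.T_pos t ht)

lemma isGradientFlow_of_isFlow (hT : Q.T = M.T) (ha : Q.a = M.σ₀) (hb : Q.b = M.σbar)
    {lam : ℝ → ℝ} (hlam : ContinuousOn lam (Icc Q.a Q.b)) {u₀ : M.V} {ε : ℝ} (hε : 0 < ε)
    {v : ℝ → M.V} {σ : ℝ → ℝ} (h : Q.toEnergySystem.IsFlow lam u₀ ε v σ) :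
    M.IsGradientFlow lam u₀ ε v σ := by
  have hmem : ∀ t ∈ Icc 0 Q.T, σ t ∈ Icc Q.a Q.b := h.mem
  refine ⟨?_, ?_, ⟨fun t => -(ε⁻¹ • Q.gradient t (v t) (σ t)), ?_, fun t ht => ⟨?_, ?_⟩⟩,
    ⟨fun t => ε⁻¹ * (max (-Q.slope t (v t) (σ t)) 0 * lam (σ t)), ?_, fun t ht => ⟨?_, ?_⟩⟩,
    h.init_v, h.init_s.trans ha⟩
  · rw [← hT, ← ha, ← hb]; exact hmem
  · rw [← hT]; exact h.monotone
  · rw [← hT]; exact (h.continuousOn_G.const_smul ε⁻¹).neg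
  · rw [← hT] at ht ⊢; exact h.deriv_v t ht
  · rw [← hT] at ht
    rw [smul_neg, neg_neg, smul_inv_smul₀ hε.ne']
    exact isGradV_gradient hF t (v t) (hmem t ht)
  · rw [← hT]
    exact continuousOn_const.mul (((continuous_id.max continuous_const).comp_continuousOn
      h.continuousOn_S.neg).mul (hlam.comp h.continuousOn_s h.mem))
  · rw [← hT] at ht ⊢; exact h.deriv_s t ht
  · rw [← hT] at ht
    rw [dσF_eq_slope hF ha hb t (v t) (hmem t ht), mul_inv_cancel_left₀ hε.ne']

/-- The two energies agree only for `σ` in the closed interval, which suffices because the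
derivative in `σ` is taken within it. The time derivatives agree almost everywhere, which suffices
under the integral. -/
lemma isApproximableEvolution_of_isEvolution (hT : Q.T = M.T) (ha : Q.a = M.σ₀)
    (hb : Q.b = M.σbar) {lam : ℝ → ℝ} (hlam : ContinuousOn lam (Icc Q.a Q.b)) {u₀ : M.V}
    {v : ℝ → M.V} {σ : ℝ → ℝ} (h : Q.toEnergySystem.IsEvolution lam u₀ v σ) :
    M.IsApproximableEvolution lam u₀ v σ := by
  have hmem : ∀ t ∈ Icc 0 Q.T, σ t ∈ Icc Q.a Q.b := h.mem
  have hpow : ∀ᵐ t ∂volume.restrict (Icc 0 Q.T),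
      Q.power t (v t) (σ t) = M.dtF t (v t) (σ t) := by
    filter_upwards [dtF_eq_power hF hT, ae_restrict_mem measurableSet_Icc] with t h1 ht
    exact (h1 (v t) (σ t) (hmem t ht)).symm
  refine ⟨?_, ?_, fun t ht => ?_, fun t ht => ?_, ?_, ?_, fun s t hs hst ht => ?_, ?_⟩
  · rw [← hT, ← ha, ← hb]; exact hmem
  · rw [← hT]; exact h.left_continuous
  · rw [← hT] at ht
    have h1 : Q.gradient t (v t) (σ t) = 0 := h.equilibrium t ht
    rw [← h1]
    exact isGradV_gradient hF t (v t) (hmem t ht)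
  · rw [← hT] at ht
    rw [dσF_eq_slope hF ha hb t (v t) (hmem t ht)]
    exact h.stability t ht
  · rw [← hT]; exact h.irreversibility
  · rw [intervalIntegrable_iff_integrableOn_Icc_of_le M.T_pos.le, ← hT]
    exact h.energy_integrable.congr hpow
  · rw [← hT] at ht
    have h1 : ∫ τ in s..t, M.dtF τ (v τ) (σ τ) = ∫ τ in s..t, Q.power τ (v τ) (σ τ) := by
      rw [intervalIntegral.integral_of_le hst.le, intervalIntegral.integral_of_le hst.le]
      refine integral_congr_ae ?_
      have hsub : Ioc s t ⊆ Icc 0 Q.T := Ioc_subset_Icc_self.trans (Icc_subset_Icc hs ht)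
      exact (ae_restrict_of_ae_restrict_of_subset hsub hpow).mono fun τ hτ => hτ.symm
    rw [h1, hF t (v t) _ (hmem t ⟨hs.trans hst.le, ht⟩), hF s (v s) _ (hmem s ⟨hs, hst.le.trans ht⟩)]
    exact h.energy_inequality s t hs hst ht
  · obtain ⟨ε, vε, σε, h1, h2, h3, h4⟩ := h.approximable
    refine ⟨ε, vε, σε, h1, h2,
      fun n => isGradientFlow_of_isFlow hF hT ha hb hlam (h1 n) (h3 n), ?_⟩
    rw [← hT]; exact h4

end Derivatives

lemma IsCutoff.nonneg {M : CrackModel} {σ₁ : ℝ} {lam : ℝ → ℝ} (h : M.IsCutoff σ₁ lam) {σ : ℝ}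
    (hσ : σ ∈ Icc M.σ₀ M.σbar) : 0 ≤ lam σ := by
  rcases le_or_gt σ σ₁ with h1 | h1
  · rw [h.eq_one σ ⟨hσ.1, h1⟩]; exact zero_le_one
  · rcases hσ.2.eq_or_lt with h2 | h2
    · rw [h2, h.eq_zero]
    · exact (h.pos σ ⟨h1, h2⟩).le

end CrackModel

end

theorem theorem3p6 (M : CrackModel) (σ₁ : ℝ) (hσ₁ : σ₁ ∈ Set.Ioo M.σ₀ M.σbar)
    (lam : ℝ → ℝ) (hlam : M.IsCutoff σ₁ lam)
    (u₀ : M.V) (hu₀ : M.IsGradV 0 u₀ M.σ₀ 0) :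
    ∃ (v : ℝ → M.V) (σ : ℝ → ℝ), M.IsApproximableEvolution lam u₀ v σ := by
  obtain ⟨Q, hT, ha, hb, hF⟩ := M.exists_quadraticData
  obtain ⟨K, hK⟩ := hlam.lipschitz
  have hF' : ∀ t v, ∀ σ ∈ Icc Q.a Q.b, M.F t v σ = Q.energy t v σ := by rwa [ha, hb]
  have hK' : LipschitzOnWith K lam (Icc Q.a Q.b) := by rwa [ha, hb]
  obtain ⟨v, σ, h⟩ := Q.toEnergySystem.exists_evolution hK'
    (fun σ (hσ : σ ∈ Icc Q.a Q.b) => hlam.nonneg (by rwa [ha, hb] at hσ))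
    (show lam Q.b = 0 by rw [hb]; exact hlam.eq_zero) u₀
  exact ⟨v, σ, CrackModel.isApproximableEvolution_of_isEvolution hF' hT ha hb hK'.continuousOn h⟩
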